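/- Let $\nu\ge 0$ and $m\ge 1$ be integers, $n=2\nu+3$ (so that $n-2=2\nu+1$), and let $a_1,\dots,a_m>0$ be pairwise distinct. Define $b_0,b_2,\dots,b_{2m}$ by $\sum_{k=0}^m b_{2k}\chi^{2k}=\prod_{i=1}^m(\chi^2-a_i^2)$ and put $$P(\partial_x,\partial_t):=\sum_{k=0}^m b_{2k}\,\Delta^{m-k}\frac{\partial^{2k}}{\partial t^{2k}}=\prod_{i=1}^m\Big(\frac{\partial^2}{\partial t^2}-a_i^2\Delta\Big),\qquad x\in\mathbb R^n,\ t>0 ,$$ where $\Delta$ is the Laplacian on $\mathbb R^n$. Let $\varphi_0,\dots,\varphi_{2m-1}\in C^\infty(\mathbb R^n)$ and let $f$ be a function on $\mathbb R^n\times[0,\infty)$ such that $f(\cdot,t)\in C^\infty(\mathbb R^n)$ for all $t\ge0$ and every $x$-derivative of $f$ is continuous on $\mathbb R^n\times[0,\infty)$; all functions are real valued, or all are complex valued. Notation. Put $w_j:=a_j^{2m-2}\big/\prod_{i\ne j}(a_j^2-a_i^2)$. For an integer $q\ge1$ put $(I^qh)(t):=\int_0^t\frac{(t-s)^{q-1}}{(q-1)!}h(s)\,ds$,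 and put $I^0h:=h$. Put $(Lh)(t):=\int_0^t h(s)\,s\,ds$, and let $L^\nu$ be its $\nu$-th iterate. For $g\in C^\infty(\mathbb R^n)$ and $\tau\ge0$ let $$(J_jg)(x,\tau):=\tau\; L^\nu\Big[\rho\mapsto (a_j^2\Delta_x)^\nu\,\frac{1}{2(2\pi)^{\nu+1}(a_j\rho)^{n-1}}\int_{|\xi-x|=a_j\rho}g(\xi)\,dS(\xi)\Big](\tau),$$ where $dS$ is the surface element of the sphere; $(J_jg)(x,0)=0$. Theorem. A function $u$ on $\mathbb R^n\times[0,\infty)$ is a solution, of class $C^{2m}$ on $\mathbb R^n\times[0,\infty)$, of the Cauchy problem $$P(\partial_x,\partial_t)u=f(x,t)\quad(x\in\mathbb R^n,\ t>0),\qquad \frac{\partial^r u}{\partial t^r}\Big|_{t=0}=\varphi_r(x)\quad(r=0,1,\dots,2m-1)$$ (with one-sided $t$-derivatives at $t=0$) if and only if, for all $x\in\mathbb R^n$ and $t\ge 0$, $$\begin{aligned} u(x,t)={}&\int_0^t \Big(I^{2m-2}\Big[\tau'\mapsto\sum_{j=1}^m w_j\,\big(J_jf(\cdot,\tau)\big)(x,\tau')\Big]\Big)(t-\tau)\,d\tau\\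 &+\int_0^t\sum_{j=1}^m w_j\sum_{l=0}^{\nu-1}\frac{a_j^{2l}(t-\tau)^{2l+2m-1}}{(2l+2m-1)!}\,\Delta^l f(x,\tau)\,d\tau\\ &+\sum_{k=0}^m b_{2k}\Delta^{m-k}\sum_{r=0}^{2k-1}\frac{\partial^{2k-1-r}}{\partial t^{2k-1-r}}\Big(I^{2m-2}\Big[\tau\mapsto\sum_{j=1}^m w_j\,(J_j\varphi_r)(x,\tau)\Big]\Big)(t)\\ &+\sum_{k=0}^m b_{2k}\Delta^{m-k}\sum_{r=0}^{2k-1}\sum_{j=1}^m w_j\sum_{l=0}^{\nu-1}\frac{a_j^{2l}\,t^{2l+2m+r-2k}}{(2l+2m+r-2k)!}\,\Delta^l\varphi_r(x). \end{aligned}$$ In particular the Cauchy problem has exactly one solution of class $C^{2m}$, and it is given by this formula. -/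

import Mathlib

open MeasureTheory Set
open scoped Laplacian ContDiff

namespace MultipleWave

noncomputable section

/-- The coefficients `b 0, b 2, …, b (2m)`, determined by
`∑ k ≤ m, b (2k) χ ^ (2k) = ∏ i, (χ ^ 2 - a i ^ 2)`; `symbolCoeff a p` is `b p`. -/
def symbolCoeff {m : ℕ} (a : Fin m → ℝ) (p : ℕ) : ℝ :=
  (∏ i, (Polynomial.X ^ 2 - Polynomial.C (a i ^ 2)) : Polynomial ℝ).coeff p

/-- The weight `a_j ^ (2m-2) / ∏_{i ≠ j} (a_j ^ 2 - a_i ^ 2)`. -/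
def weight {m : ℕ} (a : Fin m → ℝ) (j : Fin m) : ℝ :=
  a j ^ (2 * m - 2) / ∏ i ∈ Finset.univ.erase j, (a j ^ 2 - a i ^ 2)

variable {n : ℕ} {𝕜 : Type*} [RCLike 𝕜]

/-- `P(∂_x, ∂_t) u = ∑ k ≤ m, b (2k) Δ^(m-k) ∂_t^(2k) u` at the point `(x, t)`. -/
def waveOp {m : ℕ} (a : Fin m → ℝ) (u : EuclideanSpace ℝ (Fin n) → ℝ → 𝕜)
    (x : EuclideanSpace ℝ (Fin n)) (t : ℝ) : 𝕜 :=
  ∑ k ∈ Finset.range (m + 1), symbolCoeff a (2 * k) •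
    (Δ^[m - k] fun y => iteratedDeriv (2 * k) (u y) t) x

/-- `u` is a classical solution of the Cauchy problem: it is of class `C^{2m}` on `ℝⁿ × [0, ∞)`,
satisfies `P(∂_x, ∂_t) u = f` for `t > 0`, and its one-sided time derivatives of order
`r = 0, …, 2m - 1` at `t = 0` are the `φ r`. Values of `u` at negative times play no role. -/
structure IsCauchySolution {m : ℕ} (a : Fin m → ℝ)
    (f : EuclideanSpace ℝ (Fin n) → ℝ → 𝕜) (φ : ℕ → EuclideanSpace ℝ (Fin n) → 𝕜)
    (u : EuclideanSpace ℝ (Fin n) → ℝ → 𝕜) : Prop where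
  contDiffOn : ContDiffOn ℝ ((2 * m : ℕ) : WithTop ℕ∞)
    (fun p : EuclideanSpace ℝ (Fin n) × ℝ => u p.1 p.2) (univ ×ˢ Ici 0)
  equation : ∀ x t, 0 < t → waveOp a u x t = f x t
  initial : ∀ r < 2 * m, ∀ x, iteratedDerivWithin r (u x) (Ici 0) 0 = φ r x

/-- Surface integral `∫_S g dS` over the sphere `S = {ξ : |ξ - x| = ρ}` in `ℝⁿ`, `ρ ≥ 0`:
the image of the surface measure of the unit sphere under `θ ↦ x + ρ θ`, scaled by `ρ^(n-1)`. -/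
def sphereIntegral (g : EuclideanSpace ℝ (Fin n) → 𝕜) (x : EuclideanSpace ℝ (Fin n))
    (ρ : ℝ) : 𝕜 :=
  ρ ^ (n - 1) • ∫ θ : Metric.sphere (0 : EuclideanSpace ℝ (Fin n)) 1,
    g (x + ρ • (θ : EuclideanSpace ℝ (Fin n)))
      ∂((volume : Measure (EuclideanSpace ℝ (Fin n))).toSphere)

/-- The operator `h ↦ ∫₀ᵗ h(s) s ds`. -/
def weightedIntegral (h : ℝ → 𝕜) (t : ℝ) : 𝕜 := ∫ s in (0 : ℝ)..t, s • h s

/-- Convolution with `t^(q-1) / (q-1)!`, that is `h ↦ ∫₀ᵗ (t - s)^(q-1) / (q-1)! h(s) ds`,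
the `q`-fold iterated integral from `0`. For `q = 0` the kernel `t^(-1) / (-1)!` is, as usual,
the Dirac mass at `0` (Laplace transform `1`), so that the operator is the identity. -/
def iterIntegral (q : ℕ) (h : ℝ → 𝕜) (t : ℝ) : 𝕜 :=
  if q = 0 then h t
  else ∫ s in (0 : ℝ)..t, ((t - s) ^ (q - 1) / ((q - 1).factorial : ℝ)) • h s

/-- The term `τ ∫₀^τ τ dτ ⋯ ∫₀^τ (α² Δ)^ν (1 / S) ∫_S g dS τ dτ` (`ν` iterated integrals in all),
where `S` is the sphere of centre `x` and radius `α τ`, and where the normalising factor `1 / S`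
stands for `1 / (2 (2π)^(ν+1) (α τ)^(n-1))`. The Laplacian acts in the centre `x`. -/
def sphericalTerm (ν : ℕ) (α : ℝ) (g : EuclideanSpace ℝ (Fin n) → 𝕜)
    (x : EuclideanSpace ℝ (Fin n)) (τ : ℝ) : 𝕜 :=
  τ • (weightedIntegral^[ν] fun ρ => (α ^ 2) ^ ν •
    (Δ^[ν] fun y => (1 / (2 * (2 * Real.pi) ^ (ν + 1) * (α * ρ) ^ (n - 1))) •
      sphereIntegral g y (α * ρ)) x) τ

/-- The explicit formula for the solution of the Cauchy problem. -/
def solutionFormula (ν : ℕ) {m : ℕ} (a : Fin m → ℝ)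
    (f : EuclideanSpace ℝ (Fin n) → ℝ → 𝕜) (φ : ℕ → EuclideanSpace ℝ (Fin n) → 𝕜)
    (x : EuclideanSpace ℝ (Fin n)) (t : ℝ) : 𝕜 :=
  (∫ τ in (0 : ℝ)..t, iterIntegral (2 * m - 2)
      (fun τ' => ∑ j, weight a j • sphericalTerm ν (a j) (fun y => f y τ) x τ') (t - τ))
  + (∫ τ in (0 : ℝ)..t, ∑ j, weight a j • ∑ l ∈ Finset.range ν,
      (a j ^ (2 * l) * (t - τ) ^ (2 * l + 2 * m - 1) / ((2 * l + 2 * m - 1).factorial : ℝ)) •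
        (Δ^[l] fun y => f y τ) x)
  + (∑ k ∈ Finset.range (m + 1), symbolCoeff a (2 * k) •
      (Δ^[m - k] fun y => ∑ r ∈ Finset.range (2 * k),
        iteratedDerivWithin (2 * k - 1 - r)
          (iterIntegral (2 * m - 2)
            fun τ => ∑ j, weight a j • sphericalTerm ν (a j) (φ r) y τ) (Ici 0) t) x)
  + (∑ k ∈ Finset.range (m + 1), symbolCoeff a (2 * k) •
      (Δ^[m - k] fun y => ∑ r ∈ Finset.range (2 * k),
        ∑ j, weight a j • ∑ l ∈ Finset.range ν,
          (a j ^ (2 * l) * t ^ (2 * l + 2 * m + r - 2 * k) /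
              ((2 * l + 2 * m + r - 2 * k).factorial : ℝ)) • (Δ^[l] (φ r)) y) x)

end

end MultipleWave

/-!
Integrating the equation `2m` times in time turns the Cauchy problem into an algebraic one. Let `J`
be the integral in time from `0` and put `z = J² Δ`. These operators act on the space of
`Evolution`s, the functions of time and position that are smooth in the position with jointly
continuous derivatives; time runs through all of `ℝ`. A solution `u` with initial values `φ r`
satisfies `∏ i, (1 - a_i² z) u = integratedData`, the right-hand side being `J^{2m} f` corrected by
polynomials in `t` formed from the `φ r`.

Each factor is invertible. If `D_i` is Duhamel's operator for the wave equation
`∂_t² w = a_i² Δ w + F`, then `D_i = J² + a_i² J² D_i Δ` (`duhamel_eq`), and as `D_i` commutes with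
`J` and `Δ`, the inverse of `1 - a_i² z` is `waveResolvent = 1 + a_i² Δ D_i`. Because of the partial
fractions `∑ j, w_j ∏_{i ≠ j} (1 - a_i² X) = 1`, which is Lagrange interpolation of the constant `1`
at the nodes `a_i⁻²` (`sum_weight_prod_one_sub`), the weighted sum `integratedResolvent` of these
inverses inverts the whole product. Applied to the data it is the explicit formula
(`solutionFormula_eq`).

Duhamel's operator rests on `wavePropagator_eq`: in dimension `2ν + 3`, the spherical part plus a
Taylor polynomial of degree `2ν - 1` solves the wave equation with initial velocity `g`. Spherical
means satisfy the Euler–Poisson–Darboux equation (`pow_smul_deriv_unitSphereIntegral`), whose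
singular coefficient is lowered by two with every weighted integration `h ↦ ∫₀ᵗ h(s) s ds`
(`darboux_descent`); after `ν` of them it is gone.

That the formula is a solution of class `C^{2m}` is read off the integrated equation:
it gains two time integrations per step when solved for its leading term (`sub_sum_mem_range`), so
that the solution has `2m` time derivatives which are again evolutions (`exists_timeDerivatives`),
and this gives joint smoothness (`contDiff_uncurry_of_timeDerivatives`).

A classical solution is only `C^{2m}`, not an evolution. Uniqueness follows by mollifying in the
position: the difference of two mollified solutions consists of evolutions, its integrated symbol
vanishes at nonnegative times, and `integratedResolvent` preserves this property, Duhamel's operator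
being causal (`mem_vanishingForward_of_timeDerivatives`). Since continuous functions are determined
by their mollifications, two classical solutions agree at nonnegative times.
-/

namespace MultipleWave

open Function Filter Topology

set_option linter.unusedSectionVars false

/-! ### Smooth families -/

section SmoothFamily

variable {X Y Q E W V : Type*} [TopologicalSpace X] [TopologicalSpace Y]
  [NormedAddCommGroup E] [NormedSpace ℝ E] [NormedAddCommGroup W] [NormedSpace ℝ W]
  [NormedAddCommGroup V] [NormedSpace ℝ V]

/-- A family `F p` of smooth functions on `E`, depending continuously on the parameter `p` in the
sense that all derivatives with respect to the point are jointly continuous in parameter and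
point. No differentiability in the parameter is required. -/
structure SmoothFamily (F : X → E → W) : Prop where
  contDiff : ∀ p, ContDiff ℝ ∞ (F p)
  continuous_iteratedFDeriv : ∀ k : ℕ,
    Continuous fun z : X × E => iteratedFDeriv ℝ k (F z.1) z.2

namespace SmoothFamily

variable {F G : X → E → W}

theorem continuous (hF : SmoothFamily F) : Continuous fun z : X × E => F z.1 z.2 := by
  have h := (continuousMultilinearCurryFin0 ℝ E W).continuous.comp
    (hF.continuous_iteratedFDeriv 0)
  simpa [Function.comp_def] using h

theorem continuous_left (hF : SmoothFamily F) (x : E) : Continuous fun p => F p x :=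
  hF.continuous.comp (by fun_prop : Continuous fun p : X => (p, x))

theorem contDiffAt (hF : SmoothFamily F) (p : X) (k : ℕ) (x : E) : ContDiffAt ℝ k (F p) x :=
  ((hF.contDiff p).of_le (by exact_mod_cast le_top)).contDiffAt

theorem contDiff_nat (hF : SmoothFamily F) (p : X) (k : ℕ) : ContDiff ℝ k (F p) :=
  (hF.contDiff p).of_le (by exact_mod_cast le_top)

theorem differentiable (hF : SmoothFamily F) (p : X) : Differentiable ℝ (F p) :=
  (hF.contDiff p).differentiable (by simp)

theorem const {g : E → W} (hg : ContDiff ℝ ∞ g) : SmoothFamily fun _ : X => g where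
  contDiff _ := hg
  continuous_iteratedFDeriv k :=
    (hg.continuous_iteratedFDeriv (m := k) (by exact_mod_cast le_top)).comp continuous_snd

theorem add (hF : SmoothFamily F) (hG : SmoothFamily G) :
    SmoothFamily fun p x => F p x + G p x where
  contDiff p := (hF.contDiff p).add (hG.contDiff p)
  continuous_iteratedFDeriv k := by
    have h : ∀ z : X × E, iteratedFDeriv ℝ k (fun x => F z.1 x + G z.1 x) z.2 =
        iteratedFDeriv ℝ k (F z.1) z.2 + iteratedFDeriv ℝ k (G z.1) z.2 := fun z =>
      iteratedFDeriv_add_apply (hF.contDiffAt _ _ _) (hG.contDiffAt _ _ _)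
    simp only [h]
    exact (hF.continuous_iteratedFDeriv k).add (hG.continuous_iteratedFDeriv k)

/-- Applying linear maps that depend continuously on the parameter preserves smooth families. -/
theorem clm_apply (hF : SmoothFamily F) {L : X → W →L[ℝ] V} (hL : Continuous L) :
    SmoothFamily fun p x => L p (F p x) where
  contDiff p := (L p).contDiff.comp (hF.contDiff p)
  continuous_iteratedFDeriv k := by
    have h : ∀ z : X × E, iteratedFDeriv ℝ k (fun x => L z.1 (F z.1 x)) z.2 =
        ContinuousLinearMap.compContinuousMultilinearMapL ℝ (fun _ : Fin k => E) W V (L z.1)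
          (iteratedFDeriv ℝ k (F z.1) z.2) := fun z =>
      (L z.1).iteratedFDeriv_comp_left (hF.contDiffAt _ k _) le_rfl
    simp only [h]
    exact ((ContinuousLinearMap.continuous _).comp (hL.comp continuous_fst)).clm_apply
      (hF.continuous_iteratedFDeriv k)

theorem smul {c : X → ℝ} (hc : Continuous c) (hF : SmoothFamily F) :
    SmoothFamily fun p x => c p • F p x :=
  hF.clm_apply (L := fun p => c p • ContinuousLinearMap.id ℝ W) (by fun_prop)

theorem smul_right {f : X → E → ℝ} (hf : SmoothFamily f) {c : X → W} (hc : Continuous c) :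
    SmoothFamily fun p x => f p x • c p :=
  hf.clm_apply (L := fun p => ContinuousLinearMap.smulRightL ℝ ℝ W 1 (c p)) (by fun_prop)

theorem sum {ι : Type*} (s : Finset ι) {F : ι → X → E → W} (hF : ∀ i ∈ s, SmoothFamily (F i)) :
    SmoothFamily fun p x => ∑ i ∈ s, F i p x := by
  classical
  induction s using Finset.induction_on with
  | empty => simpa using const (X := X) (contDiff_const (c := (0 : W)))
  | insert i s hi ih =>
    simp only [Finset.sum_insert hi]
    exact (hF i (by simp)).add (ih fun j hj => hF j (by simp [hj]))

/-- Reparametrisation combined with a translation depending continuously on the parameter. -/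
theorem translate (hF : SmoothFamily F) {π : Y → X} (hπ : Continuous π) {A : Y → E}
    (hA : Continuous A) : SmoothFamily fun q x => F (π q) (x + A q) where
  contDiff q := (hF.contDiff _).comp (contDiff_id.add contDiff_const)
  continuous_iteratedFDeriv k := by
    simp only [iteratedFDeriv_comp_add_right]
    exact (hF.continuous_iteratedFDeriv k).comp
      (by fun_prop : Continuous fun z : Y × E => (π z.1, z.2 + A z.1))

theorem comp (hF : SmoothFamily F) {π : Y → X} (hπ : Continuous π) :
    SmoothFamily fun q x => F (π q) x := by
  simpa using hF.translate hπ (A := fun _ => 0) continuous_const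

theorem fderiv (hF : SmoothFamily F) : SmoothFamily fun p => fderiv ℝ (F p) where
  contDiff p := (contDiff_infty_iff_fderiv.1 (hF.contDiff p)).2
  continuous_iteratedFDeriv k := by
    have h := (continuousMultilinearCurryRightEquiv' ℝ k E W).continuous.comp
      (hF.continuous_iteratedFDeriv (k + 1))
    simpa only [Function.comp_def, iteratedFDeriv_succ_eq_comp_right,
      LinearIsometryEquiv.apply_symm_apply] using h

/-- Being a smooth family is a local property of the point. -/
theorem of_locally (h : ∀ x₀ : E, ∃ G : X → E → W, SmoothFamily G ∧
    ∀ᶠ x in 𝓝 x₀, ∀ p, F p x = G p x) : SmoothFamily F where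
  contDiff p := contDiff_iff_contDiffAt.2 fun x₀ => by
    obtain ⟨G, hG, hFG⟩ := h x₀
    exact (hG.contDiff p).contDiffAt.congr_of_eventuallyEq (hFG.mono fun x hx => hx p)
  continuous_iteratedFDeriv k := continuous_iff_continuousAt.2 fun ⟨p₀, x₀⟩ => by
    obtain ⟨G, hG, hFG⟩ := h x₀
    refine (hG.continuous_iteratedFDeriv k).continuousAt.congr ?_
    have h1 : ∀ᶠ z in 𝓝 (p₀, x₀), ∀ᶠ x in 𝓝 z.2, ∀ p, F p x = G p x :=
      (continuous_snd.tendsto (p₀, x₀)).eventually hFG.eventually_nhds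
    filter_upwards [h1] with z hz
    exact (Filter.EventuallyEq.iteratedFDeriv ℝ (hz.mono fun x hx => (hx z.1).symm) k).self_of_nhds

end SmoothFamily

variable [TopologicalSpace Q] [MeasurableSpace Q] [BorelSpace Q] [SecondCountableTopology Q]
  [T2Space Q]
  {μ : Measure Q} [IsLocallyFiniteMeasure μ] {K : Set Q}

/-- Differentiation under an integral over a compact set. -/
theorem hasFDerivAt_setIntegral [FiniteDimensional ℝ E] (hK : IsCompact K) {F : Q → E → W}
    {F' : Q → E → E →L[ℝ] W} (hF : Continuous fun z : Q × E => F z.1 z.2)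
    (hF' : Continuous fun z : Q × E => F' z.1 z.2)
    (h : ∀ q x, HasFDerivAt (F q) (F' q x) x) (x₀ : E) :
    HasFDerivAt (fun x => ∫ q in K, F q x ∂μ) (∫ q in K, F' q x₀ ∂μ) x₀ := by
  have : ProperSpace E := FiniteDimensional.proper ℝ E
  have : SecondCountableTopology E := inferInstance
  obtain ⟨M, hM⟩ := (hK.prod (isCompact_closedBall x₀ 1)).bddAbove_image hF'.norm.continuousOn
  have hle : ∀ᵐ q ∂μ.restrict K, ∀ x ∈ Metric.closedBall x₀ 1, ‖F' q x‖ ≤ M := by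
    rw [ae_restrict_iff]
    · filter_upwards with q hq x hx using hM (mem_image_of_mem _ (mk_mem_prod hq hx))
    · have : {q | ∀ x ∈ Metric.closedBall x₀ 1, ‖F' q x‖ ≤ M} =
          ⋂ x ∈ Metric.closedBall x₀ 1, {q | ‖F' q x‖ ≤ M} := by ext; simp
      rw [this]
      exact (isClosed_biInter fun x _ => isClosed_le
        (hF'.comp (by fun_prop : Continuous fun q : Q => (q, x))).norm
          continuous_const).measurableSet
  refine hasFDerivAt_integral_of_dominated_of_fderiv_le (F := fun x q => F q x)
    (F' := fun x q => F' q x) (bound := fun _ => M)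
    (Metric.closedBall_mem_nhds x₀ one_pos) ?_ ?_ ?_ hle ?_ ?_
  · exact Eventually.of_forall fun x =>
      (hF.comp (by fun_prop : Continuous fun q : Q => (q, x))).aestronglyMeasurable
  · exact (hF.comp
      (by fun_prop : Continuous fun q : Q => (q, x₀))).continuousOn.integrableOn_compact hK
  · exact (hF'.comp (by fun_prop : Continuous fun q : Q => (q, x₀))).aestronglyMeasurable
  · exact integrableOn_const hK.measure_ne_top
  · exact Eventually.of_forall fun q x _ => h q x

variable [FirstCountableTopology X] [LocallyCompactSpace X] [FiniteDimensional ℝ E]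

theorem SmoothFamily.iteratedFDeriv_setIntegral (hK : IsCompact K) {F : Q → E → W}
    (hF : SmoothFamily F) (k : ℕ) (x : E) :
    iteratedFDeriv ℝ k (fun x => ∫ q in K, F q x ∂μ) x =
      ∫ q in K, iteratedFDeriv ℝ k (F q) x ∂μ := by
  induction k generalizing x with
  | zero =>
    simp only [iteratedFDeriv_zero_eq_comp, Function.comp_def]
    exact ((continuousMultilinearCurryFin0 ℝ E W).symm.toContinuousLinearEquiv.integral_comp_comm
      _).symm
  | succ k ih =>
    have ih' := funext ih
    simp only [iteratedFDeriv_succ_eq_comp_left, Function.comp_def]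
    rw [ih']
    have hd : ∀ q x, HasFDerivAt (iteratedFDeriv ℝ k (F q))
        (_root_.fderiv ℝ (iteratedFDeriv ℝ k (F q)) x) x := fun q x =>
      (((hF.contDiff q).differentiable_iteratedFDeriv (m := k)
        (by exact_mod_cast WithTop.coe_lt_top _)) x).hasFDerivAt
    have hc : Continuous fun z : Q × E => _root_.fderiv ℝ (iteratedFDeriv ℝ k (F z.1)) z.2 := by
      have := (continuousMultilinearCurryLeftEquiv ℝ (fun _ : Fin (k + 1) => E) W).continuous.comp
        (hF.continuous_iteratedFDeriv (k + 1))
      simpa only [Function.comp_def, iteratedFDeriv_succ_eq_comp_left,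
        LinearIsometryEquiv.apply_symm_apply] using this
    rw [(hasFDerivAt_setIntegral hK (hF.continuous_iteratedFDeriv k) hc hd x).fderiv]
    exact (ContinuousLinearEquiv.integral_comp_comm (μ := μ.restrict K) (𝕜 := ℝ)
        (E := E →L[ℝ] E [×k]→L[ℝ] W)
      (F := E [×(k + 1)]→L[ℝ] W) (continuousMultilinearCurryLeftEquiv ℝ
      (fun _ : Fin (k + 1) => E) W).symm.toContinuousLinearEquiv
      fun q => _root_.fderiv ℝ (iteratedFDeriv ℝ k (F q)) x).symm

/-- Integrating out a parameter over a compact set preserves smooth families. -/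
theorem SmoothFamily.setIntegral (hK : IsCompact K) {F : X × Q → E → W}
    (hF : SmoothFamily F) : SmoothFamily fun p x => ∫ q in K, F (p, q) x ∂μ := by
  have : ProperSpace E := FiniteDimensional.proper ℝ E
  have hp : ∀ p, SmoothFamily fun q => F (p, q) := fun p =>
    hF.comp (by fun_prop : Continuous fun q : Q => (p, q))
  refine ⟨fun p => contDiff_of_differentiable_iteratedFDeriv fun k _ => ?_, fun k => ?_⟩
  · rw [funext ((hp p).iteratedFDeriv_setIntegral hK k)]
    intro x
    have hd : ∀ q x, HasFDerivAt (iteratedFDeriv ℝ k (F (p, q)))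
        (_root_.fderiv ℝ (iteratedFDeriv ℝ k (F (p, q))) x) x := fun q x =>
      (((hF.contDiff _).differentiable_iteratedFDeriv (m := k)
        (by exact_mod_cast WithTop.coe_lt_top _)) x).hasFDerivAt
    have hc : Continuous fun z : Q × E =>
        _root_.fderiv ℝ (iteratedFDeriv ℝ k (F (p, z.1))) z.2 := by
      have := (continuousMultilinearCurryLeftEquiv ℝ (fun _ : Fin (k + 1) => E) W).continuous.comp
        ((hp p).continuous_iteratedFDeriv (k + 1))
      simpa only [Function.comp_def, iteratedFDeriv_succ_eq_comp_left,
        LinearIsometryEquiv.apply_symm_apply] using this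
    exact (hasFDerivAt_setIntegral hK ((hp p).continuous_iteratedFDeriv k) hc hd x).differentiableAt
  · simp only [(hp _).iteratedFDeriv_setIntegral hK k]
    exact continuous_parametric_integral_of_continuous
      (f := fun (z : X × E) (q : Q) => iteratedFDeriv ℝ k (F (z.1, q)) z.2)
      ((hF.continuous_iteratedFDeriv k).comp
        (by fun_prop : Continuous fun z : (X × E) × Q => ((z.1.1, z.2), z.1.2))) hK

end SmoothFamily

/-! ### The Laplacian of smooth families -/

section Laplacian

variable {X Q E W : Type*} [TopologicalSpace X]
  [NormedAddCommGroup E] [InnerProductSpace ℝ E] [FiniteDimensional ℝ E]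
  [NormedAddCommGroup W] [NormedSpace ℝ W]

/-- The trace of a bilinear map with respect to the inner product of `E`. -/
noncomputable def bilinTrace (E W : Type*) [NormedAddCommGroup E] [InnerProductSpace ℝ E]
    [FiniteDimensional ℝ E] [NormedAddCommGroup W] [NormedSpace ℝ W] :
    (E →L[ℝ] E →L[ℝ] W) →L[ℝ] W :=
  ∑ i, (ContinuousLinearMap.apply ℝ W (stdOrthonormalBasis ℝ E i)).comp
    (ContinuousLinearMap.apply ℝ (E →L[ℝ] W) (stdOrthonormalBasis ℝ E i))

theorem laplacian_eq_bilinTrace (f : E → W) (x : E) :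
    (Δ f) x = bilinTrace E W (fderiv ℝ (fderiv ℝ f) x) := by
  rw [InnerProductSpace.laplacian_eq_iteratedFDeriv_stdOrthonormalBasis]
  simp [bilinTrace, iteratedFDeriv_two_apply]

theorem SmoothFamily.laplacian {F : X → E → W} (hF : SmoothFamily F) :
    SmoothFamily fun p => Δ (F p) := by
  have h := hF.fderiv.fderiv.clm_apply (L := fun _ => bilinTrace E W) continuous_const
  simpa only [← laplacian_eq_bilinTrace] using h

theorem SmoothFamily.laplacian_iterate {F : X → E → W} (hF : SmoothFamily F) (k : ℕ) :
    SmoothFamily fun p => Δ^[k] (F p) := by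
  induction k with
  | zero => exact hF
  | succ k ih =>
    simp only [Function.iterate_succ_apply']
    exact ih.laplacian

theorem contDiff_laplacian_iterate {g : E → W} (hg : ContDiff ℝ ∞ g) (k : ℕ) :
    ContDiff ℝ ∞ (Δ^[k] g) :=
  ((SmoothFamily.const (X := Unit) hg).laplacian_iterate k).contDiff ()

theorem laplacian_comp_add_right (f : E → W) (y : E) :
    (Δ fun x => f (x + y)) = fun x => (Δ f) (x + y) := by
  funext x
  simp only [laplacian_eq_bilinTrace]
  congr 1
  have : fderiv ℝ (fun x => f (x + y)) = fun x => fderiv ℝ f (x + y) := by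
    funext x
    exact fderiv_comp_add_right y
  rw [this, fderiv_comp_add_right]

theorem laplacian_iterate_comp_add_right (f : E → W) (y : E) (k : ℕ) :
    (Δ^[k] fun x => f (x + y)) = fun x => (Δ^[k] f) (x + y) := by
  induction k with
  | zero => rfl
  | succ k ih => simp only [Function.iterate_succ_apply', ih, laplacian_comp_add_right]

theorem fderiv_comp_neg_eq {g : E → W} (hg : Differentiable ℝ g) (x : E) :
    fderiv ℝ (fun x => g (-x)) x = -fderiv ℝ g (-x) := by
  have := (hg (-x)).hasFDerivAt.comp x (hasFDerivAt_id (𝕜 := ℝ) x).neg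
  simpa [Function.comp_def] using this.fderiv

theorem laplacian_comp_neg {f : E → W} (hf : ContDiff ℝ 2 f) (x : E) :
    (Δ fun x => f (-x)) x = (Δ f) (-x) := by
  have h1 : fderiv ℝ (fun x => f (-x)) = fun x => -fderiv ℝ f (-x) :=
    funext (fderiv_comp_neg_eq (hf.differentiable (by simp)))
  simp only [laplacian_eq_bilinTrace]
  congr 1
  rw [h1, fderiv_fun_neg,
    fderiv_comp_neg_eq ((hf.fderiv_right (m := 1) le_rfl).differentiable (by simp)), neg_neg]

variable [TopologicalSpace Q] [MeasurableSpace Q] [BorelSpace Q] [SecondCountableTopology Q]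
  [T2Space Q] {μ : Measure Q} [IsLocallyFiniteMeasure μ] {K : Set Q}

/-- The Laplacian of an integral of `C²` functions over a compact parameter set. -/
theorem laplacian_setIntegral [CompleteSpace W] (hK : IsCompact K) {F : Q → E → W}
    (hF : ∀ q, ContDiff ℝ 2 (F q)) (h0 : Continuous fun z : Q × E => F z.1 z.2)
    (h1 : Continuous fun z : Q × E => fderiv ℝ (F z.1) z.2)
    (h2 : Continuous fun z : Q × E => fderiv ℝ (fderiv ℝ (F z.1)) z.2) (x : E) :
    (Δ fun x => ∫ q in K, F q x ∂μ) x = ∫ q in K, (Δ (F q)) x ∂μ := by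
  have e1 : fderiv ℝ (fun x => ∫ q in K, F q x ∂μ) = fun x => ∫ q in K, fderiv ℝ (F q) x ∂μ :=
    funext fun x => (hasFDerivAt_setIntegral hK h0 h1
      (fun q x => (((hF q).differentiable (by simp)) x).hasFDerivAt) x).fderiv
  have e2 := (hasFDerivAt_setIntegral (μ := μ) hK h1 h2
      (fun q x => ((((hF q).fderiv_right (m := 1) le_rfl).differentiable (by simp)) x).hasFDerivAt)
      x).fderiv
  simp only [laplacian_eq_bilinTrace]
  rw [e1, e2]
  refine (ContinuousLinearMap.integral_comp_comm (𝕜 := ℝ) (E := E →L[ℝ] E →L[ℝ] W) (Fₗ := W)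
    (bilinTrace E W) (φ := fun q => fderiv ℝ (fderiv ℝ (F q)) x) ?_).symm
  exact (h2.comp (by fun_prop : Continuous fun q : Q => (q, x))).continuousOn.integrableOn_compact
    hK

theorem SmoothFamily.laplacian_setIntegral [CompleteSpace W] (hK : IsCompact K) {F : Q → E → W}
    (hF : SmoothFamily F) (x : E) :
    (Δ fun x => ∫ q in K, F q x ∂μ) x = ∫ q in K, (Δ (F q)) x ∂μ :=
  MultipleWave.laplacian_setIntegral hK (fun q => hF.contDiff_nat q 2) hF.continuous
    hF.fderiv.continuous hF.fderiv.fderiv.continuous x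

theorem SmoothFamily.laplacian_iterate_setIntegral [CompleteSpace W] (hK : IsCompact K)
    {F : Q → E → W} (hF : SmoothFamily F) (k : ℕ) :
    (Δ^[k] fun x => ∫ q in K, F q x ∂μ) = fun x => ∫ q in K, (Δ^[k] (F q)) x ∂μ := by
  induction k with
  | zero => rfl
  | succ k ih =>
    funext x
    simp only [Function.iterate_succ_apply', ih]
    exact (hF.laplacian_iterate k).laplacian_setIntegral hK x

end Laplacian

section IntervalIntegral

variable {X E W : Type*} [TopologicalSpace X]
  [NormedAddCommGroup E] [InnerProductSpace ℝ E] [FiniteDimensional ℝ E]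
  [NormedAddCommGroup W] [NormedSpace ℝ W]

/-- Scaling to the fixed compact interval `[0, 1]` reduces interval integrals with a variable
endpoint, of either sign, to integrals over a compact set. -/
theorem intervalIntegral_eq_smul_setIntegral (h : ℝ → W) (b : ℝ) :
    ∫ s in (0 : ℝ)..b, h s = b • ∫ r in Icc (0 : ℝ) 1, h (b * r) := by
  rw [integral_Icc_eq_integral_Ioc, ← intervalIntegral.integral_of_le zero_le_one,
    intervalIntegral.smul_integral_comp_mul_left]
  simp

/-- The interval integral of a smooth family up to an endpoint depending continuously on the
parameter is a smooth family. -/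
theorem SmoothFamily.intervalIntegral [FirstCountableTopology X] [LocallyCompactSpace X]
    {F : X × ℝ → E → W} (hF : SmoothFamily F) {b : X → ℝ} (hb : Continuous b) :
    SmoothFamily fun p x => ∫ s in (0 : ℝ)..b p, F (p, s) x := by
  simp only [intervalIntegral_eq_smul_setIntegral]
  refine SmoothFamily.smul hb (SmoothFamily.setIntegral (X := X) (Q := ℝ)
    (F := fun z => F (z.1, b z.1 * z.2)) isCompact_Icc ?_)
  exact hF.comp (by fun_prop : Continuous fun z : X × ℝ => (z.1, b z.1 * z.2))

theorem laplacian_const_smul (c : ℝ) {f : E → W} (hf : ContDiff ℝ 2 f) (x : E) :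
    (Δ fun x => c • f x) x = c • (Δ f) x :=
  InnerProductSpace.laplacian_smul c hf.contDiffAt

theorem SmoothFamily.laplacian_intervalIntegral [CompleteSpace W] {F : ℝ → E → W}
    (hF : SmoothFamily F) (b : ℝ) (x : E) :
    (Δ fun x => ∫ s in (0 : ℝ)..b, F s x) x = ∫ s in (0 : ℝ)..b, (Δ (F s)) x := by
  simp only [intervalIntegral_eq_smul_setIntegral]
  have hF' := hF.comp (by fun_prop : Continuous fun r : ℝ => b * r)
  have h1 : SmoothFamily fun (_ : Unit) x => ∫ r in Icc (0 : ℝ) 1, F (b * r) x :=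
    SmoothFamily.setIntegral (X := Unit) (Q := ℝ)
    (F := fun z => F (b * z.2)) isCompact_Icc (hF'.comp continuous_snd)
  rw [laplacian_const_smul b (h1.contDiff_nat () 2), hF'.laplacian_setIntegral isCompact_Icc]

theorem SmoothFamily.fderiv_intervalIntegral {F : ℝ → E → W}
    (hF : SmoothFamily F) (b : ℝ) (x : E) :
    _root_.fderiv ℝ (fun x => ∫ s in (0 : ℝ)..b, F s x) x =
      ∫ s in (0 : ℝ)..b, _root_.fderiv ℝ (F s) x := by
  simp only [intervalIntegral_eq_smul_setIntegral]
  have hF' := hF.comp (by fun_prop : Continuous fun r : ℝ => b * r)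
  have := hasFDerivAt_setIntegral (μ := volume) (K := Icc (0 : ℝ) 1) isCompact_Icc hF'.continuous
      hF'.fderiv.continuous
    (fun q x => (hF'.differentiable q x).hasFDerivAt) x
  exact (this.const_smul b).fderiv

end IntervalIntegral

/-! ### Primitives and convolutions in time -/

section Volterra

variable {W : Type*} [NormedAddCommGroup W] [NormedSpace ℝ W] [CompleteSpace W]

theorem hasDerivAt_primitive {h : ℝ → W} (hh : Continuous h) (t : ℝ) :
    HasDerivAt (fun t => ∫ s in (0 : ℝ)..t, h s) (h t) t :=
  intervalIntegral.integral_hasDerivAt_right (hh.intervalIntegrable _ _)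
    hh.stronglyMeasurable.stronglyMeasurableAtFilter hh.continuousAt

theorem eq_primitive_of_hasDerivAt {F f : ℝ → W} (hf : Continuous f) (h0 : F 0 = 0)
    (h : ∀ t, HasDerivAt F (f t) t) (t : ℝ) : F t = ∫ s in (0 : ℝ)..t, f s := by
  rw [intervalIntegral.integral_eq_sub_of_hasDerivAt (fun s _ => h s)
    (hf.intervalIntegrable _ _), h0, sub_zero]

/-- The primitive of the convolution-type integral `∫₀ˢ k τ (s - τ) dτ`; for `t ≥ 0` both sides are
the integral of `k` over the triangle `0 ≤ τ`, `0 ≤ σ`, `τ + σ ≤ t`. -/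
theorem integral_primitive_convolution {k : ℝ → ℝ → W} (hk : Continuous ↿k) (t : ℝ) :
    ∫ s in (0 : ℝ)..t, ∫ τ in (0 : ℝ)..s, k τ (s - τ) =
      ∫ τ in (0 : ℝ)..t, ∫ σ in (0 : ℝ)..(t - τ), k τ σ := by
  have hk' : Continuous fun z : ℝ × ℝ => k z.1 z.2 := hk
  have hκ : Continuous fun z : ℝ × ℝ => ∫ σ in (0 : ℝ)..z.2, k z.1 σ :=
    intervalIntegral.continuous_parametric_primitive_of_continuous (f := k) hk
  -- The right-hand side with the two occurrences of `t` separated; it is differentiated along the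
  -- diagonal by means of its two partial derivatives.
  let Φ : ℝ → ℝ → W := fun a b => ∫ τ in (0 : ℝ)..a, ∫ σ in (0 : ℝ)..(b - τ), k τ σ
  have hc1 : Continuous fun z : ℝ × ℝ => ∫ σ in (0 : ℝ)..(z.2 - z.1), k z.1 σ :=
    hκ.comp (by fun_prop : Continuous fun z : ℝ × ℝ => (z.1, z.2 - z.1))
  have hc2 : Continuous fun z : ℝ × ℝ => ∫ τ in (0 : ℝ)..z.1, k τ (z.2 - τ) :=
    (intervalIntegral.continuous_parametric_primitive_of_continuous (X := ℝ)
      (f := fun b τ => k τ (b - τ))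
      (hk'.comp (by fun_prop : Continuous fun z : ℝ × ℝ => (z.2, z.1 - z.2)))).comp
      (by fun_prop : Continuous fun z : ℝ × ℝ => (z.2, z.1))
  have hd1 : ∀ a b : ℝ, HasDerivAt (fun a => Φ a b) (∫ σ in (0 : ℝ)..(b - a), k a σ) a := fun a b =>
    hasDerivAt_primitive (h := fun τ => ∫ σ in (0 : ℝ)..(b - τ), k τ σ)
      (hc1.comp (by fun_prop : Continuous fun τ : ℝ => (τ, b))) a
  have hd2 : ∀ a b : ℝ, HasDerivAt (fun b => Φ a b) (∫ τ in (0 : ℝ)..a, k τ (b - τ)) b := by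
    intro a b
    have key : ∀ τ b : ℝ, HasDerivAt (fun b => ∫ σ in (0 : ℝ)..(b - τ), k τ σ) (k τ (b - τ)) b := by
      intro τ b
      exact (hasDerivAt_primitive (h := fun σ => k τ σ)
        (hk'.comp (by fun_prop : Continuous fun σ : ℝ => (τ, σ))) (b - τ)).comp_sub_const b τ
    have := hasFDerivAt_setIntegral (μ := volume) (K := Icc 0 1) isCompact_Icc
      (F := fun (r b : ℝ) => ∫ σ in (0 : ℝ)..(b - a * r), k (a * r) σ)
      (F' := fun (r b : ℝ) => ContinuousLinearMap.toSpanSingleton ℝ (k (a * r) (b - a * r)))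
      (hc1.comp (by fun_prop : Continuous fun z : ℝ × ℝ => (a * z.1, z.2)))
      ((ContinuousLinearMap.toSpanSingletonCLE (𝕜 := ℝ) (E := W)).continuous.comp (hk'.comp
        (by fun_prop : Continuous fun z : ℝ × ℝ => (a * z.1, z.2 - a * z.1))))
      (fun r b => (key (a * r) b).hasFDerivAt) b
    have h2 := (this.const_smul a).hasDerivAt
    simp only [Φ, intervalIntegral_eq_smul_setIntegral (b := a)]
    refine h2.congr_deriv ?_
    rw [_root_.smul_apply, ContinuousLinearMap.integral_apply]
    · simp
    · exact ((ContinuousLinearMap.toSpanSingletonCLE (𝕜 := ℝ) (E := W)).continuous.comp (hk'.comp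
        (by fun_prop : Continuous fun z : ℝ =>
          (a * z, b - a * z)))).continuousOn.integrableOn_compact
          isCompact_Icc
  have hΦ : ∀ t : ℝ, HasDerivAt (fun t => Φ t t) (∫ τ in (0 : ℝ)..t, k τ (t - τ)) t := by
    intro t
    have hstrict := hasStrictFDerivAt_uncurry_coprod (u := (t, t)) (f := Φ)
      (f₁ := fun a b => ContinuousLinearMap.toSpanSingleton ℝ (∫ σ in (0 : ℝ)..(b - a), k a σ))
      (f₂ := fun a b => ContinuousLinearMap.toSpanSingleton ℝ (∫ τ in (0 : ℝ)..a, k τ (b - τ)))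
      (Eventually.of_forall fun v => (hd1 v.1 v.2).hasFDerivAt)
      (Eventually.of_forall fun v => (hd2 v.1 v.2).hasFDerivAt)
      ((ContinuousLinearMap.toSpanSingletonCLE (𝕜 := ℝ) (E := W)).continuous.comp
        hc1).continuousAt
      ((ContinuousLinearMap.toSpanSingletonCLE (𝕜 := ℝ) (E := W)).continuous.comp
        hc2).continuousAt
    have hdiag : HasDerivAt (fun t : ℝ => (t, t)) ((1 : ℝ), (1 : ℝ)) t :=
      (hasDerivAt_id t).prodMk (hasDerivAt_id t)
    have := hstrict.hasFDerivAt.comp_hasDerivAt (f := fun t : ℝ => (t, t)) t hdiag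
    simpa [Function.HasUncurry.uncurry, Function.comp_def] using! this
  refine (eq_primitive_of_hasDerivAt (F := fun t => Φ t t) ?_ ?_ hΦ t).symm
  · exact hc2.comp (by fun_prop : Continuous fun t : ℝ => (t, t))
  · simp [Φ]

end Volterra

/-! ### Polar coordinates and radial moments -/

section Polar

variable {E W : Type*} [NormedAddCommGroup E] [InnerProductSpace ℝ E] [FiniteDimensional ℝ E]
  [MeasurableSpace E] [BorelSpace E] [NormedAddCommGroup W] [NormedSpace ℝ W]

/-- Integration in polar coordinates. -/
theorem integral_eq_integral_Ioi_sphere [Nontrivial E] {g : E → W} (hg : Integrable g) :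
    ∫ x, g x = ∫ r in Ioi (0 : ℝ), r ^ (Module.finrank ℝ E - 1) •
      ∫ θ : Metric.sphere (0 : E) 1, g (r • (θ : E)) ∂(volume : Measure E).toSphere := by
  set μ : Measure E := volume
  have hmp := μ.measurePreserving_homeomorphUnitSphereProd
  have hemb := Homeomorph.measurableEmbedding (homeomorphUnitSphereProd E)
  have hcomp : ∀ x : ({0}ᶜ : Set E), (fun p : Metric.sphere (0 : E) 1 × Ioi (0 : ℝ) =>
      g ((p.2 : ℝ) • (p.1 : E))) (homeomorphUnitSphereProd E x) = g x := by
    intro x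
    have h := congrArg Subtype.val ((homeomorphUnitSphereProd E).symm_apply_apply x)
    rw [homeomorphUnitSphereProd_symm_apply_coe] at h
    simp only [h]
  have hint : Integrable (fun p : Metric.sphere (0 : E) 1 × Ioi (0 : ℝ) =>
      g ((p.2 : ℝ) • (p.1 : E))) (μ.toSphere.prod (.volumeIoiPow (Module.finrank ℝ E - 1))) := by
    rw [← hmp.integrable_comp_emb hemb]
    have : ((fun p : Metric.sphere (0 : E) 1 × Ioi (0 : ℝ) =>
      g ((p.2 : ℝ) • (p.1 : E))) ∘ homeomorphUnitSphereProd E) =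
        fun x : ({0}ᶜ : Set E) => g x := funext hcomp
    rw [this]
    exact (integrableOn_iff_comap_subtypeVal (by measurability)).1 hg.integrableOn
  calc ∫ x, g x ∂μ = ∫ x : ({0}ᶜ : Set E), g x ∂(μ.comap (↑)) := by
        rw [integral_subtype_comap (measurableSet_singleton _).compl g, restrict_compl_singleton]
    _ = ∫ p, g ((p.2 : ℝ) • (p.1 : E))
          ∂μ.toSphere.prod (.volumeIoiPow (Module.finrank ℝ E - 1)) := by
        rw [← hmp.integral_comp hemb]
        exact integral_congr_ae (Eventually.of_forall fun x => (hcomp x).symm)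
    _ = ∫ r : Ioi (0 : ℝ), ∫ θ : Metric.sphere (0 : E) 1, g ((r : ℝ) • (θ : E)) ∂μ.toSphere
          ∂(.volumeIoiPow (Module.finrank ℝ E - 1)) := integral_prod_symm _ hint
    _ = _ := by
      simp only [Measure.volumeIoiPow, ENNReal.ofReal]
      rw [integral_withDensity_eq_integral_smul,
        integral_subtype_comap measurableSet_Ioi fun a : ℝ =>
          Real.toNNReal (a ^ (Module.finrank ℝ E - 1)) •
            ∫ θ : Metric.sphere (0 : E) 1, g (a • (θ : E)) ∂μ.toSphere,
        setIntegral_congr_fun measurableSet_Ioi fun x hx => ?_]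
      · rw [NNReal.smul_def, Real.coe_toNNReal _ (pow_nonneg hx.out.le _)]
      · exact (measurable_subtype_coe.pow_const _).real_toNNReal

/-- Polar coordinates for an integrand that vanishes outside the ball of radius `R`. -/
theorem integral_eq_intervalIntegral_sphere [Nontrivial E] {g : E → W} (hg : Continuous g) {R : ℝ}
    (hR : 0 ≤ R) (hgR : ∀ x, R < ‖x‖ → g x = 0) :
    ∫ x, g x = ∫ r in (0 : ℝ)..R, r ^ (Module.finrank ℝ E - 1) •
      ∫ θ : Metric.sphere (0 : E) 1, g (r • (θ : E)) ∂(volume : Measure E).toSphere := by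
  have hcs : HasCompactSupport g := HasCompactSupport.intro (isCompact_closedBall (0 : E) R)
    fun x hx => hgR x (by simpa using hx)
  rw [integral_eq_integral_Ioi_sphere (hg.integrable_of_hasCompactSupport hcs),
    intervalIntegral.integral_of_le hR]
  refine setIntegral_eq_of_subset_of_forall_sdiff_eq_zero measurableSet_Ioi Ioc_subset_Ioi_self ?_
  intro r hr
  have hr0 : (0 : ℝ) < r := hr.1
  have hrR : R < r := by
    by_contra h
    exact hr.2 ⟨hr0, not_lt.1 h⟩
  have : ∀ θ : Metric.sphere (0 : E) 1, g (r • (θ : E)) = 0 := fun θ =>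
    hgR _ (by rw [norm_smul, norm_eq_of_mem_sphere, mul_one, Real.norm_of_nonneg hr0.le]; exact hrR)
  simp [this]

theorem hasDerivAt_max_zero_sq (c q : ℝ) :
    HasDerivAt (fun q => (max (c - q) 0) ^ 2) (-(2 * max (c - q) 0)) q := by
  rcases lt_trichotomy q c with h | h | h
  · have h1 : HasDerivAt (fun q => (c - q) ^ 2) (-(2 * (c - q))) q := by
      have := ((hasDerivAt_id q).const_sub c).pow 2
      simpa [mul_comm, Pi.pow_def] using this
    rw [max_eq_left (by linarith)]
    refine h1.congr_of_eventuallyEq ?_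
    filter_upwards [Iio_mem_nhds h] with y hy
    rw [max_eq_left (by linarith [mem_Iio.1 hy])]
  · subst h
    rw [sub_self, max_self, mul_zero, neg_zero, hasDerivAt_iff_isLittleO]
    simp only [sub_self, max_self, ne_eq, OfNat.ofNat_ne_zero, not_false_eq_true, zero_pow,
      sub_zero, smul_zero]
    have h2 : (fun x : ℝ => (max (q - x) 0) ^ 2) =O[𝓝 q] fun x => (x - q) ^ 2 := by
      refine Asymptotics.IsBigO.of_bound 1 (Eventually.of_forall fun x => ?_)
      rw [one_mul, norm_pow, norm_pow]
      gcongr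
      rw [Real.norm_eq_abs, Real.norm_eq_abs, abs_of_nonneg (le_max_right _ _), abs_sub_comm]
      exact max_le (le_abs_self _) (abs_nonneg _)
    exact h2.trans_isLittleO (by simpa using Asymptotics.isLittleO_pow_sub_sub q one_lt_two)
  · rw [max_eq_right (by linarith), mul_zero, neg_zero]
    refine (hasDerivAt_const q (0 : ℝ)).congr_of_eventuallyEq ?_
    filter_upwards [Ioi_mem_nhds h] with y hy
    rw [max_eq_right (by linarith [mem_Ioi.1 hy])]
    simp

/-- Integration by parts against the radial function `((R² - |x|²)₊)²`. It takes the place of the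
divergence theorem on balls: the square makes the weight differentiable across the sphere `|x| = R`,
and the spherical integrals are recovered from these moments by `eq_primitive_of_moments`. -/
theorem integral_max_sq_smul_laplacian {g : E → W} (hg : ContDiff ℝ 2 g) (R : ℝ) :
    ∫ x, (max (R ^ 2 - ‖x‖ ^ 2) 0) ^ 2 • (Δ g) x =
      ∫ x, (4 * max (R ^ 2 - ‖x‖ ^ 2) 0) • fderiv ℝ g x x := by
  set b := stdOrthonormalBasis ℝ E
  have hg1 : Continuous (fderiv ℝ g) := hg.continuous_fderiv (by simp)
  have hg2 : ContDiff ℝ 1 (fderiv ℝ g) := hg.fderiv_right (m := 1) le_rfl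
  have hg2c : Continuous (fderiv ℝ (fderiv ℝ g)) := hg2.continuous_fderiv (by simp)
  let Ψ : E → ℝ := fun x => (max (R ^ 2 - ‖x‖ ^ 2) 0) ^ 2
  have hΨ : ∀ x, HasFDerivAt Ψ ((-(2 * max (R ^ 2 - ‖x‖ ^ 2) 0)) • (2 • innerSL ℝ x)) x := fun x =>
    (hasDerivAt_max_zero_sq (R ^ 2) (‖x‖ ^ 2)).comp_hasFDerivAt (f := fun x => ‖x‖ ^ 2) x
      (hasStrictFDerivAt_norm_sq x).hasFDerivAt
  have hcs : ∀ {V : Type _} [NormedAddCommGroup V] {h : E → V}, (∀ x, |R| < ‖x‖ → h x = 0) →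
      Continuous h → Integrable h := by
    intro V _ h hh hc
    exact hc.integrable_of_hasCompactSupport (HasCompactSupport.intro
      (isCompact_closedBall (0 : E) |R|) fun x hx => hh x (by simpa using hx))
  have hmax : ∀ x : E, |R| < ‖x‖ → max (R ^ 2 - ‖x‖ ^ 2) 0 = 0 := fun x hx => by
    refine max_eq_right ?_
    have : R ^ 2 < ‖x‖ ^ 2 := sq_lt_sq.2 (by simpa using hx)
    linarith
  have hmc : Continuous fun x : E => max (R ^ 2 - ‖x‖ ^ 2) 0 := by fun_prop
  have hfd : ∀ v x, fderiv ℝ (fun y => fderiv ℝ g y v) x v = fderiv ℝ (fderiv ℝ g) x v v := by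
    intro v x
    have := ((hg2.differentiable (by simp) x).hasFDerivAt.clm_apply (hasFDerivAt_const v x)).fderiv
    rw [this]
    simp
  have key : ∀ v : E, ∫ x, Ψ x • fderiv ℝ (fderiv ℝ g) x v v =
      ∫ x, (4 * max (R ^ 2 - ‖x‖ ^ 2) 0 * inner ℝ x v) • fderiv ℝ g x v := by
    intro v
    have e : ∀ x, fderiv ℝ Ψ x v = -(4 * max (R ^ 2 - ‖x‖ ^ 2) 0 * inner ℝ x v) := by
      intro x
      rw [(hΨ x).fderiv]
      simp
      ring
    have := integral_smul_fderiv_eq_neg_fderiv_smul_of_integrable (μ := (volume : Measure E))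
      (f := Ψ) (g := fun y => fderiv ℝ g y v) (v := v) ?_ ?_ ?_
      (fun x _ => (hΨ x).differentiableAt)
      (fun x _ => (hg2.differentiable (by simp) x).clm_apply (differentiableAt_const v))
    · simp only [hfd, e, neg_smul, integral_neg, neg_neg] at this
      exact this
    · simp only [e]
      exact hcs (fun x hx => by simp [hmax x hx]) (by fun_prop)
    · simp only [hfd]
      exact hcs (fun x hx => by simp [Ψ, hmax x hx]) (by fun_prop)
    · exact hcs (fun x hx => by simp [Ψ, hmax x hx]) (by fun_prop)
  have hL : ∀ x, (Δ g) x = ∑ i, fderiv ℝ (fderiv ℝ g) x (b i) (b i) := fun x => by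
    rw [laplacian_eq_bilinTrace]
    simp [bilinTrace, b]
  have hx : ∀ x, fderiv ℝ g x x = ∑ i, (inner ℝ x (b i) : ℝ) • fderiv ℝ g x (b i) := fun x => by
    have h := congrArg (fderiv ℝ g x) (b.sum_repr' x)
    rw [← h, map_sum]
    simp [real_inner_comm]
  calc ∫ x, Ψ x • (Δ g) x = ∑ i, ∫ x, Ψ x • fderiv ℝ (fderiv ℝ g) x (b i) (b i) := by
        simp only [hL, Finset.smul_sum]
        refine integral_finsetSum _ fun i _ => ?_
        exact hcs (fun x hx => by simp [Ψ, hmax x hx]) (by fun_prop)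
    _ = ∑ i, ∫ x, (4 * max (R ^ 2 - ‖x‖ ^ 2) 0 * inner ℝ x (b i)) • fderiv ℝ g x (b i) :=
        Finset.sum_congr rfl fun i _ => key _
    _ = _ := by
        simp only [hx, Finset.smul_sum, smul_smul]
        refine (integral_finsetSum _ fun i _ => ?_).symm
        exact hcs (fun x hx => by simp [hmax x hx]) (by fun_prop)

end Polar

section RealVariable

variable {W : Type*} [NormedAddCommGroup W] [NormedSpace ℝ W] [CompleteSpace W]

/-- A function is recovered from its moments against `(R² - s²)₊` and `((R² - s²)₊)²`, by
differentiating twice with respect to `R`. -/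
theorem eq_primitive_of_moments {A B : ℝ → W} (hA : Continuous A) (hB : Continuous B)
    (h : ∀ R > 0, ∫ s in (0 : ℝ)..R, (R ^ 2 - s ^ 2) ^ 2 • B s =
      ∫ s in (0 : ℝ)..R, (4 * s * (R ^ 2 - s ^ 2)) • A s) {R : ℝ} (hR : 0 < R) :
    A R = ∫ s in (0 : ℝ)..R, B s := by
  have hii : ∀ {f : ℝ → W} (R : ℝ), Continuous f → IntervalIntegrable f volume 0 R :=
    fun R hf => hf.intervalIntegrable _ _
  have hd : ∀ {c : ℝ → ℝ} {f : ℝ → W} (R c' : ℝ), Continuous f → HasDerivAt c c' R →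
      HasDerivAt (fun R => c R • ∫ s in (0 : ℝ)..R, f s)
        (c R • f R + c' • ∫ s in (0 : ℝ)..R, f s) R :=
    fun R c' hf hc => hc.smul (hasDerivAt_primitive hf R)
  -- The first of the two differentiations in `R`, divided by `4 R`.
  have step : ∀ R > 0, R ^ 2 • (∫ s in (0 : ℝ)..R, B s) - ∫ s in (0 : ℝ)..R, s ^ 2 • B s =
      (2 : ℝ) • ∫ s in (0 : ℝ)..R, s • A s := by
    intro R hR
    have h1 : ∀ R > 0, R ^ 4 • (∫ s in (0 : ℝ)..R, B s) - (2 * R ^ 2) •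
        (∫ s in (0 : ℝ)..R, s ^ 2 • B s) + (1 : ℝ) • ∫ s in (0 : ℝ)..R, s ^ 4 • B s =
        (4 * R ^ 2) • (∫ s in (0 : ℝ)..R, s • A s) - (4 : ℝ) • ∫ s in (0 : ℝ)..R, s ^ 3 • A s := by
      intro R hR
      have := h R hR
      simp only [← intervalIntegral.integral_smul]
      rw [← intervalIntegral.integral_sub (hii R (by fun_prop)) (hii R (by fun_prop)),
        ← intervalIntegral.integral_add (hii R (by fun_prop)) (hii R (by fun_prop)),
        ← intervalIntegral.integral_sub (hii R (by fun_prop)) (hii R (by fun_prop))]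
      convert this using 3 with s s
      · module
      · module
    have dl := ((hd R (4 * R ^ 3) hB (by simpa using hasDerivAt_pow 4 R)).sub
      (hd R (4 * R) (f := fun s => s ^ 2 • B s) (by fun_prop)
        (c := fun R => 2 * R ^ 2) (by
          exact ((hasDerivAt_pow 2 R).const_mul 2).congr_deriv (by push_cast; ring)))).add
      (hd R 0 (f := fun s => s ^ 4 • B s) (by fun_prop) (hasDerivAt_const R (1 : ℝ)))
    have dr := (hd R (8 * R) (f := fun s => s • A s) (by fun_prop)
        (c := fun R => 4 * R ^ 2) (by
          exact ((hasDerivAt_pow 2 R).const_mul 4).congr_deriv (by push_cast; ring))).sub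
      (hd R 0 (f := fun s => s ^ 3 • A s) (by fun_prop) (hasDerivAt_const R (4 : ℝ)))
    have heq := dl.unique (dr.congr_of_eventuallyEq (by
      filter_upwards [Ioi_mem_nhds hR] with y hy using h1 y hy))
    have h4 : (4 * R) • (R ^ 2 • (∫ s in (0 : ℝ)..R, B s) - ∫ s in (0 : ℝ)..R, s ^ 2 • B s) =
        (4 * R) • ((2 : ℝ) • ∫ s in (0 : ℝ)..R, s • A s) := by
      linear_combination (norm := module) heq
    exact smul_right_injective _ (by positivity) h4
  have dl := (hd R (2 * R) hB (by simpa using hasDerivAt_pow 2 R)).sub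
    (hasDerivAt_primitive (h := fun s => s ^ 2 • B s) (by fun_prop) R)
  have dr := (hasDerivAt_primitive (h := fun s => s • A s) (by fun_prop) R).const_smul (2 : ℝ)
  have heq := dl.unique (dr.congr_of_eventuallyEq (by
    filter_upwards [Ioi_mem_nhds hR] with y hy using step y hy))
  have h2 : (2 * R) • A R = (2 * R) • ∫ s in (0 : ℝ)..R, B s := by
    linear_combination (norm := module) (-1 : ℝ) • heq
  exact smul_right_injective _ (by positivity) h2

end RealVariable

/-! ### Spherical means and the Euler–Poisson–Darboux equation -/

section SphereIntegral

variable {X E W : Type*} [NormedAddCommGroup E] [InnerProductSpace ℝ E] [FiniteDimensional ℝ E]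
  [MeasurableSpace E] [BorelSpace E] [NormedAddCommGroup W] [NormedSpace ℝ W] [TopologicalSpace X]

/-- The integral over directions `θ` of the unit sphere of `g (x + r θ)`; unlike the surface
integral over the sphere of radius `r` it carries no factor `r ^ (n - 1)`, and it makes sense for
all real `r`. -/
noncomputable def unitSphereIntegral (g : E → W) (x : E) (r : ℝ) : W :=
  ∫ θ : Metric.sphere (0 : E) 1, g (x + r • (θ : E)) ∂(volume : Measure E).toSphere

theorem SmoothFamily.unitSphereIntegral_translate {F : X → E → W} (hF : SmoothFamily F) :
    SmoothFamily fun (z : (X × ℝ) × Metric.sphere (0 : E) 1) x =>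
      F z.1.1 (x + z.1.2 • (z.2 : E)) :=
  hF.translate (π := fun z : (X × ℝ) × Metric.sphere (0 : E) 1 => z.1.1) (by fun_prop)
    (A := fun z => z.1.2 • (z.2 : E)) (by fun_prop)

theorem SmoothFamily.unitSphereIntegral [FirstCountableTopology X] [LocallyCompactSpace X]
    {F : X → E → W} (hF : SmoothFamily F) :
    SmoothFamily fun (z : X × ℝ) x => unitSphereIntegral (F z.1) x z.2 := by
  simpa only [setIntegral_univ, MultipleWave.unitSphereIntegral] using
    hF.unitSphereIntegral_translate.setIntegral
    (μ := (volume : Measure E).toSphere) isCompact_univ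

theorem smoothFamily_translate_sphere {g : E → W} (hg : ContDiff ℝ ∞ g) (r : ℝ) :
    SmoothFamily fun (θ : Metric.sphere (0 : E) 1) x => g (x + r • (θ : E)) :=
  (SmoothFamily.const (X := Unit) hg).translate (π := fun _ => ()) (by fun_prop)
    (A := fun θ : Metric.sphere (0 : E) 1 => r • (θ : E)) (by fun_prop)

theorem integrable_sphere_of_continuous {h : Metric.sphere (0 : E) 1 → W} (hh : Continuous h) :
    Integrable h (volume : Measure E).toSphere :=
  integrableOn_univ.1 (hh.continuousOn.integrableOn_compact isCompact_univ)

theorem laplacian_iterate_unitSphereIntegral [CompleteSpace W] {g : E → W} (hg : ContDiff ℝ ∞ g)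
    (r : ℝ) (k : ℕ) :
    (Δ^[k] fun x => unitSphereIntegral g x r) = fun x => unitSphereIntegral (Δ^[k] g) x r := by
  have h := (smoothFamily_translate_sphere hg r).laplacian_iterate_setIntegral
    (μ := (volume : Measure E).toSphere) isCompact_univ k
  simpa only [setIntegral_univ, laplacian_iterate_comp_add_right, unitSphereIntegral] using h

theorem unitSphereIntegral_zero_right [CompleteSpace W] (g : E → W) (x : E) :
    unitSphereIntegral g x 0 = (volume : Measure E).toSphere.real univ • g x := by
  simp [unitSphereIntegral]

theorem unitSphereIntegral_intervalIntegral {F : ℝ → E → W}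
    (hF : Continuous fun z : ℝ × E => F z.1 z.2) (b : ℝ) (x : E) (r : ℝ) :
    unitSphereIntegral (fun x => ∫ s in (0 : ℝ)..b, F s x) x r =
      ∫ s in (0 : ℝ)..b, unitSphereIntegral (F s) x r := by
  refine (intervalIntegral_integral_swap (f := fun (s : ℝ) (θ : Metric.sphere (0 : E) 1) =>
    F s (x + r • (θ : E))) ?_).symm
  have hc : Continuous fun z : ℝ × Metric.sphere (0 : E) 1 => F z.1 (x + r • (z.2 : E)) :=
    hF.comp (by fun_prop : Continuous fun z : ℝ × Metric.sphere (0 : E) 1 =>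
      (z.1, x + r • (z.2 : E)))
  have h : IntegrableOn (fun z : ℝ × Metric.sphere (0 : E) 1 => F z.1 (x + r • (z.2 : E)))
      (uIcc 0 b ×ˢ univ) ((volume : Measure ℝ).prod (volume : Measure E).toSphere) :=
    hc.continuousOn.integrableOn_compact (isCompact_uIcc.prod isCompact_univ)
  rw [IntegrableOn, ← Measure.prod_restrict, Measure.restrict_univ] at h
  exact h.mono_measure (Measure.prod_mono (Measure.restrict_mono uIoc_subset_uIcc le_rfl) le_rfl)

variable [CompleteSpace W]

/-- The radial derivative of a spherical integral. -/
theorem hasDerivAt_unitSphereIntegral {g : E → W} (hg : ContDiff ℝ 1 g) (x : E) (r : ℝ) :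
    HasDerivAt (fun r => unitSphereIntegral g x r)
      (∫ θ : Metric.sphere (0 : E) 1, fderiv ℝ g (x + r • (θ : E)) θ
        ∂(volume : Measure E).toSphere) r := by
  have hg' : Continuous (fderiv ℝ g) := hg.continuous_fderiv (by simp)
  have hF' : Continuous fun z : Metric.sphere (0 : E) 1 × ℝ =>
      ContinuousLinearMap.toSpanSingleton ℝ (fderiv ℝ g (x + z.2 • (z.1 : E)) z.1) :=
    (ContinuousLinearMap.toSpanSingletonCLE (𝕜 := ℝ) (E := W)).continuous.comp (by fun_prop)
  have h := hasFDerivAt_setIntegral (μ := (volume : Measure E).toSphere) isCompact_univ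
    (F := fun (θ : Metric.sphere (0 : E) 1) (r : ℝ) => g (x + r • (θ : E)))
    (hg.continuous.comp (by fun_prop)) hF' (fun θ r => by
      have h1 : HasDerivAt (fun r : ℝ => x + r • (θ : E)) (θ : E) r := by
        simpa using ((hasDerivAt_id r).smul_const (θ : E)).const_add x
      exact ((hg.differentiable (by simp) _).hasFDerivAt.comp_hasDerivAt r h1).hasFDerivAt) r
  simp only [setIntegral_univ] at h
  refine h.hasDerivAt.congr_deriv ?_
  rw [ContinuousLinearMap.integral_apply]
  · simp
  · exact integrable_sphere_of_continuous
      (hF'.comp (by fun_prop : Continuous fun θ : Metric.sphere (0 : E) 1 => (θ, r)))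

theorem continuous_sphere_integral_fderiv {g : E → W} (hg : ContDiff ℝ 1 g) (x : E) :
    Continuous fun r : ℝ => ∫ θ : Metric.sphere (0 : E) 1, fderiv ℝ g (x + r • (θ : E)) θ
        ∂(volume : Measure E).toSphere := by
  have hg' : Continuous (fderiv ℝ g) := hg.continuous_fderiv (by simp)
  simpa only [setIntegral_univ] using continuous_parametric_integral_of_continuous
    (μ := (volume : Measure E).toSphere) (s := univ)
    (f := fun (r : ℝ) (θ : Metric.sphere (0 : E) 1) => fderiv ℝ g (x + r • (θ : E)) θ)
    (by fun_prop) isCompact_univ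

theorem continuous_unitSphereIntegral {g : E → W} (hg : Continuous g) (x : E) :
    Continuous fun r : ℝ => unitSphereIntegral g x r := by
  simpa only [setIntegral_univ, unitSphereIntegral] using
    continuous_parametric_integral_of_continuous
    (μ := (volume : Measure E).toSphere) (s := univ)
    (f := fun (r : ℝ) (θ : Metric.sphere (0 : E) 1) => g (x + r • (θ : E)))
    (by fun_prop) isCompact_univ

/-- The divergence theorem on the ball of radius `r` about `0`, in polar coordinates. -/
theorem pow_smul_deriv_unitSphereIntegral_of_nonneg [Nontrivial E] {g : E → W} (hg : ContDiff ℝ 2 g)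
    (hn : Module.finrank ℝ E ≠ 1) {r : ℝ} (hr : 0 ≤ r) :
    r ^ (Module.finrank ℝ E - 1) • (∫ θ : Metric.sphere (0 : E) 1, fderiv ℝ g (r • (θ : E)) θ
        ∂(volume : Measure E).toSphere) =
      ∫ s in (0 : ℝ)..r, s ^ (Module.finrank ℝ E - 1) • unitSphereIntegral (Δ g) 0 s := by
  have hn' : Module.finrank ℝ E - 1 ≠ 0 := by
    have : 0 < Module.finrank ℝ E := Module.finrank_pos
    omega
  rcases hr.eq_or_lt with rfl | hr
  · simp [hn']
  have hg1 : ContDiff ℝ 1 g := hg.of_le (by norm_num)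
  have hg' : Continuous (fderiv ℝ g) := hg.continuous_fderiv (by simp)
  have hΔ : Continuous (Δ g) := by
    simp only [funext (laplacian_eq_bilinTrace g)]
    exact (bilinTrace E W).continuous.comp
      ((hg.fderiv_right (m := 1) le_rfl).continuous_fderiv (by simp))
  have hc1 := continuous_sphere_integral_fderiv hg1 0
  have hc2 := continuous_unitSphereIntegral hΔ 0
  simp only [zero_add] at hc1
  refine eq_primitive_of_moments
    (A := fun r => r ^ (Module.finrank ℝ E - 1) • (∫ θ : Metric.sphere (0 : E) 1,
      fderiv ℝ g (r • (θ : E)) θ ∂(volume : Measure E).toSphere))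
    (B := fun s => s ^ (Module.finrank ℝ E - 1) • unitSphereIntegral (Δ g) 0 s)
    (by fun_prop) (by fun_prop) ?_ hr
  intro R hR
  have h := integral_max_sq_smul_laplacian hg R
  have hmax : ∀ x : E, R < ‖x‖ → max (R ^ 2 - ‖x‖ ^ 2) 0 = 0 := fun x hx => by
    refine max_eq_right ?_
    nlinarith
  rw [integral_eq_intervalIntegral_sphere (by fun_prop) hR.le (fun x hx => by simp [hmax x hx]),
    integral_eq_intervalIntegral_sphere (by fun_prop) hR.le (fun x hx => by simp [hmax x hx])] at h
  have hm : ∀ s ∈ uIcc 0 R, ∀ θ : Metric.sphere (0 : E) 1,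
      max (R ^ 2 - ‖s • (θ : E)‖ ^ 2) 0 = R ^ 2 - s ^ 2 := by
    intro s hs θ
    rw [uIcc_of_le hR.le] at hs
    rw [norm_smul, norm_eq_of_mem_sphere, mul_one, Real.norm_eq_abs, sq_abs, max_eq_left]
    nlinarith [hs.1, hs.2]
  convert h using 1
  · refine intervalIntegral.integral_congr fun s hs => ?_
    simp only [hm s hs, integral_smul, unitSphereIntegral, zero_add]
    rw [smul_comm]
  · refine intervalIntegral.integral_congr fun s hs => ?_
    simp only [hm s hs, map_smul, integral_smul]
    module

/-- The **Euler–Poisson–Darboux equation**, integrated once: the spherical integral `H` of `g` and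
the spherical integral `K` of `Δ g` satisfy `r ^ (n - 1) H'(r) = ∫₀ʳ s ^ (n - 1) K(s) ds`. In odd
dimension `n ≥ 3` it holds for all real `r`. -/
theorem pow_smul_deriv_unitSphereIntegral {g : E → W} (hg : ContDiff ℝ 2 g)
    (hn : Even (Module.finrank ℝ E - 1)) (hn1 : Module.finrank ℝ E - 1 ≠ 0) (x : E) (r : ℝ) :
    r ^ (Module.finrank ℝ E - 1) • (∫ θ : Metric.sphere (0 : E) 1, fderiv ℝ g (x + r • (θ : E)) θ
        ∂(volume : Measure E).toSphere) =
      ∫ s in (0 : ℝ)..r, s ^ (Module.finrank ℝ E - 1) • unitSphereIntegral (Δ g) x s := by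
  have : Nontrivial E := Module.nontrivial_of_finrank_pos (R := ℝ) (by omega)
  have hG : ContDiff ℝ 2 fun y => g (y + x) := hg.comp (contDiff_id.add contDiff_const)
  have hd : ∀ y, fderiv ℝ (fun y => g (y + x)) y = fderiv ℝ g (x + y) := fun y => by
    rw [fderiv_comp_add_right, add_comm]
  have hU : ∀ s, unitSphereIntegral (Δ fun y => g (y + x)) 0 s = unitSphereIntegral (Δ g) x s :=
    fun s => by
      rw [laplacian_comp_add_right]
      simp only [unitSphereIntegral, zero_add, add_comm x]
  rcases le_total 0 r with hr | hr
  · simpa only [hd, hU] using pow_smul_deriv_unitSphereIntegral_of_nonneg hG (by omega) hr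
  · -- Negative radii are reached by reflecting `g` in the centre.
    have hN : ContDiff ℝ 2 fun y => g (-y + x) := hG.comp contDiff_neg
    have h := pow_smul_deriv_unitSphereIntegral_of_nonneg hN (by omega) (neg_nonneg.2 hr)
    have hdN : ∀ y, fderiv ℝ (fun y => g (-y + x)) y = -fderiv ℝ g (x - y) := fun y => by
      rw [fderiv_comp_neg_eq (g := fun y => g (y + x)) (hG.differentiable (by simp)), hd,
        sub_eq_add_neg]
    have hUN : ∀ s, unitSphereIntegral (Δ fun y => g (-y + x)) 0 s =
        unitSphereIntegral (Δ g) x (-s) := fun s => by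
      rw [← hU (-s)]
      simp only [unitSphereIntegral, laplacian_comp_neg (f := fun y => g (y + x)) hG, zero_add,
        neg_smul]
    simp only [hdN, hUN, neg_smul, sub_neg_eq_add, hn.neg_pow, neg_apply,
      integral_neg, smul_neg] at h
    rw [← neg_inj, h, ← intervalIntegral.integral_symm, ← neg_zero,
      ← intervalIntegral.integral_comp_neg]
    simp [hn.neg_pow]

end SphereIntegral

/-! ### Descent from the Euler–Poisson–Darboux equation to the wave equation -/

section Descent

variable {𝕜 : Type*} [RCLike 𝕜]

theorem hasDerivAt_weightedIntegral {h : ℝ → 𝕜} (hh : Continuous h) (t : ℝ) :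
    HasDerivAt (weightedIntegral h) (t • h t) t :=
  hasDerivAt_primitive (h := fun s => s • h s) (by fun_prop) t

@[simp] theorem weightedIntegral_zero_right (h : ℝ → 𝕜) : weightedIntegral h 0 = 0 := by
  simp [weightedIntegral]

theorem continuous_weightedIntegral {h : ℝ → 𝕜} (hh : Continuous h) :
    Continuous (weightedIntegral h) :=
  continuous_iff_continuousAt.2 fun t => (hasDerivAt_weightedIntegral hh t).continuousAt

theorem continuous_weightedIntegral_iterate {h : ℝ → 𝕜} (hh : Continuous h) (k : ℕ) :
    Continuous (weightedIntegral^[k] h) := by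
  induction k with
  | zero => exact hh
  | succ k ih =>
    rw [Function.iterate_succ_apply']
    exact continuous_weightedIntegral ih

theorem weightedIntegral_const_smul (c : ℝ) (h : ℝ → 𝕜) :
    (weightedIntegral fun s => c • h s) = fun s => c • weightedIntegral h s := by
  funext t
  simp only [weightedIntegral, smul_comm _ c, intervalIntegral.integral_smul]

theorem weightedIntegral_iterate_const_smul (c : ℝ) (h : ℝ → 𝕜) (k : ℕ) :
    (weightedIntegral^[k] fun s => c • h s) = fun s => c • weightedIntegral^[k] h s := by
  induction k with
  | zero => rfl
  | succ k ih => rw [Function.iterate_succ_apply', ih, weightedIntegral_const_smul,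
      Function.iterate_succ_apply']

theorem weightedIntegral_add {h₁ h₂ : ℝ → 𝕜} (hh₁ : Continuous h₁) (hh₂ : Continuous h₂) :
    (weightedIntegral fun s => h₁ s + h₂ s) =
      fun s => weightedIntegral h₁ s + weightedIntegral h₂ s := by
  funext t
  simp only [weightedIntegral, smul_add]
  exact intervalIntegral.integral_add ((by fun_prop : Continuous _).intervalIntegrable _ _)
    ((by fun_prop : Continuous _).intervalIntegrable _ _)

theorem weightedIntegral_iterate_add {h₁ h₂ : ℝ → 𝕜} (hh₁ : Continuous h₁) (hh₂ : Continuous h₂)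
    (k : ℕ) : (weightedIntegral^[k] fun s => h₁ s + h₂ s) =
      fun s => weightedIntegral^[k] h₁ s + weightedIntegral^[k] h₂ s := by
  induction k with
  | zero => rfl
  | succ k ih => rw [Function.iterate_succ_apply', ih, weightedIntegral_add
      (continuous_weightedIntegral_iterate hh₁ k) (continuous_weightedIntegral_iterate hh₂ k),
      Function.iterate_succ_apply', Function.iterate_succ_apply']

theorem integral_pow_smul_const (c : 𝕜) (k : ℕ) (t : ℝ) :
    ∫ s in (0 : ℝ)..t, s ^ k • c = (t ^ (k + 1) / (k + 1)) • c := by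
  rw [intervalIntegral.integral_smul_const, integral_pow]
  simp

theorem weightedIntegral_iterate_const (c : 𝕜) (k : ℕ) :
    (weightedIntegral^[k] fun _ => c) = fun s : ℝ => (s ^ (2 * k) / (2 ^ k * k.factorial)) • c := by
  induction k with
  | zero => simp
  | succ k ih =>
    funext t
    rw [Function.iterate_succ_apply', ih, weightedIntegral]
    have h : ∀ s : ℝ, s • ((s ^ (2 * k) / (2 ^ k * k.factorial)) • c) =
        ((2 : ℝ) ^ k * k.factorial)⁻¹ • (s ^ (2 * k + 1) • c) := fun s => by
      rw [smul_smul, smul_smul]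
      congr 1
      ring
    simp only [h]
    rw [intervalIntegral.integral_smul, integral_pow_smul_const, smul_smul]
    congr 1
    push_cast [Nat.factorial_succ]
    field_simp
    ring

/-- From the once-integrated Euler–Poisson–Darboux equation `τ ^ N h' = ∫ σ ^ N k` to
`(N - 1) h + τ h' = ∫ σ k + (N - 1) h 0`. -/
theorem darboux_first_integral {h h' k : ℝ → 𝕜} (hh : ∀ t, HasDerivAt h (h' t) t)
    (hh' : Continuous h') (hk : Continuous k) {N : ℕ}
    (H : ∀ t, t ^ N • h' t = ∫ s in (0 : ℝ)..t, s ^ N • k s) (t : ℝ) :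
    ((N : ℝ) - 1) • h t + t • h' t - weightedIntegral k t = ((N : ℝ) - 1) • h 0 := by
  have hc : Continuous h := continuous_iff_continuousAt.2 fun t => (hh t).continuousAt
  have hLk := continuous_weightedIntegral hk
  have hd : ∀ t : ℝ, t ≠ 0 → HasDerivAt
      (fun t => ((N : ℝ) - 1) • h t + t • h' t - weightedIntegral k t) 0 t := by
    intro t ht
    have e : ∀ s : ℝ, s ≠ 0 → h' s = (s ^ N)⁻¹ • ∫ r in (0 : ℝ)..s, r ^ N • k r := fun s hs => by
      rw [← H s, smul_smul, inv_mul_cancel₀ (pow_ne_zero _ hs), one_smul]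
    have h2 : HasDerivAt h' (-(N * t⁻¹) • h' t + k t) t := by
      have h3 : HasDerivAt (fun s : ℝ => (s ^ N)⁻¹ • ∫ r in (0 : ℝ)..s, r ^ N • k r) _ t :=
        ((hasDerivAt_pow N t).inv (pow_ne_zero _ ht)).smul
          (hasDerivAt_primitive (h := fun r => r ^ N • k r) (by fun_prop) t)
      refine (h3.congr_of_eventuallyEq ?_).congr_deriv ?_
      · filter_upwards [isOpen_ne.mem_nhds ht] with s hs using e s hs
      · rw [← H t, smul_smul, smul_smul, Pi.inv_apply, inv_mul_cancel₀ (pow_ne_zero _ ht),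
          one_smul, add_comm]
        congr 2
        rcases N with _ | N
        · simp
        · rw [Nat.add_sub_cancel]
          field_simp
          ring
    have h4 := (((hh t).const_smul ((N : ℝ) - 1)).add ((hasDerivAt_id t).smul h2)).sub
      (hasDerivAt_weightedIntegral hk t)
    refine h4.congr_deriv ?_
    simp only [id, smul_add, smul_smul]
    have : t * (-(N * t⁻¹)) = -(N : ℝ) := by field_simp
    rw [this]
    module
  -- `h'` need not be differentiable at `0`, where only continuity of the expression is used.
  have hint := integral_eq_of_hasDerivAt_off_countable
    (fun t => ((N : ℝ) - 1) • h t + t • h' t - weightedIntegral k t) (fun _ => 0)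
    (a := 0) (b := t) (countable_singleton (0 : ℝ)) (by fun_prop) (fun x hx => hd x hx.2)
    (by simp)
  rw [intervalIntegral.integral_zero, eq_comm, sub_eq_zero] at hint
  simpa using hint

/-- Each weighted integration lowers the coefficient in the Darboux equation by two. -/
theorem darboux_descent {h h' k r : ℝ → 𝕜} (hh : ∀ t, HasDerivAt h (h' t) t)
    (hk : Continuous k) (hr : Continuous r) {μ : ℝ}
    (H : ∀ t, μ • h t + t • h' t - weightedIntegral k t = r t) (t : ℝ) :
    (μ - 2) • weightedIntegral h t + t • (t • h t) - weightedIntegral (weightedIntegral k) t =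
      weightedIntegral r t := by
  have hc : Continuous h := continuous_iff_continuousAt.2 fun t => (hh t).continuousAt
  have hd : ∀ t, HasDerivAt (fun t => (μ - 2) • weightedIntegral h t + t • (t • h t) -
      weightedIntegral (weightedIntegral k) t) (t • r t) t := by
    intro t
    have h1 := (((hasDerivAt_weightedIntegral hc t).const_smul (μ - 2)).add
      ((hasDerivAt_id t).smul ((hasDerivAt_id t).smul (hh t)))).sub
      (hasDerivAt_weightedIntegral (continuous_weightedIntegral hk) t)
    refine h1.congr_deriv ?_
    rw [← H t]
    simp only [id, Pi.smul_apply']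
    module
  exact eq_primitive_of_hasDerivAt (f := fun t => t • r t) (by fun_prop) (by simp) hd t

/-- The effect of `i` descents on the equation `μ h + t h' - ∫ s k = c`: the coefficient becomes
`μ - 2 i`, and the constant `c` becomes `c t ^ (2 i) / (2 ^ i i!)`. -/
theorem darboux_iterate {h h' k : ℝ → 𝕜} (hh : ∀ t, HasDerivAt h (h' t) t)
    (hk : Continuous k) {μ : ℝ} {c : 𝕜}
    (H : ∀ t, μ • h t + t • h' t - weightedIntegral k t = c) (i : ℕ) :
    ∃ d : ℝ → 𝕜, (∀ t, HasDerivAt (weightedIntegral^[i] h) (d t) t) ∧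
      ∀ t, (μ - 2 * i) • weightedIntegral^[i] h t + t • d t -
        weightedIntegral (weightedIntegral^[i] k) t =
        (t ^ (2 * i) / (2 ^ i * i.factorial)) • c := by
  induction i with
  | zero => exact ⟨h', hh, by simpa using H⟩
  | succ i ih =>
    obtain ⟨d, hd, hd'⟩ := ih
    have hci : Continuous (weightedIntegral^[i] h) :=
      continuous_iff_continuousAt.2 fun t => (hd t).continuousAt
    refine ⟨fun t => t • weightedIntegral^[i] h t, fun t => ?_, fun t => ?_⟩
    · rw [Function.iterate_succ_apply']
      exact hasDerivAt_weightedIntegral hci t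
    · have h1 := darboux_descent hd (continuous_weightedIntegral_iterate hk i)
        (by fun_prop) hd' t
      have h2 := congrFun (weightedIntegral_iterate_const c (i + 1)) t
      rw [Function.iterate_succ_apply', weightedIntegral_iterate_const] at h2
      rw [h2] at h1
      rw [Function.iterate_succ_apply', Function.iterate_succ_apply', ← h1]
      push_cast
      congr 3
      ring

/-- After `ν` weighted integrations, starting from the coefficient `2 ν + 1`, the function
`t ↦ t • h_ν t` solves an inhomogeneous one-dimensional wave equation in integrated form. -/
theorem smul_weightedIntegral_iterate_eq {h h' k : ℝ → 𝕜} (hh : ∀ t, HasDerivAt h (h' t) t)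
    (hh' : Continuous h') (hk : Continuous k) {ν : ℕ}
    (H : ∀ t, t ^ (2 * ν + 2) • h' t = ∫ s in (0 : ℝ)..t, s ^ (2 * ν + 2) • k s) (t : ℝ) :
    t • weightedIntegral^[ν] h t =
      (∫ s in (0 : ℝ)..t, weightedIntegral (weightedIntegral^[ν] k) s) +
        (t ^ (2 * ν + 1) / (2 ^ ν * ν.factorial)) • h 0 := by
  have h1 := darboux_first_integral hh hh' hk H
  obtain ⟨d, hd, hd'⟩ := darboux_iterate hh hk h1 ν
  have hkν := continuous_weightedIntegral (continuous_weightedIntegral_iterate hk ν)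
  have hderiv : ∀ t : ℝ, HasDerivAt (fun t => t • weightedIntegral^[ν] h t)
      (weightedIntegral (weightedIntegral^[ν] k) t +
        (t ^ (2 * ν) / (2 ^ ν * ν.factorial)) • ((2 * ν + 1 : ℝ) • h 0)) t := by
    intro t
    refine ((hasDerivAt_id t).smul (hd t)).congr_deriv ?_
    have := hd' t
    push_cast at this
    simp only [id]
    rw [show (2 * ν + 1 : ℝ) = 2 * ν + 2 - 1 by ring, ← this]
    module
  have h2 := eq_primitive_of_hasDerivAt (by fun_prop) (by simp) hderiv t
  rw [h2, intervalIntegral.integral_add (hkν.intervalIntegrable _ _)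
    ((by fun_prop : Continuous _).intervalIntegrable _ _)]
  congr 1
  have h3 : ∀ s : ℝ, (s ^ (2 * ν) / (2 ^ ν * ν.factorial)) • ((2 * ν + 1 : ℝ) • h 0) =
      s ^ (2 * ν) • (((2 * ν + 1 : ℝ) / (2 ^ ν * ν.factorial)) • h 0) := fun s => by module
  simp only [h3]
  rw [integral_pow_smul_const, smul_smul]
  congr 1
  push_cast
  have : (2 * ν + 1 : ℝ) ≠ 0 := by positivity
  field_simp

end Descent

/-! ### The propagator of the wave equation -/

section Propagator

variable {𝕜 : Type*} [RCLike 𝕜] {X E : Type*} [NormedAddCommGroup E] [InnerProductSpace ℝ E]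
  [FiniteDimensional ℝ E] [MeasurableSpace E] [BorelSpace E] [TopologicalSpace X]

/-- The normalised spherical integral of `(α² Δ)^ν g` over the sphere of radius `α ρ`. -/
noncomputable def sphereSeed (ν : ℕ) (α : ℝ) (g : E → 𝕜) (x : E) (ρ : ℝ) : 𝕜 :=
  ((α ^ 2) ^ ν / (2 * (2 * Real.pi) ^ (ν + 1))) • unitSphereIntegral (Δ^[ν] g) x (α * ρ)

/-- The solution `w` at time `t` of `∂ₜ² w = α² Δ w` with `w = 0` and `∂ₜ w = g` at `t = 0`: a
spherical part and a Taylor polynomial in `t`. -/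
noncomputable def wavePropagator (ν : ℕ) (α : ℝ) (g : E → 𝕜) (x : E) (t : ℝ) : 𝕜 :=
  t • weightedIntegral^[ν] (sphereSeed ν α g x) t +
    ∑ l ∈ Finset.range ν,
      (α ^ (2 * l) * t ^ (2 * l + 1) / ((2 * l + 1).factorial : ℝ)) • (Δ^[l] g) x

theorem SmoothFamily.sphereSeed [FirstCountableTopology X] [LocallyCompactSpace X] (ν : ℕ) (α : ℝ)
    {F : X → E → 𝕜} (hF : SmoothFamily F) :
    SmoothFamily fun (z : X × ℝ) x => sphereSeed ν α (F z.1) x z.2 :=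
  SmoothFamily.smul (c := fun _ => (α ^ 2) ^ ν / (2 * (2 * Real.pi) ^ (ν + 1))) continuous_const
    ((hF.laplacian_iterate ν).unitSphereIntegral.comp
      (by fun_prop : Continuous fun z : X × ℝ => (z.1, α * z.2)))

theorem SmoothFamily.weightedIntegral_iterate [FirstCountableTopology X] [LocallyCompactSpace X]
    {F : X × ℝ → E → 𝕜} (hF : SmoothFamily F) (k : ℕ) :
    SmoothFamily fun (z : X × ℝ) x => weightedIntegral^[k] (fun ρ => F (z.1, ρ) x) z.2 := by
  induction k with
  | zero => exact hF
  | succ k ih =>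
    simp only [Function.iterate_succ_apply', weightedIntegral]
    refine SmoothFamily.intervalIntegral (X := X × ℝ)
      (F := fun z x => z.2 • weightedIntegral^[k] (fun ρ => F (z.1.1, ρ) x) z.2) ?_ continuous_snd
    exact SmoothFamily.smul (c := fun z : (X × ℝ) × ℝ => z.2) (by fun_prop)
      (ih.comp (by fun_prop : Continuous fun z : (X × ℝ) × ℝ => (z.1.1, z.2)))

theorem SmoothFamily.wavePropagator [FirstCountableTopology X] [LocallyCompactSpace X] (ν : ℕ)
    (α : ℝ) {F : X → E → 𝕜} (hF : SmoothFamily F) :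
    SmoothFamily fun (z : X × ℝ) x => wavePropagator ν α (F z.1) x z.2 := by
  refine SmoothFamily.add (SmoothFamily.smul (c := fun z : X × ℝ => z.2) (by fun_prop)
    ((hF.sphereSeed ν α).weightedIntegral_iterate ν)) (SmoothFamily.sum _ fun l _ => ?_)
  exact SmoothFamily.smul (c := fun z : X × ℝ =>
    α ^ (2 * l) * z.2 ^ (2 * l + 1) / ((2 * l + 1).factorial : ℝ)) (by fun_prop)
    ((hF.laplacian_iterate l).comp continuous_fst)

/-- The area of the unit sphere in dimension `2 ν + 3` is `2 (2 π) ^ (ν + 1) / (2 ν + 1)‼`, written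
here by means of `(2 ν + 1)! = (2 ν + 1)‼ 2 ^ ν ν!`. -/
theorem toSphere_real_univ_of_finrank {ν : ℕ} (hE : Module.finrank ℝ E = 2 * ν + 3) :
    (volume : Measure E).toSphere.real univ * (2 * ν + 1).factorial =
      2 * (2 * Real.pi) ^ (ν + 1) * (2 ^ ν * ν.factorial) := by
  have hE' : Module.finrank ℝ E = 2 * (ν + 1) + 1 := by omega
  have h1 : ((2 * ν + 1).factorial : ℝ) =
      (Nat.doubleFactorial (2 * ν + 1) : ℝ) * (2 ^ ν * ν.factorial) := by
    rw [Nat.factorial_eq_mul_doubleFactorial, Nat.doubleFactorial_two_mul]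
    push_cast
    ring
  have h2 : (Nat.doubleFactorial (2 * (ν + 1) + 1) : ℝ) =
      (2 * ν + 3) * Nat.doubleFactorial (2 * ν + 1) := by
    rw [show 2 * (ν + 1) + 1 = (2 * ν + 1) + 2 by ring, Nat.doubleFactorial_add_two]
    push_cast
    ring
  have h3 : (0 : ℝ) < Nat.doubleFactorial (2 * ν + 1) := by
    exact_mod_cast Nat.doubleFactorial_pos _
  rw [Measure.toSphere_real_apply_univ, measureReal_def,
    InnerProductSpace.volume_ball_of_dim_odd hE', hE', ENNReal.ofReal_one, one_pow, one_mul,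
    ENNReal.toReal_ofReal (by positivity), h1, h2]
  push_cast
  field_simp
  ring

theorem continuous_sphereSeed (ν : ℕ) (α : ℝ) {g : E → 𝕜} (hg : ContDiff ℝ ∞ g) (x : E) :
    Continuous (sphereSeed ν α g x) :=
  (continuous_const).smul ((continuous_unitSphereIntegral
    (contDiff_laplacian_iterate hg ν).continuous x).comp (by fun_prop))

/-- The propagator solves the wave equation, in integrated form. The descent leaves a term in
`t ^ (2 ν + 1)` formed from the value of the spherical mean at radius `0`; the normalisation by the
area of the sphere makes it the Taylor term of order `ν`, so that the integrated Taylor polynomial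
telescopes. -/
theorem wavePropagator_eq {ν : ℕ} (hE : Module.finrank ℝ E = 2 * ν + 3) {α : ℝ} (hα : α ≠ 0)
    {g : E → 𝕜} (hg : ContDiff ℝ ∞ g) (x : E) (t : ℝ) :
    wavePropagator ν α g x t = t • g x +
      α ^ 2 • ∫ s in (0 : ℝ)..t, ∫ r in (0 : ℝ)..s, wavePropagator ν α (Δ g) x r := by
  set c : ℝ := (α ^ 2) ^ ν / (2 * (2 * Real.pi) ^ (ν + 1)) with hc
  set G := Δ^[ν] g with hG
  have hGs : ContDiff ℝ ∞ G := contDiff_laplacian_iterate hg ν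
  have hG1 : ContDiff ℝ 1 G := by exact_mod_cast contDiff_infty.1 hGs 1
  have hG2 : ContDiff ℝ 2 G := by exact_mod_cast contDiff_infty.1 hGs 2
  have hΔg : ContDiff ℝ ∞ (Δ g) := contDiff_laplacian_iterate hg 1
  have hΔG : Δ^[ν] (Δ g) = Δ G := by
    rw [← Function.iterate_succ_apply, Function.iterate_succ_apply']
  have hN : Module.finrank ℝ E - 1 = 2 * ν + 2 := by omega
  have hk := continuous_sphereSeed ν α hΔg x
  set k : ℝ → 𝕜 := fun ρ => α ^ 2 • sphereSeed ν α (Δ g) x ρ with hkdef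
  have hkc : Continuous k := by fun_prop
  set D : ℝ → 𝕜 := fun r => ∫ θ : Metric.sphere (0 : E) 1, fderiv ℝ G (x + r • (θ : E)) θ
        ∂(volume : Measure E).toSphere with hD
  have hDc : Continuous D := continuous_sphere_integral_fderiv hG1 x
  have hder : ∀ ρ, HasDerivAt (sphereSeed ν α g x) (c • α • D (α * ρ)) ρ := fun ρ =>
    (((hasDerivAt_unitSphereIntegral hG1 x (α * ρ)).scomp ρ
      ((hasDerivAt_id ρ).const_mul α)).const_smul c).congr_deriv (by simp [hD])
  have hEPD : ∀ r : ℝ, r ^ (2 * ν + 2) • D r =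
      ∫ s in (0 : ℝ)..r, s ^ (2 * ν + 2) • unitSphereIntegral (Δ G) x s := by
    intro r
    have := pow_smul_deriv_unitSphereIntegral hG2 (by rw [hN]; exact ⟨ν + 1, by ring⟩)
      (by omega) x r
    rwa [hN] at this
  have key := smul_weightedIntegral_iterate_eq hder (by fun_prop) hkc (ν := ν) ?_ t
  swap
  · intro ρ
    have h1 := hEPD (α * ρ)
    rw [← mul_zero α, ← intervalIntegral.smul_integral_comp_mul_left] at h1
    simp only [mul_pow, mul_smul, intervalIntegral.integral_smul] at h1
    rw [smul_comm α (α ^ (2 * ν + 2))] at h1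
    have h2 := smul_right_injective _ (pow_ne_zero (2 * ν + 2) hα) h1
    have h3 : ∫ s in (0 : ℝ)..ρ, s ^ (2 * ν + 2) • k s = (α ^ 2 * c) •
        ∫ s in (0 : ℝ)..ρ, s ^ (2 * ν + 2) • unitSphereIntegral (Δ G) x (α * s) := by
      rw [← intervalIntegral.integral_smul]
      refine intervalIntegral.integral_congr fun s _ => ?_
      simp only [hkdef, sphereSeed, hΔG, ← hc]
      module
    calc ρ ^ (2 * ν + 2) • c • α • D (α * ρ) = (c * α) • (ρ ^ (2 * ν + 2) • D (α * ρ)) := by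
          module
      _ = _ := by
          rw [h2, h3]
          module
  -- The shift of the Taylor polynomial.
  set T : ℕ → 𝕜 := fun l => (α ^ (2 * l) * t ^ (2 * l + 1) / ((2 * l + 1).factorial : ℝ)) •
    (Δ^[l] g) x with hT
  have hpoly : α ^ 2 • ∫ s in (0 : ℝ)..t, ∫ r in (0 : ℝ)..s, ∑ l ∈ Finset.range ν,
      (α ^ (2 * l) * r ^ (2 * l + 1) / ((2 * l + 1).factorial : ℝ)) • (Δ^[l] (Δ g)) x =
      ∑ l ∈ Finset.range ν, T (l + 1) := by
    have h1 : ∀ s : ℝ, (∫ r in (0 : ℝ)..s, ∑ l ∈ Finset.range ν,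
        (α ^ (2 * l) * r ^ (2 * l + 1) / ((2 * l + 1).factorial : ℝ)) • (Δ^[l] (Δ g)) x) =
        ∑ l ∈ Finset.range ν, s ^ (2 * l + 2) •
          (α ^ (2 * l) / ((2 * l + 2).factorial : ℝ)) • (Δ^[l] (Δ g)) x := by
      intro s
      rw [intervalIntegral.integral_finsetSum fun l _ =>
        (by fun_prop : Continuous _).intervalIntegrable _ _]
      refine Finset.sum_congr rfl fun l _ => ?_
      have h2 : ∀ r : ℝ, (α ^ (2 * l) * r ^ (2 * l + 1) / ((2 * l + 1).factorial : ℝ)) •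
          (Δ^[l] (Δ g)) x = r ^ (2 * l + 1) •
            (α ^ (2 * l) / ((2 * l + 1).factorial : ℝ)) • (Δ^[l] (Δ g)) x := fun r => by module
      simp only [h2]
      rw [integral_pow_smul_const, smul_smul, smul_smul]
      congr 1
      rw [Nat.factorial_succ (2 * l + 1)]
      push_cast
      field_simp
    simp only [h1]
    rw [intervalIntegral.integral_finsetSum fun l _ =>
        (by fun_prop : Continuous _).intervalIntegrable _ _, Finset.smul_sum]
    refine Finset.sum_congr rfl fun l _ => ?_
    rw [integral_pow_smul_const, smul_smul, smul_smul]
    simp only [hT, Function.iterate_succ_apply]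
    congr 1
    rw [show 2 * (l + 1) + 1 = 2 * l + 2 + 1 by ring, Nat.factorial_succ (2 * l + 2)]
    push_cast
    field_simp
    ring
  have hsum : T 0 + ∑ l ∈ Finset.range ν, T (l + 1) = (∑ l ∈ Finset.range ν, T l) + T ν := by
    rw [add_comm, ← Finset.sum_range_succ' T ν, Finset.sum_range_succ]
  have hT0 : T 0 = t • g x := by simp [hT]
  -- The term of the descent from radius `0`, identified with the Taylor term of order `ν`.
  have hTν : (t ^ (2 * ν + 1) / (2 ^ ν * ν.factorial)) • sphereSeed ν α g x 0 = T ν := by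
    simp only [sphereSeed, hT, mul_zero, unitSphereIntegral_zero_right, smul_smul]
    congr 1
    have hv := toSphere_real_univ_of_finrank hE
    have hπ := Real.pi_pos
    set v := (volume : Measure E).toSphere.real univ
    rw [← eq_div_iff (by positivity)] at hv
    rw [hv, ← pow_mul]
    field_simp
  have hLk : ∀ s, weightedIntegral (weightedIntegral^[ν] k) s =
      α ^ 2 • ∫ r in (0 : ℝ)..s, r • weightedIntegral^[ν] (sphereSeed ν α (Δ g) x) r := by
    intro s
    rw [hkdef, weightedIntegral_iterate_const_smul, weightedIntegral_const_smul]
    rfl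
  have hkν := continuous_weightedIntegral_iterate hk ν
  have hkν' : Continuous fun s : ℝ =>
      ∫ r in (0 : ℝ)..s, r • weightedIntegral^[ν] (sphereSeed ν α (Δ g) x) r :=
    continuous_weightedIntegral hkν
  have hsplit : (∫ s in (0 : ℝ)..t, ∫ r in (0 : ℝ)..s, wavePropagator ν α (Δ g) x r) =
      (∫ s in (0 : ℝ)..t, ∫ r in (0 : ℝ)..s,
        r • weightedIntegral^[ν] (sphereSeed ν α (Δ g) x) r) +
      ∫ s in (0 : ℝ)..t, ∫ r in (0 : ℝ)..s, ∑ l ∈ Finset.range ν,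
        (α ^ (2 * l) * r ^ (2 * l + 1) / ((2 * l + 1).factorial : ℝ)) • (Δ^[l] (Δ g)) x := by
    rw [← intervalIntegral.integral_add (hkν'.intervalIntegrable _ _)]
    · refine intervalIntegral.integral_congr fun s _ => ?_
      exact intervalIntegral.integral_add ((by fun_prop : Continuous _).intervalIntegrable _ _)
        ((by fun_prop : Continuous _).intervalIntegrable _ _)
    · exact (intervalIntegral.continuous_primitive (fun a b =>
        (by fun_prop : Continuous _).intervalIntegrable a b) 0).intervalIntegrable _ _
  rw [hsplit, smul_add, hpoly, wavePropagator, key, hTν, ← hT0]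
  simp only [hLk, intervalIntegral.integral_smul]
  rw [add_left_comm, hsum]
  abel

end Propagator

/-! ### Operations on the propagator -/

section PropagatorOperations

variable {𝕜 : Type*} [RCLike 𝕜] {E : Type*} [NormedAddCommGroup E] [InnerProductSpace ℝ E]
  [FiniteDimensional ℝ E]

theorem laplacian_add {f g : E → 𝕜} (hf : ContDiff ℝ ∞ f) (hg : ContDiff ℝ ∞ g) :
    (Δ fun x => f x + g x) = fun x => (Δ f) x + (Δ g) x :=
  funext fun x => ContDiffAt.laplacian_add
    (by exact_mod_cast (contDiff_infty.1 hf 2).contDiffAt)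
    (by exact_mod_cast (contDiff_infty.1 hg 2).contDiffAt)

theorem laplacian_smul {f : E → 𝕜} (hf : ContDiff ℝ ∞ f) (c : ℝ) :
    (Δ fun x => c • f x) = fun x => c • (Δ f) x :=
  funext fun x => laplacian_const_smul c (by exact_mod_cast contDiff_infty.1 hf 2) x

theorem laplacian_sum {ι : Type*} (s : Finset ι) {f : ι → E → 𝕜}
    (hf : ∀ i ∈ s, ContDiff ℝ ∞ (f i)) :
    (Δ fun x => ∑ i ∈ s, f i x) = fun x => ∑ i ∈ s, (Δ (f i)) x := by
  classical
  induction s using Finset.induction_on with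
  | empty =>
    simp only [Finset.sum_empty]
    exact InnerProductSpace.laplacian_const
  | insert i s hi ih =>
    simp only [Finset.sum_insert hi]
    rw [laplacian_add (hf i (by simp)) (ContDiff.sum fun j hj => hf j (by simp [hj])),
      ih fun j hj => hf j (by simp [hj])]

theorem laplacian_iterate_add {f g : E → 𝕜} (hf : ContDiff ℝ ∞ f) (hg : ContDiff ℝ ∞ g) (k : ℕ) :
    (Δ^[k] fun x => f x + g x) = fun x => (Δ^[k] f) x + (Δ^[k] g) x := by
  induction k with
  | zero => rfl
  | succ k ih =>
    rw [Function.iterate_succ_apply', ih, laplacian_add (contDiff_laplacian_iterate hf k)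
      (contDiff_laplacian_iterate hg k), Function.iterate_succ_apply',
      Function.iterate_succ_apply']

theorem laplacian_iterate_smul {f : E → 𝕜} (hf : ContDiff ℝ ∞ f) (c : ℝ) (k : ℕ) :
    (Δ^[k] fun x => c • f x) = fun x => c • (Δ^[k] f) x := by
  induction k with
  | zero => rfl
  | succ k ih =>
    rw [Function.iterate_succ_apply', ih, laplacian_smul (contDiff_laplacian_iterate hf k),
      Function.iterate_succ_apply']

theorem laplacian_iterate_intervalIntegral {F : ℝ → E → 𝕜} (hF : SmoothFamily F) (b : ℝ) (k : ℕ) :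
    (Δ^[k] fun x => ∫ s in (0 : ℝ)..b, F s x) = fun x => ∫ s in (0 : ℝ)..b, (Δ^[k] (F s)) x := by
  induction k with
  | zero => rfl
  | succ k ih =>
    funext x
    simp only [Function.iterate_succ_apply', ih]
    exact (hF.laplacian_iterate k).laplacian_intervalIntegral b x

variable [MeasurableSpace E] [BorelSpace E]

theorem SmoothFamily.weightedIntegral_iterate' {F : ℝ → E → 𝕜} (hF : SmoothFamily F) (k : ℕ) :
    SmoothFamily fun t x => weightedIntegral^[k] (fun ρ => F ρ x) t :=
  ((hF.comp
    (continuous_snd : Continuous (Prod.snd : Unit × ℝ → ℝ))).weightedIntegral_iterate k).comp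
    (by fun_prop : Continuous fun t : ℝ => ((), t))

theorem laplacian_weightedIntegral_iterate {F : ℝ → E → 𝕜} (hF : SmoothFamily F) (k : ℕ) (t : ℝ)
    (x : E) : (Δ fun x => weightedIntegral^[k] (fun ρ => F ρ x) t) x =
      weightedIntegral^[k] (fun ρ => (Δ (F ρ)) x) t := by
  induction k generalizing t with
  | zero => rfl
  | succ k ih =>
    simp only [Function.iterate_succ_apply', weightedIntegral]
    have hk := hF.weightedIntegral_iterate' k
    rw [(SmoothFamily.smul (c := fun t : ℝ => t) continuous_id hk).laplacian_intervalIntegral t x]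
    refine intervalIntegral.integral_congr fun s _ => ?_
    change (Δ fun x => s • weightedIntegral^[k] (fun ρ => F ρ x) s) x = _
    rw [laplacian_smul (hk.contDiff s)]
    exact congrArg (s • ·) (ih s)

theorem continuous_weightedIntegral_iterate_param {H : ℝ → ℝ → 𝕜}
    (hH : Continuous fun z : ℝ × ℝ => H z.1 z.2) (k : ℕ) :
    Continuous fun z : ℝ × ℝ => weightedIntegral^[k] (H z.1) z.2 := by
  induction k with
  | zero => exact hH
  | succ k ih =>
    simp only [Function.iterate_succ_apply', weightedIntegral]
    exact intervalIntegral.continuous_parametric_primitive_of_continuous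
      (f := fun s r => r • weightedIntegral^[k] (H s) r) (continuous_snd.smul ih)

theorem intervalIntegral_swap {H : ℝ → ℝ → 𝕜} (hH : Continuous fun z : ℝ × ℝ => H z.1 z.2)
    (a b c d : ℝ) :
    ∫ s in a..b, ∫ r in c..d, H s r = ∫ r in c..d, ∫ s in a..b, H s r :=
  intervalIntegral_intervalIntegral_swap ((hH.continuousOn.integrableOn_compact
    (isCompact_uIcc.prod isCompact_uIcc)).mono_set
      (prod_mono uIoc_subset_uIcc uIoc_subset_uIcc))

theorem weightedIntegral_iterate_intervalIntegral {H : ℝ → ℝ → 𝕜}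
    (hH : Continuous fun z : ℝ × ℝ => H z.1 z.2) (b : ℝ) (k : ℕ) (t : ℝ) :
    weightedIntegral^[k] (fun ρ => ∫ s in (0 : ℝ)..b, H s ρ) t =
      ∫ s in (0 : ℝ)..b, weightedIntegral^[k] (H s) t := by
  induction k generalizing t with
  | zero => rfl
  | succ k ih =>
    simp only [Function.iterate_succ_apply']
    rw [show weightedIntegral^[k] (fun ρ => ∫ s in (0 : ℝ)..b, H s ρ) = _ from funext ih]
    simp only [weightedIntegral, ← intervalIntegral.integral_smul]
    exact intervalIntegral_swap (H := fun r s => r • weightedIntegral^[k] (H s) r)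
      (continuous_fst.smul ((continuous_weightedIntegral_iterate_param hH k).comp
        (by fun_prop : Continuous fun z : ℝ × ℝ => (z.2, z.1)))) _ _ _ _

theorem laplacian_sphereSeed (ν : ℕ) (α : ℝ) {g : E → 𝕜} (hg : ContDiff ℝ ∞ g) (x : E) (ρ : ℝ) :
    (Δ fun x => sphereSeed ν α g x ρ) x = sphereSeed ν α (Δ g) x ρ := by
  have hG := contDiff_laplacian_iterate hg ν
  have hU : ContDiff ℝ ∞ fun x => unitSphereIntegral (Δ^[ν] g) x (α * ρ) :=
    (SmoothFamily.const (X := Unit) hG).unitSphereIntegral.contDiff ((), α * ρ)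
  have hΔ : Δ^[ν] (Δ g) = Δ (Δ^[ν] g) := by
    rw [← Function.iterate_succ_apply, Function.iterate_succ_apply']
  simp only [sphereSeed]
  rw [laplacian_smul hU, show (Δ fun x => unitSphereIntegral (Δ^[ν] g) x (α * ρ)) = _ from
    laplacian_iterate_unitSphereIntegral hG (α * ρ) 1, hΔ]
  rfl

theorem smoothFamily_sphereSeed (ν : ℕ) (α : ℝ) {g : E → 𝕜} (hg : ContDiff ℝ ∞ g) :
    SmoothFamily fun ρ x => sphereSeed ν α g x ρ :=
  ((SmoothFamily.const (X := Unit) hg).sphereSeed ν α).comp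
    (by fun_prop : Continuous fun t : ℝ => ((), t))

theorem smoothFamily_wavePropagator (ν : ℕ) (α : ℝ) {g : E → 𝕜} (hg : ContDiff ℝ ∞ g) :
    SmoothFamily fun t x => wavePropagator ν α g x t :=
  ((SmoothFamily.const (X := Unit) hg).wavePropagator ν α).comp
    (by fun_prop : Continuous fun t : ℝ => ((), t))

theorem laplacian_wavePropagator (ν : ℕ) (α : ℝ) {g : E → 𝕜} (hg : ContDiff ℝ ∞ g) (x : E)
    (t : ℝ) : (Δ fun x => wavePropagator ν α g x t) x = wavePropagator ν α (Δ g) x t := by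
  have hs := smoothFamily_sphereSeed ν α hg
  have hw := (hs.weightedIntegral_iterate' ν).contDiff t
  simp only [wavePropagator]
  rw [laplacian_add (hw.const_smul t) (ContDiff.sum fun l _ =>
      (contDiff_laplacian_iterate hg l).const_smul _), laplacian_smul hw,
    laplacian_sum _ fun l _ => (contDiff_laplacian_iterate hg l).const_smul _]
  simp only [laplacian_smul (contDiff_laplacian_iterate hg _)]
  rw [laplacian_weightedIntegral_iterate hs]
  simp only [laplacian_sphereSeed ν α hg, ← Function.iterate_succ_apply]
  simp only [← Function.iterate_succ_apply' Δ]

theorem unitSphereIntegral_add {f g : E → 𝕜} (hf : Continuous f) (hg : Continuous g) (x : E)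
    (r : ℝ) : unitSphereIntegral (fun x => f x + g x) x r =
      unitSphereIntegral f x r + unitSphereIntegral g x r :=
  integral_add (integrable_sphere_of_continuous (by fun_prop))
    (integrable_sphere_of_continuous (by fun_prop))

theorem unitSphereIntegral_smul (c : ℝ) (f : E → 𝕜) (x : E) (r : ℝ) :
    unitSphereIntegral (fun x => c • f x) x r = c • unitSphereIntegral f x r :=
  integral_smul _ _

theorem wavePropagator_add (ν : ℕ) (α : ℝ) {f g : E → 𝕜} (hf : ContDiff ℝ ∞ f)
    (hg : ContDiff ℝ ∞ g) (x : E) (t : ℝ) :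
    wavePropagator ν α (fun x => f x + g x) x t =
      wavePropagator ν α f x t + wavePropagator ν α g x t := by
  have hs : sphereSeed ν α (fun x => f x + g x) x =
      fun ρ => sphereSeed ν α f x ρ + sphereSeed ν α g x ρ := by
    funext ρ
    simp only [sphereSeed]
    rw [laplacian_iterate_add hf hg, unitSphereIntegral_add
      (contDiff_laplacian_iterate hf ν).continuous (contDiff_laplacian_iterate hg ν).continuous,
      smul_add]
  simp only [wavePropagator, hs]
  rw [weightedIntegral_iterate_add (continuous_sphereSeed ν α hf x)
    (continuous_sphereSeed ν α hg x)]
  simp only [laplacian_iterate_add hf hg, smul_add, Finset.sum_add_distrib]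
  abel

theorem wavePropagator_smul (ν : ℕ) (α : ℝ) (c : ℝ) {f : E → 𝕜} (hf : ContDiff ℝ ∞ f) (x : E)
    (t : ℝ) : wavePropagator ν α (fun x => c • f x) x t = c • wavePropagator ν α f x t := by
  have hs : sphereSeed ν α (fun x => c • f x) x = fun ρ => c • sphereSeed ν α f x ρ := by
    funext ρ
    simp only [sphereSeed]
    rw [laplacian_iterate_smul hf, unitSphereIntegral_smul, smul_comm]
  simp only [wavePropagator, hs]
  rw [weightedIntegral_iterate_const_smul]
  simp only [laplacian_iterate_smul hf, smul_add, Finset.smul_sum, smul_comm _ c]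

theorem wavePropagator_zero (ν : ℕ) (α : ℝ) (x : E) (t : ℝ) :
    wavePropagator ν α (fun _ => (0 : 𝕜)) x t = 0 := by
  simpa using wavePropagator_smul ν α 0 (contDiff_const (c := (0 : 𝕜))) x t

theorem SmoothFamily.continuous_sphereSeed {F : ℝ → E → 𝕜} (hF : SmoothFamily F) (ν : ℕ) (α : ℝ)
    (x : E) : Continuous fun z : ℝ × ℝ => MultipleWave.sphereSeed ν α (F z.1) x z.2 :=
  (hF.sphereSeed ν α).continuous_left x

theorem SmoothFamily.continuous_wavePropagator {F : ℝ → E → 𝕜} (hF : SmoothFamily F) (ν : ℕ)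
    (α : ℝ) (x : E) : Continuous fun z : ℝ × ℝ => MultipleWave.wavePropagator ν α (F z.1) x z.2 :=
  (hF.wavePropagator ν α).continuous_left x

/-- The propagator commutes with integrals over a parameter. -/
theorem wavePropagator_intervalIntegral (ν : ℕ) (α : ℝ) {F : ℝ → E → 𝕜} (hF : SmoothFamily F)
    (b : ℝ) (x : E) (t : ℝ) :
    wavePropagator ν α (fun x => ∫ s in (0 : ℝ)..b, F s x) x t =
      ∫ s in (0 : ℝ)..b, wavePropagator ν α (F s) x t := by
  have hs : sphereSeed ν α (fun x => ∫ s in (0 : ℝ)..b, F s x) x =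
      fun ρ => ∫ s in (0 : ℝ)..b, sphereSeed ν α (F s) x ρ := by
    funext ρ
    simp only [sphereSeed, intervalIntegral.integral_smul]
    rw [laplacian_iterate_intervalIntegral hF, unitSphereIntegral_intervalIntegral
      (hF.laplacian_iterate ν).continuous]
  have hc := hF.continuous_sphereSeed ν α x
  have h1 : Continuous fun s => t • weightedIntegral^[ν] (sphereSeed ν α (F s) x) t :=
    ((continuous_weightedIntegral_iterate_param
      (H := fun s ρ => sphereSeed ν α (F s) x ρ) hc ν).comp
      (by fun_prop : Continuous fun s : ℝ => (s, t))).const_smul t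
  have h2 : ∀ l, Continuous fun s =>
      (α ^ (2 * l) * t ^ (2 * l + 1) / ((2 * l + 1).factorial : ℝ)) • (Δ^[l] (F s)) x := fun l =>
    ((hF.laplacian_iterate l).continuous_left x).const_smul _
  simp only [wavePropagator, hs]
  rw [intervalIntegral.integral_add (h1.intervalIntegrable _ _)
    ((continuous_finsetSum _ fun l _ => h2 l).intervalIntegrable _ _),
    intervalIntegral.integral_finsetSum fun l _ => (h2 l).intervalIntegrable _ _,
    weightedIntegral_iterate_intervalIntegral (H := fun s ρ => sphereSeed ν α (F s) x ρ) hc]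
  simp only [intervalIntegral.integral_smul, laplacian_iterate_intervalIntegral hF]

end PropagatorOperations

/-! ### Time integrals of convolutions -/

section Convolution

variable {W : Type*} [NormedAddCommGroup W] [NormedSpace ℝ W] [CompleteSpace W]

theorem integral_primitive_convolution_left {k : ℝ → ℝ → W} (hk : Continuous ↿k) (t : ℝ) :
    ∫ τ in (0 : ℝ)..t, ∫ σ in (0 : ℝ)..τ, k σ (t - τ) =
      ∫ s in (0 : ℝ)..t, ∫ τ in (0 : ℝ)..s, k τ (s - τ) := by
  have hk' : Continuous fun z : ℝ × ℝ => k z.1 z.2 := hk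
  have hswap : Continuous ↿(fun τ σ => k σ τ) :=
    hk'.comp (by fun_prop : Continuous fun z : ℝ × ℝ => (z.2, z.1))
  have h1 := intervalIntegral.integral_comp_sub_left
    (fun τ => ∫ σ in (0 : ℝ)..(t - τ), k σ τ) (a := 0) (b := t) t
  simp only [sub_sub_cancel, sub_self, sub_zero] at h1
  rw [h1, ← integral_primitive_convolution hswap t]
  refine intervalIntegral.integral_congr fun s _ => ?_
  have h2 := intervalIntegral.integral_comp_sub_left
    (fun τ => k τ (s - τ)) (a := 0) (b := s) s
  simpa using h2

theorem integral_primitive_primitive_convolution {k : ℝ → ℝ → W} (hk : Continuous ↿k) (t : ℝ) :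
    ∫ τ in (0 : ℝ)..t, ∫ σ in (0 : ℝ)..(t - τ), ∫ r in (0 : ℝ)..σ, k τ r =
      ∫ s in (0 : ℝ)..t, ∫ s' in (0 : ℝ)..s, ∫ τ in (0 : ℝ)..s', k τ (s' - τ) := by
  rw [← integral_primitive_convolution (k := fun τ σ => ∫ r in (0 : ℝ)..σ, k τ r)
    (intervalIntegral.continuous_parametric_primitive_of_continuous (f := k) hk)]
  simp only [integral_primitive_convolution hk]

end Convolution

/-! ### The algebra of operators on smooth evolutions -/

section OperatorAlgebra

variable {A : Type*} [Ring A] [Algebra ℝ A] {J L D : A} {c : ℝ}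

theorem one_sub_mul_eq_sq (hDL : Commute D L) (h : D = J ^ 2 + c • (J ^ 2 * (D * L))) :
    (1 - c • (J ^ 2 * L)) * D = J ^ 2 := by
  rw [hDL.eq] at h
  rwa [sub_mul, one_mul, smul_mul_assoc, mul_assoc, sub_eq_iff_eq_add]

/-- If `D = J² + c J² D L` and `D`, `J`, `L` commute, then `1 + c L D` is inverse to `1 - c J² L`;
`D` plays the role of Duhamel's operator, `J` and `L` those of the integral in time and the
Laplacian. -/
theorem one_sub_mul_one_add (hJL : Commute J L) (hDL : Commute D L)
    (h : D = J ^ 2 + c • (J ^ 2 * (D * L))) :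
    (1 - c • (J ^ 2 * L)) * (1 + c • (L * D)) = 1 := by
  have hc : Commute (1 - c • (J ^ 2 * L)) L :=
    (Commute.one_left _).sub_left (((hJL.pow_left 2).mul_left (Commute.refl _)).smul_left _)
  rw [mul_add, mul_one, mul_smul_comm, ← mul_assoc, hc.eq, mul_assoc,
    one_sub_mul_eq_sq hDL h, (hJL.pow_left 2).eq, sub_add_cancel]

theorem one_add_mul_one_sub (hJL : Commute J L) (hDL : Commute D L) (hDJ : Commute D J)
    (h : D = J ^ 2 + c • (J ^ 2 * (D * L))) :
    (1 + c • (L * D)) * (1 - c • (J ^ 2 * L)) = 1 := by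
  have hL : Commute L (J ^ 2 * L) := (hJL.symm.pow_right 2).mul_right (Commute.refl _)
  have hD : Commute D (J ^ 2 * L) := (hDJ.pow_right 2).mul_right hDL
  have hc : Commute (c • (L * D)) (1 - c • (J ^ 2 * L)) :=
    (Commute.one_right _).sub_right (((hL.mul_left hD).smul_left c).smul_right c)
  exact ((Commute.one_left _).add_left hc).eq.trans (one_sub_mul_one_add hJL hDL h)

end OperatorAlgebra

section SmoothEvolution

variable (E : Type*) [NormedAddCommGroup E] [InnerProductSpace ℝ E] [FiniteDimensional ℝ E]
  (𝕜 : Type*) [RCLike 𝕜]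

/-- The space of functions of time and position which are smooth in the position, all derivatives
in the position being jointly continuous. Time runs through all of `ℝ`, so that the integral from
`0` is an injective operator commuting with the Laplacian. -/
def smoothEvolution : Submodule ℝ (ℝ → E → 𝕜) where
  carrier := {F | SmoothFamily F}
  add_mem' hF hG := hF.add hG
  zero_mem' := SmoothFamily.const (contDiff_const (c := (0 : 𝕜)))
  smul_mem' c _ hF := SmoothFamily.smul (c := fun _ => c) continuous_const hF

variable {E 𝕜}

variable (E 𝕜) in
/-- The elements of `smoothEvolution E 𝕜` as a type. It is a definition of its own, not a coercion
of the submodule, so that its module structure is found without unfolding the function space. -/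
def Evolution : Type _ := smoothEvolution E 𝕜

noncomputable instance : AddCommGroup (Evolution E 𝕜) :=
  inferInstanceAs (AddCommGroup (smoothEvolution E 𝕜))

noncomputable instance : Module ℝ (Evolution E 𝕜) :=
  inferInstanceAs (Module ℝ (smoothEvolution E 𝕜))

/-- The underlying function of time and position. -/
@[coe] def Evolution.toFun (F : Evolution E 𝕜) : ℝ → E → 𝕜 :=
  Subtype.val (p := fun F => F ∈ smoothEvolution E 𝕜) F

instance : CoeFun (Evolution E 𝕜) fun _ => ℝ → E → 𝕜 := ⟨Evolution.toFun⟩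

namespace Evolution

/-- The evolution given by a smooth family. -/
def mk (F : ℝ → E → 𝕜) (hF : SmoothFamily F) : Evolution E 𝕜 := ⟨F, hF⟩

theorem smoothFamily (F : Evolution E 𝕜) : SmoothFamily F :=
  Subtype.property (p := fun F => F ∈ smoothEvolution E 𝕜) F

theorem contDiff (F : Evolution E 𝕜) (t : ℝ) : ContDiff ℝ ∞ (F t) := F.smoothFamily.contDiff t

theorem continuous (F : Evolution E 𝕜) (x : E) : Continuous fun t => F t x :=
  F.smoothFamily.continuous_left x

theorem ext {F G : Evolution E 𝕜} (h : ∀ t x, F t x = G t x) : F = G :=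
  Subtype.ext (funext fun t => funext fun x => h t x)

theorem add_apply (F G : Evolution E 𝕜) (t : ℝ) (x : E) : (F + G) t x = F t x + G t x := rfl

theorem sub_apply (F G : Evolution E 𝕜) (t : ℝ) (x : E) : (F - G) t x = F t x - G t x := rfl

theorem zero_apply (t : ℝ) (x : E) : (0 : Evolution E 𝕜) t x = 0 := rfl

theorem smul_apply (c : ℝ) (F : Evolution E 𝕜) (t : ℝ) (x : E) : (c • F) t x = c • F t x := rfl

theorem sum_apply {ι : Type*} (s : Finset ι) (F : ι → Evolution E 𝕜) (t : ℝ) (x : E) :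
    (∑ i ∈ s, F i) t x = ∑ i ∈ s, F i t x := by
  classical
  induction s using Finset.induction_on with
  | empty => simp [zero_apply]
  | insert i s hi ih => rw [Finset.sum_insert hi, Finset.sum_insert hi, add_apply, ih]

end Evolution

variable (E 𝕜) in
/-- Integration in time from `0`. -/
noncomputable def timeIntegral : Module.End ℝ (Evolution E 𝕜) where
  toFun F := .mk (fun t x => ∫ s in (0 : ℝ)..t, F s x)
    (SmoothFamily.intervalIntegral (F := fun z : ℝ × ℝ => F z.2)
      (F.smoothFamily.comp continuous_snd) continuous_id)
  map_add' F G := Evolution.ext fun _ x => intervalIntegral.integral_add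
    ((F.continuous x).intervalIntegrable _ _)
    ((G.continuous x).intervalIntegrable _ _)
  map_smul' c F := Evolution.ext fun _ x =>
    intervalIntegral.integral_smul c fun s => F s x

variable (E 𝕜) in
/-- The Laplacian in the position. -/
noncomputable def spaceLaplacian : Module.End ℝ (Evolution E 𝕜) where
  toFun F := .mk (fun t => Δ (F t)) F.smoothFamily.laplacian
  map_add' F G := Evolution.ext fun t =>
    congrFun (laplacian_add (F.smoothFamily.contDiff t) (G.smoothFamily.contDiff t))
  map_smul' c F := Evolution.ext fun t => congrFun (laplacian_smul (F.smoothFamily.contDiff t) c)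

variable [MeasurableSpace E] [BorelSpace E]

variable (E 𝕜) in
/-- Duhamel's operator: the solution of `∂ₜ² w - α² Δ w = F` with vanishing initial values, as a
superposition of solutions `wavePropagator ν α (F τ)` started at the times `τ`. -/
noncomputable def duhamel (ν : ℕ) (α : ℝ) : Module.End ℝ (Evolution E 𝕜) where
  toFun F := .mk (fun t x => ∫ τ in (0 : ℝ)..t, wavePropagator ν α (F τ) x (t - τ))
    (SmoothFamily.intervalIntegral
      (F := fun z : ℝ × ℝ => fun x => wavePropagator ν α (F z.2) x (z.1 - z.2))
      ((SmoothFamily.wavePropagator ν α F.smoothFamily).comp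
        (by fun_prop : Continuous fun z : ℝ × ℝ => (z.2, z.1 - z.2))) continuous_id)
  map_add' F G := Evolution.ext fun t x => by
    have h : ∀ F : Evolution E 𝕜, Continuous fun τ =>
        wavePropagator ν α (F τ) x (t - τ) := fun F =>
      (SmoothFamily.continuous_wavePropagator F.smoothFamily ν α x).comp
        (by fun_prop : Continuous fun τ : ℝ => (τ, t - τ))
    refine Eq.trans (intervalIntegral.integral_congr fun τ _ => ?_)
      (intervalIntegral.integral_add ((h F).intervalIntegrable _ _)
        ((h G).intervalIntegrable _ _))
    exact wavePropagator_add ν α (F.smoothFamily.contDiff τ) (G.smoothFamily.contDiff τ) x (t - τ)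
  map_smul' c F := Evolution.ext fun t x => by
    refine Eq.trans (intervalIntegral.integral_congr fun τ _ => ?_)
      (intervalIntegral.integral_smul c _)
    exact wavePropagator_smul ν α c (F.smoothFamily.contDiff τ) x (t - τ)

theorem timeIntegral_apply (F : Evolution E 𝕜) (t : ℝ) (x : E) :
    (timeIntegral E 𝕜 F) t x = ∫ s in (0 : ℝ)..t, F s x := rfl

theorem spaceLaplacian_apply (F : Evolution E 𝕜) (t : ℝ) :
    (spaceLaplacian E 𝕜 F) t = Δ (F t) := rfl

theorem duhamel_apply (ν : ℕ) (α : ℝ) (F : Evolution E 𝕜) (t : ℝ) (x : E) :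
    (duhamel E 𝕜 ν α F) t x =
      ∫ τ in (0 : ℝ)..t, wavePropagator ν α (F τ) x (t - τ) := rfl

theorem spaceLaplacian_pow_apply (F : Evolution E 𝕜) (k : ℕ) (t : ℝ) :
    ((spaceLaplacian E 𝕜 ^ k) F : ℝ → E → 𝕜) t = Δ^[k] (F t) := by
  induction k with
  | zero => rfl
  | succ k ih =>
    rw [pow_succ', Module.End.mul_apply, spaceLaplacian_apply, ih, Function.iterate_succ_apply']

theorem commute_timeIntegral_spaceLaplacian :
    Commute (timeIntegral E 𝕜) (spaceLaplacian E 𝕜) :=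
  LinearMap.ext fun F => Evolution.ext fun t x =>
    (SmoothFamily.laplacian_intervalIntegral F.smoothFamily t x).symm

theorem continuous_duhamel_kernel (ν : ℕ) (α : ℝ) (F : Evolution E 𝕜) (x : E) :
    Continuous ↿fun τ σ => wavePropagator ν α (F τ) x σ :=
  SmoothFamily.continuous_wavePropagator F.smoothFamily ν α x

theorem commute_duhamel_timeIntegral (ν : ℕ) (α : ℝ) :
    Commute (duhamel E 𝕜 ν α) (timeIntegral E 𝕜) := by
  refine LinearMap.ext fun F => Evolution.ext fun t x => ?_
  simp only [Module.End.mul_apply, duhamel_apply, timeIntegral_apply]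
  rw [← integral_primitive_convolution_left (continuous_duhamel_kernel ν α F x)]
  refine intervalIntegral.integral_congr fun τ _ => ?_
  exact wavePropagator_intervalIntegral ν α F.smoothFamily τ x (t - τ)

theorem commute_duhamel_spaceLaplacian (ν : ℕ) (α : ℝ) :
    Commute (duhamel E 𝕜 ν α) (spaceLaplacian E 𝕜) := by
  refine LinearMap.ext fun F => Evolution.ext fun t x => ?_
  simp only [Module.End.mul_apply, duhamel_apply, spaceLaplacian_apply]
  have hG : SmoothFamily fun τ x => wavePropagator ν α (F τ) x (t - τ) :=
    (SmoothFamily.wavePropagator ν α F.smoothFamily).comp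
      (by fun_prop : Continuous fun τ : ℝ => (τ, t - τ))
  refine Eq.trans ?_ (hG.laplacian_intervalIntegral t x).symm
  exact intervalIntegral.integral_congr fun τ _ =>
    (laplacian_wavePropagator ν α (F.smoothFamily.contDiff τ) x (t - τ)).symm

variable (E 𝕜) in
/-- The inverse `1 + α² Δ D` of the integrated wave operator `1 - α² J² Δ`, where `J` is the
integral in time and `D` Duhamel's operator. -/
noncomputable def waveResolvent (ν : ℕ) (α : ℝ) : Module.End ℝ (Evolution E 𝕜) :=
  1 + α ^ 2 • (spaceLaplacian E 𝕜 * duhamel E 𝕜 ν α)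

section Resolvent

variable {ν : ℕ} (hE : Module.finrank ℝ E = 2 * ν + 3) {α : ℝ} (hα : α ≠ 0)

include hE hα

/-- The wave equation for Duhamel's operator `D`, integrated twice in time: `D = J² + α² J² D Δ`. -/
theorem duhamel_eq : duhamel E 𝕜 ν α = timeIntegral E 𝕜 ^ 2 +
    α ^ 2 • (timeIntegral E 𝕜 ^ 2 * (duhamel E 𝕜 ν α * spaceLaplacian E 𝕜)) := by
  refine LinearMap.ext fun F => Evolution.ext fun t x => ?_
  have hc := (continuous_duhamel_kernel ν α (spaceLaplacian E 𝕜 F) x)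
  have hF := F.continuous x
  have h1 : ∫ τ in (0 : ℝ)..t, (t - τ) • F τ x =
      ∫ s in (0 : ℝ)..t, ∫ τ in (0 : ℝ)..s, F τ x := by
    have := integral_primitive_convolution (k := fun τ _ => F τ x)
      (hF.comp continuous_fst) t
    simpa using this.symm
  have h2 := integral_primitive_primitive_convolution hc t
  have h3 : Continuous fun τ => (t - τ) • F τ x := by fun_prop
  have h4 : Continuous fun τ => ∫ σ in (0 : ℝ)..(t - τ), ∫ r in (0 : ℝ)..σ,
      wavePropagator ν α (spaceLaplacian E 𝕜 F τ) x r := by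
    have h5 := intervalIntegral.continuous_parametric_primitive_of_continuous (μ := volume)
      (a₀ := 0) (f := fun τ σ => ∫ r in (0 : ℝ)..σ,
        wavePropagator ν α (spaceLaplacian E 𝕜 F τ) x r)
      (intervalIntegral.continuous_parametric_primitive_of_continuous (f := fun τ σ =>
        wavePropagator ν α (spaceLaplacian E 𝕜 F τ) x σ) hc)
    exact h5.comp (by fun_prop : Continuous fun τ : ℝ => (τ, t - τ))
  have h6 : (duhamel E 𝕜 ν α F) t x = ∫ τ in (0 : ℝ)..t,
      ((t - τ) • F τ x + α ^ 2 • ∫ σ in (0 : ℝ)..(t - τ), ∫ r in (0 : ℝ)..σ,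
        wavePropagator ν α (spaceLaplacian E 𝕜 F τ) x r) :=
    intervalIntegral.integral_congr fun τ _ =>
      wavePropagator_eq hE hα (F.smoothFamily.contDiff τ) x (t - τ)
  rw [h6, intervalIntegral.integral_add (h3.intervalIntegrable _ _)
    ((show Continuous fun τ => α ^ 2 • ∫ σ in (0 : ℝ)..(t - τ), ∫ r in (0 : ℝ)..σ,
      wavePropagator ν α (spaceLaplacian E 𝕜 F τ) x r from
        h4.const_smul (α ^ 2)).intervalIntegrable _ _), intervalIntegral.integral_smul, h1, h2]
  simp only [pow_two, LinearMap.add_apply, LinearMap.smul_apply, Module.End.mul_apply]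
  rfl

theorem one_sub_mul_waveResolvent :
    (1 - α ^ 2 • (timeIntegral E 𝕜 ^ 2 * spaceLaplacian E 𝕜)) * waveResolvent E 𝕜 ν α = 1 :=
  one_sub_mul_one_add commute_timeIntegral_spaceLaplacian (commute_duhamel_spaceLaplacian ν α)
    (duhamel_eq hE hα)

theorem waveResolvent_mul_one_sub :
    waveResolvent E 𝕜 ν α * (1 - α ^ 2 • (timeIntegral E 𝕜 ^ 2 * spaceLaplacian E 𝕜)) = 1 :=
  one_add_mul_one_sub commute_timeIntegral_spaceLaplacian (commute_duhamel_spaceLaplacian ν α)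
    (commute_duhamel_timeIntegral ν α) (duhamel_eq hE hα)

theorem duhamel_eq_mul_waveResolvent :
    duhamel E 𝕜 ν α = timeIntegral E 𝕜 ^ 2 * waveResolvent E 𝕜 ν α := by
  have h := duhamel_eq (𝕜 := 𝕜) hE hα
  rw [waveResolvent, mul_add, mul_one, mul_smul_comm,
    ← (commute_duhamel_spaceLaplacian (𝕜 := 𝕜) (E := E) ν α).eq]
  exact h

end Resolvent

theorem commute_waveResolvent_timeIntegral (ν : ℕ) (α : ℝ) :
    Commute (waveResolvent E 𝕜 ν α) (timeIntegral E 𝕜) :=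
  (Commute.one_left _).add_left ((commute_timeIntegral_spaceLaplacian.symm.mul_left
    (commute_duhamel_timeIntegral ν α)).smul_left _)

theorem commute_waveResolvent_spaceLaplacian (ν : ℕ) (α : ℝ) :
    Commute (waveResolvent E 𝕜 ν α) (spaceLaplacian E 𝕜) :=
  (Commute.one_left _).add_left (((Commute.refl _).mul_left
    (commute_duhamel_spaceLaplacian ν α)).smul_left _)

variable (E 𝕜) in
/-- The evolutions that vanish at nonnegative times. -/
def vanishingForward : Submodule ℝ (Evolution E 𝕜) where
  carrier := {F | ∀ t, 0 ≤ t → F t = 0}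
  add_mem' {F G} hF hG t ht := by
    change F t + G t = 0
    rw [hF t ht, hG t ht, add_zero]
  zero_mem' t _ := rfl
  smul_mem' c F hF t ht := by
    change c • F t = 0
    rw [hF t ht, smul_zero]

/-- Causality: at a time `t ≥ 0`, Duhamel's operator only uses the times between `0` and `t`. -/
theorem waveResolvent_mem_vanishingForward (ν : ℕ) (α : ℝ) {F : Evolution E 𝕜}
    (hF : F ∈ vanishingForward E 𝕜) : waveResolvent E 𝕜 ν α F ∈ vanishingForward E 𝕜 := by
  have hD : duhamel E 𝕜 ν α F ∈ vanishingForward E 𝕜 := fun t ht => by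
    funext x
    rw [duhamel_apply, intervalIntegral.integral_congr (g := fun _ => 0)]
    · simp
    · intro τ hτ
      rw [uIcc_of_le ht] at hτ
      simp only [hF τ hτ.1]
      exact wavePropagator_zero ν α x (t - τ)
  refine add_mem hF (Submodule.smul_mem _ _ fun t ht => ?_)
  rw [Module.End.mul_apply, spaceLaplacian_apply, hD t ht]
  exact InnerProductSpace.laplacian_const

end SmoothEvolution

/-! ### The symbol and partial fractions -/

section Symbol

open Polynomial

variable {m : ℕ} (a : Fin m → ℝ)

theorem symbolCoeff_two_mul (k : ℕ) :
    symbolCoeff a (2 * k) = (∏ i, (X - C (a i ^ 2)) : ℝ[X]).coeff k := by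
  have h : (∏ i, (X ^ 2 - C (a i ^ 2)) : ℝ[X]) = expand ℝ 2 (∏ i, (X - C (a i ^ 2))) := by
    simp [map_prod]
  rw [symbolCoeff, h, mul_comm, coeff_expand_mul (by norm_num)]

/-- Reversing the order of the coefficients of `∏ i, (X - a_i²)` gives `∏ i, (1 - a_i² X)`. -/
theorem prod_one_sub_eq_sum :
    (∏ i, (1 - C (a i ^ 2) * X) : ℝ[X]) =
      ∑ k ∈ Finset.range (m + 1), C (symbolCoeff a (2 * k)) * X ^ (m - k) := by
  set p : ℝ[X] := ∏ i, (X - C (a i ^ 2)) with hp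
  have hdeg : p.natDegree = m := by
    rw [hp, natDegree_prod_of_monic _ _ fun i _ => monic_X_sub_C _]
    simp only [natDegree_X_sub_C, Finset.sum_const, Finset.card_univ, Fintype.card_fin,
      smul_eq_mul, mul_one]
  have hrev : ∀ s : Finset (Fin m), (∏ i ∈ s, (X - C (a i ^ 2)) : ℝ[X]).reverse =
      ∏ i ∈ s, (1 - C (a i ^ 2) * X) := by
    classical
    intro s
    induction s using Finset.induction_on with
    | empty => simp only [Finset.prod_empty]; rw [← C_1, reverse_C]
    | insert i s hi ih =>
      rw [Finset.prod_insert hi, Finset.prod_insert hi, reverse_mul_of_domain, ih]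
      congr 1
      have h1 : reflect 1 (X : ℝ[X]) = 1 := by simp
      rw [reverse, natDegree_X_sub_C, reflect_sub, reflect_C, h1, pow_one]
  rw [← hrev, ← hp, Polynomial.as_sum_range_C_mul_X_pow' (n := m + 1) p.reverse
    (Nat.lt_succ_of_le ((reverse_natDegree_le p).trans hdeg.le)), ← Finset.sum_range_reflect]
  refine Finset.sum_congr rfl fun k hk => ?_
  have hk' : k ≤ m := Nat.lt_succ_iff.1 (Finset.mem_range.1 hk)
  rw [coeff_reverse, hdeg, symbolCoeff_two_mul, show m + 1 - 1 - k = m - k by omega,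
    revAt_le (by omega), show m - (m - k) = k by omega]

/-- Partial fractions. The summands are the Lagrange basis polynomials for the nodes `a_i⁻²`, and
these add up to `1`. -/
theorem sum_weight_prod_one_sub (ha_pos : ∀ i, 0 < a i) (ha_inj : Function.Injective a)
    (hm : 1 ≤ m) :
    ∑ j, C (weight a j) * ∏ i ∈ Finset.univ.erase j, (1 - C (a i ^ 2) * X) = (1 : ℝ[X]) := by
  have hsq : Function.Injective fun i => a i ^ 2 := fun i j hij =>
    ha_inj ((pow_left_inj₀ (ha_pos i).le (ha_pos j).le two_ne_zero).1 hij)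
  have hv : Function.Injective fun i => (a i ^ 2)⁻¹ := inv_injective.comp hsq
  have : Nonempty (Fin m) := ⟨⟨0, hm⟩⟩
  refine Eq.trans ?_ (Lagrange.sum_basis (s := Finset.univ) (v := fun i => (a i ^ 2)⁻¹) hv.injOn
    Finset.univ_nonempty)
  refine Finset.sum_congr rfl fun j _ => ?_
  have hw : weight a j = ∏ i ∈ Finset.univ.erase j, (a j ^ 2 / (a j ^ 2 - a i ^ 2)) := by
    rw [weight, Finset.prod_div_distrib, Finset.prod_const, Finset.card_erase_of_mem
      (Finset.mem_univ j), Finset.card_univ, Fintype.card_fin, ← pow_mul, Nat.mul_sub]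
  rw [hw, map_prod, ← Finset.prod_mul_distrib, Lagrange.basis]
  refine Finset.prod_congr rfl fun i hi => ?_
  have hij : a j ^ 2 - a i ^ 2 ≠ 0 := sub_ne_zero.2 (hsq.ne (Finset.ne_of_mem_erase hi).symm)
  have hi0 := (ha_pos i).ne'
  have hj0 := (ha_pos j).ne'
  have e : (a j ^ 2)⁻¹ - (a i ^ 2)⁻¹ = -(a j ^ 2 - a i ^ 2) / (a i ^ 2 * a j ^ 2) := by
    field_simp
    ring
  have e2 : ((a j ^ 2)⁻¹ - (a i ^ 2)⁻¹)⁻¹ = -(a j ^ 2 / (a j ^ 2 - a i ^ 2)) * a i ^ 2 := by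
    rw [e]
    field_simp
  have e3 : ((a j ^ 2)⁻¹ - (a i ^ 2)⁻¹)⁻¹ * (a i ^ 2)⁻¹ = -(a j ^ 2 / (a j ^ 2 - a i ^ 2)) := by
    rw [e2]
    field_simp
  rw [Lagrange.basisDivisor, mul_sub (C ((a j ^ 2)⁻¹ - (a i ^ 2)⁻¹)⁻¹), ← C_mul, e3, e2]
  simp only [C_mul, C_neg]
  ring

variable {A : Type*} [Ring A] [Algebra ℝ A] (z : A)

theorem aeval_prod_one_sub :
    aeval z (∏ i, (1 - C (a i ^ 2) * X) : ℝ[X]) =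
      ∑ k ∈ Finset.range (m + 1), symbolCoeff a (2 * k) • z ^ (m - k) := by
  rw [prod_one_sub_eq_sum]
  simp [Algebra.smul_def]

/-- If the factors `1 - a_i² z` have right inverses `r i`, the weighted sum of these inverses is
the right inverse of the product of the factors. -/
theorem aeval_prod_mul_sum_weight (ha_pos : ∀ i, 0 < a i) (ha_inj : Function.Injective a)
    (hm : 1 ≤ m) {r : Fin m → A} (hr : ∀ i, (1 - a i ^ 2 • z) * r i = 1) :
    (∑ k ∈ Finset.range (m + 1), symbolCoeff a (2 * k) • z ^ (m - k)) *
      ∑ j, weight a j • r j = 1 := by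
  rw [← aeval_prod_one_sub, Finset.mul_sum]
  have h := congrArg (aeval z) (sum_weight_prod_one_sub a ha_pos ha_inj hm)
  rw [map_sum, map_one] at h
  rw [← h]
  refine Finset.sum_congr rfl fun j _ => ?_
  rw [← Finset.prod_erase_mul _ _ (Finset.mem_univ j), map_mul, mul_smul_comm, mul_assoc]
  have : aeval z (1 - C (a j ^ 2) * X : ℝ[X]) = 1 - a j ^ 2 • z := by
    simp [Algebra.smul_def]
  rw [this, hr, mul_one, map_mul, aeval_C, ← Algebra.smul_def]

theorem sum_weight_mul_aeval_prod (ha_pos : ∀ i, 0 < a i) (ha_inj : Function.Injective a)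
    (hm : 1 ≤ m) {r : Fin m → A} (hr : ∀ i, r i * (1 - a i ^ 2 • z) = 1) :
    (∑ j, weight a j • r j) *
      (∑ k ∈ Finset.range (m + 1), symbolCoeff a (2 * k) • z ^ (m - k)) = 1 := by
  rw [← aeval_prod_one_sub, Finset.sum_mul]
  have h := congrArg (aeval z) (sum_weight_prod_one_sub a ha_pos ha_inj hm)
  rw [map_sum, map_one] at h
  rw [← h]
  refine Finset.sum_congr rfl fun j _ => ?_
  rw [← Finset.mul_prod_erase _ _ (Finset.mem_univ j), map_mul, smul_mul_assoc, ← mul_assoc]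
  have : aeval z (1 - C (a j ^ 2) * X : ℝ[X]) = 1 - a j ^ 2 • z := by
    simp [Algebra.smul_def]
  rw [this, hr, one_mul, map_mul, aeval_C, ← Algebra.smul_def]

end Symbol

/-! ### Iterated primitives -/

section Primitive

variable {W : Type*} [NormedAddCommGroup W] [NormedSpace ℝ W] [CompleteSpace W]

/-- The primitive vanishing at `0`. -/
noncomputable def primitive (h : ℝ → W) (t : ℝ) : W := ∫ s in (0 : ℝ)..t, h s

theorem continuous_primitive_iterate_param {X : Type*} [TopologicalSpace X]
    [FirstCountableTopology X] {k : X → ℝ → W}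
    (hk : Continuous fun z : X × ℝ => k z.1 z.2) (q : ℕ) :
    Continuous fun z : X × ℝ => primitive^[q] (k z.1) z.2 := by
  induction q with
  | zero => exact hk
  | succ q ih =>
    simp only [Function.iterate_succ_apply']
    exact intervalIntegral.continuous_parametric_primitive_of_continuous
      (f := fun p => primitive^[q] (k p)) ih

theorem primitive_iterate_convolution {k : ℝ → ℝ → W} (hk : Continuous ↿k) (q : ℕ) (t : ℝ) :
    primitive^[q] (fun s => ∫ τ in (0 : ℝ)..s, k τ (s - τ)) t =
      ∫ τ in (0 : ℝ)..t, primitive^[q] (k τ) (t - τ) := by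
  induction q generalizing t with
  | zero => rfl
  | succ q ih =>
    simp only [Function.iterate_succ_apply']
    rw [primitive, intervalIntegral.integral_congr fun s _ => ih s]
    exact integral_primitive_convolution (k := fun τ => primitive^[q] (k τ))
      (continuous_primitive_iterate_param hk q) t

theorem primitive_iterate_pow_smul (p q : ℕ) (c : W) (t : ℝ) :
    primitive^[q] (fun s => (s ^ p / (p.factorial : ℝ)) • c) t =
      (t ^ (p + q) / ((p + q).factorial : ℝ)) • c := by
  induction q generalizing t with
  | zero => rfl
  | succ q ih =>
    rw [Function.iterate_succ_apply', primitive, intervalIntegral.integral_congr fun s _ => ih s,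
      intervalIntegral.integral_smul_const, intervalIntegral.integral_div, integral_pow]
    congr 1
    rw [← add_assoc, Nat.factorial_succ]
    push_cast
    field_simp
    simp

end Primitive

/-- Cauchy's formula for iterated integrals. -/
theorem iterIntegral_eq_primitive_iterate {𝕜 : Type*} [RCLike 𝕜] {h : ℝ → 𝕜} (hh : Continuous h)
    (q : ℕ) : iterIntegral q h = primitive^[q] h := by
  rcases q with _ | q
  · funext t
    simp [iterIntegral]
  induction q with
  | zero =>
    funext t
    simp [iterIntegral, primitive]
  | succ q ih =>
    funext t
    rw [Function.iterate_succ_apply', ← ih]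
    have hk : Continuous ↿fun (τ σ : ℝ) => (σ ^ q / (q.factorial : ℝ)) • h τ := by
      change Continuous fun z : ℝ × ℝ => (z.2 ^ q / (q.factorial : ℝ)) • h z.1
      fun_prop
    have h1 := integral_primitive_convolution hk t
    simp only [iterIntegral, primitive, Nat.add_eq_zero_iff, one_ne_zero, and_false, if_false,
      Nat.add_sub_cancel]
    rw [h1]
    refine intervalIntegral.integral_congr fun τ _ => ?_
    exact (primitive_iterate_pow_smul q 1 (h τ) (t - τ)).symm

/-! ### Elementary evolutions -/

section Evolution

variable {E : Type*} [NormedAddCommGroup E] [InnerProductSpace ℝ E] [FiniteDimensional ℝ E]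
  [MeasurableSpace E] [BorelSpace E] {𝕜 : Type*} [RCLike 𝕜]

theorem timeIntegral_pow_apply (F : Evolution E 𝕜) (q : ℕ) (t : ℝ) (x : E) :
    (timeIntegral E 𝕜 ^ q) F t x = primitive^[q] (fun s => F s x) t := by
  induction q generalizing t with
  | zero => rfl
  | succ q ih =>
    rw [pow_succ', Module.End.mul_apply, timeIntegral_apply, Function.iterate_succ_apply',
      primitive]
    simp only [ih]

theorem hasDerivAt_timeIntegral (F : Evolution E 𝕜) (t : ℝ) (x : E) :
    HasDerivAt (fun s => timeIntegral E 𝕜 F s x) (F t x) t :=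
  hasDerivAt_primitive (F.continuous x) t

theorem iteratedDerivWithin_timeIntegral_pow (F : Evolution E 𝕜) {i p : ℕ} (hi : i ≤ p) (x : E)
    {t : ℝ} (ht : 0 ≤ t) :
    iteratedDerivWithin i (fun s => (timeIntegral E 𝕜 ^ p) F s x) (Ici 0) t =
      (timeIntegral E 𝕜 ^ (p - i)) F t x := by
  induction i generalizing t with
  | zero => simp
  | succ i ih =>
    have hcongr : derivWithin
        (iteratedDerivWithin i (fun s => (timeIntegral E 𝕜 ^ p) F s x) (Ici 0)) (Ici 0) t = derivWithin (fun s => (timeIntegral E 𝕜 ^ (p - i)) F s x) (Ici 0) t :=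
      derivWithin_congr (fun s hs => ih (Nat.le_of_succ_le hi) hs) (ih (Nat.le_of_succ_le hi) ht)
    rw [iteratedDerivWithin_succ, hcongr]
    have h : p - i = (p - (i + 1)) + 1 := by omega
    rw [h, pow_succ']
    exact (hasDerivAt_timeIntegral _ t x).hasDerivWithinAt.derivWithin (uniqueDiffOn_Ici 0 t ht)

/-- The evolution constant in time. -/
def Evolution.stationary (g : E → 𝕜) (hg : ContDiff ℝ ∞ g) : Evolution E 𝕜 :=
  .mk (fun _ => g) (SmoothFamily.const hg)

/-- The solution of the wave equation with initial velocity `g`, as an evolution. -/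
noncomputable def Evolution.wave (ν : ℕ) (α : ℝ) (g : E → 𝕜) (hg : ContDiff ℝ ∞ g) :
    Evolution E 𝕜 :=
  .mk (fun t x => wavePropagator ν α g x t) (smoothFamily_wavePropagator ν α hg)

theorem duhamel_stationary (ν : ℕ) (α : ℝ) {g : E → 𝕜} (hg : ContDiff ℝ ∞ g) :
    duhamel E 𝕜 ν α (.stationary g hg) = timeIntegral E 𝕜 (.wave ν α g hg) := by
  refine Evolution.ext fun t x => ?_
  have := intervalIntegral.integral_comp_sub_left (fun σ => wavePropagator ν α g x σ)
    (a := 0) (b := t) t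
  rw [sub_self, sub_zero] at this
  exact this

/-- The wave with initial velocity `g` is `J (1 - α² J² Δ)⁻¹ g`. -/
theorem timeIntegral_waveResolvent_stationary {ν : ℕ} (hE : Module.finrank ℝ E = 2 * ν + 3) {α : ℝ}
    (hα : α ≠ 0) {g : E → 𝕜} (hg : ContDiff ℝ ∞ g) :
    timeIntegral E 𝕜 (waveResolvent E 𝕜 ν α (.stationary g hg)) = .wave ν α g hg := by
  have h1 : timeIntegral E 𝕜 (spaceLaplacian E 𝕜 (duhamel E 𝕜 ν α (.stationary g hg))) =
      spaceLaplacian E 𝕜 (timeIntegral E 𝕜 (timeIntegral E 𝕜 (.wave ν α g hg))) := by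
    rw [duhamel_stationary]
    exact LinearMap.congr_fun commute_timeIntegral_spaceLaplacian.eq _
  have h2 : spaceLaplacian E 𝕜 (.wave ν α g hg) =
      .wave ν α (Δ g) (contDiff_laplacian_iterate hg 1) :=
    Evolution.ext fun t x => laplacian_wavePropagator ν α hg x t
  have h3 : spaceLaplacian E 𝕜 (timeIntegral E 𝕜 (timeIntegral E 𝕜 (.wave ν α g hg))) =
      timeIntegral E 𝕜 (timeIntegral E 𝕜 (.wave ν α (Δ g) (contDiff_laplacian_iterate hg 1))) := by
    have hc := fun F : Evolution E 𝕜 =>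
      LinearMap.congr_fun (commute_timeIntegral_spaceLaplacian (E := E) (𝕜 := 𝕜)).eq F
    simp only [Module.End.mul_apply] at hc
    rw [← hc, ← hc, h2]
  rw [waveResolvent, LinearMap.add_apply, LinearMap.smul_apply, Module.End.mul_apply, map_add,
    map_smul, h1, h3]
  refine Evolution.ext fun t x => ?_
  refine Eq.trans ?_ (wavePropagator_eq hE hα hg x t).symm
  have h4 : timeIntegral E 𝕜 (.stationary g hg) t x = t • g x := by
    change ∫ s in (0 : ℝ)..t, g x = _
    simp
  rw [← h4]
  rfl

/-- The sum of the first `ν` terms of the Neumann series of `(1 - α² J² Δ)⁻¹ F`. For `F` constant in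
time, the time integral of this sum is the polynomial part of `wavePropagator`. -/
noncomputable def Evolution.taylor (ν : ℕ) (α : ℝ) (F : Evolution E 𝕜) : Evolution E 𝕜 :=
  ∑ l ∈ Finset.range ν, α ^ (2 * l) • (timeIntegral E 𝕜 ^ (2 * l)) ((spaceLaplacian E 𝕜 ^ l) F)

theorem timeIntegral_pow_taylor_stationary (ν : ℕ) (α : ℝ) {g : E → 𝕜} (hg : ContDiff ℝ ∞ g)
    (p : ℕ) (t : ℝ) (x : E) :
    (timeIntegral E 𝕜 ^ p) (Evolution.taylor ν α (.stationary g hg)) t x =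
      ∑ l ∈ Finset.range ν, (α ^ (2 * l) * t ^ (2 * l + p) / ((2 * l + p).factorial : ℝ)) •
        (Δ^[l] g) x := by
  simp only [Evolution.taylor, map_sum, map_smul, Evolution.sum_apply, Evolution.smul_apply]
  refine Finset.sum_congr rfl fun l _ => ?_
  rw [← Module.End.mul_apply, ← pow_add, timeIntegral_pow_apply]
  simp only [spaceLaplacian_pow_apply]
  have h := primitive_iterate_pow_smul 0 (p + 2 * l) ((Δ^[l] g) x) t
  simp only [pow_zero, Nat.factorial_zero, Nat.cast_one, div_one, one_smul, zero_add] at h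
  change α ^ (2 * l) • primitive^[p + 2 * l] (fun _ => (Δ^[l] g) x) t = _
  rw [h, smul_smul, mul_div_assoc, add_comm p]

end Evolution

/-! ### The spherical means in the formula -/

section SphericalTerm

variable {𝕜 : Type*} [RCLike 𝕜]

/-- The value of `h` at `0` does not matter, because of the factor `s` in `weightedIntegral` for
`k > 0` and because of the factor `t` for `k = 0`. -/
theorem smul_weightedIntegral_iterate_congr {h h' : ℝ → 𝕜} (H : ∀ s, s ≠ 0 → h s = h' s) (k : ℕ)
    (t : ℝ) : t • weightedIntegral^[k] h t = t • weightedIntegral^[k] h' t := by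
  have hs : ∀ s : ℝ, s • h s = s • h' s := fun s => by
    rcases eq_or_ne s 0 with rfl | hs
    · simp
    · rw [H s hs]
  rcases k with _ | k
  · exact hs t
  · simp only [Function.iterate_succ_apply]
    rw [show weightedIntegral h = weightedIntegral h' from
      funext fun t => intervalIntegral.integral_congr fun s _ => hs s]

variable {n : ℕ}

/-- At radius `0`, where the surface integral is divided by `(α ρ) ^ (n - 1) = 0`, the two
integrands may differ, but this value has no effect on either side. -/
theorem sphericalTerm_eq {ν : ℕ} {α : ℝ} (hα : α ≠ 0) {g : EuclideanSpace ℝ (Fin n) → 𝕜}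
    (hg : ContDiff ℝ ∞ g) (x : EuclideanSpace ℝ (Fin n)) (τ : ℝ) :
    sphericalTerm ν α g x τ = τ • weightedIntegral^[ν] (sphereSeed ν α g x) τ := by
  refine smul_weightedIntegral_iterate_congr (fun ρ hρ => ?_) ν τ
  have hr : (α * ρ) ^ (n - 1) ≠ 0 := pow_ne_zero _ (mul_ne_zero hα hρ)
  have hU : ContDiff ℝ ∞ fun y => unitSphereIntegral g y (α * ρ) :=
    (SmoothFamily.const (X := Unit) hg).unitSphereIntegral.contDiff ((), α * ρ)
  have h1 : (fun y => (1 / (2 * (2 * Real.pi) ^ (ν + 1) * (α * ρ) ^ (n - 1))) •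
      sphereIntegral g y (α * ρ)) =
      fun y => (1 / (2 * (2 * Real.pi) ^ (ν + 1))) • unitSphereIntegral g y (α * ρ) := by
    funext y
    change _ • ((α * ρ) ^ (n - 1) • unitSphereIntegral g y (α * ρ)) = _
    rw [smul_smul]
    congr 1
    have := Real.pi_pos
    field_simp
  rw [h1, laplacian_iterate_smul hU, laplacian_iterate_unitSphereIntegral hg, sphereSeed, smul_smul,
    mul_one_div]

theorem wavePropagator_eq_sphericalTerm_add {ν : ℕ} {α : ℝ} (hα : α ≠ 0)
    {g : EuclideanSpace ℝ (Fin n) → 𝕜} (hg : ContDiff ℝ ∞ g) (t : ℝ)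
    (x : EuclideanSpace ℝ (Fin n)) :
    wavePropagator ν α g x t = sphericalTerm ν α g x t +
      timeIntegral _ 𝕜 (Evolution.taylor ν α (.stationary g hg)) t x := by
  have h := timeIntegral_pow_taylor_stationary ν α hg 1 t x
  rw [pow_one] at h
  rw [sphericalTerm_eq hα hg, h, wavePropagator]

/-- The iterated integrals of the spherical terms, expressed by the propagator. -/
theorem iterIntegral_sum_sphericalTerm (ν : ℕ) {m : ℕ} {a : Fin m → ℝ} (ha : ∀ i, a i ≠ 0)
    {g : EuclideanSpace ℝ (Fin n) → 𝕜} (hg : ContDiff ℝ ∞ g) (q : ℕ) (t : ℝ)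
    (x : EuclideanSpace ℝ (Fin n)) :
    iterIntegral q (fun τ => ∑ j, weight a j • sphericalTerm ν (a j) g x τ) t =
      (timeIntegral _ 𝕜 ^ q) (∑ j, weight a j • (Evolution.wave ν (a j) g hg -
        timeIntegral _ 𝕜 (Evolution.taylor ν (a j) (.stationary g hg)))) t x := by
  have h : (fun τ => ∑ j, weight a j • sphericalTerm ν (a j) g x τ) = fun τ =>
      (∑ j, weight a j • (Evolution.wave ν (a j) g hg -
        timeIntegral _ 𝕜 (Evolution.taylor ν (a j) (.stationary g hg)))) τ x := by
    funext τ
    rw [Evolution.sum_apply]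
    refine Finset.sum_congr rfl fun j _ => ?_
    rw [Evolution.smul_apply, Evolution.sub_apply]
    exact congrArg (weight a j • ·)
      (eq_sub_of_add_eq (wavePropagator_eq_sphericalTerm_add (ha j) hg τ x).symm)
  rw [h, iterIntegral_eq_primitive_iterate (Evolution.continuous _ x), timeIntegral_pow_apply]

end SphericalTerm

/-! ### The integrated Cauchy problem -/

section IntegratedProblem

variable {E : Type*} [NormedAddCommGroup E] [InnerProductSpace ℝ E] [FiniteDimensional ℝ E]
  [MeasurableSpace E] [BorelSpace E] {𝕜 : Type*} [RCLike 𝕜] {m : ℕ} (a : Fin m → ℝ)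

variable (E 𝕜) in
/-- The `2m`-fold time integral of `P(∂_x, ∂_t)`, that is
`∑ k ≤ m, b (2k) (J² Δ)^(m-k) = ∏ i, (1 - a_i² J² Δ)` with `J` the integral in time. -/
noncomputable def integratedSymbol : Module.End ℝ (Evolution E 𝕜) :=
  ∑ k ∈ Finset.range (m + 1),
    symbolCoeff a (2 * k) • (timeIntegral E 𝕜 ^ 2 * spaceLaplacian E 𝕜) ^ (m - k)

variable (E 𝕜) in
/-- The inverse of the integrated symbol, by partial fractions. -/
noncomputable def integratedResolvent (ν : ℕ) : Module.End ℝ (Evolution E 𝕜) :=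
  ∑ j, weight a j • waveResolvent E 𝕜 ν (a j)

/-- The `2m`-fold time integral of the right-hand side of the equation, corrected by the initial
values `Φ r` (evolutions constant in time). -/
noncomputable def integratedData (F : Evolution E 𝕜) (Φ : ℕ → Evolution E 𝕜) : Evolution E 𝕜 :=
  (timeIntegral E 𝕜 ^ (2 * m)) F + ∑ k ∈ Finset.range (m + 1), symbolCoeff a (2 * k) •
    ((timeIntegral E 𝕜 ^ 2 * spaceLaplacian E 𝕜) ^ (m - k))
      (∑ r ∈ Finset.range (2 * k), (timeIntegral E 𝕜 ^ r) (Φ r))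

theorem commute_integratedResolvent_timeIntegral (ν : ℕ) :
    Commute (integratedResolvent E 𝕜 a ν) (timeIntegral E 𝕜) :=
  Commute.sum_left _ _ _ fun j _ => (commute_waveResolvent_timeIntegral ν (a j)).smul_left _

theorem commute_integratedResolvent_spaceLaplacian (ν : ℕ) :
    Commute (integratedResolvent E 𝕜 a ν) (spaceLaplacian E 𝕜) :=
  Commute.sum_left _ _ _ fun j _ => (commute_waveResolvent_spaceLaplacian ν (a j)).smul_left _

theorem integratedResolvent_mem_vanishingForward (ν : ℕ) {F : Evolution E 𝕜}
    (hF : F ∈ vanishingForward E 𝕜) :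
    integratedResolvent E 𝕜 a ν F ∈ vanishingForward E 𝕜 := by
  rw [integratedResolvent, LinearMap.sum_apply]
  exact sum_mem fun j _ => Submodule.smul_mem _ _ (waveResolvent_mem_vanishingForward ν (a j) hF)

variable {a} {ν : ℕ} (hE : Module.finrank ℝ E = 2 * ν + 3) (hm : 1 ≤ m)
  (ha_pos : ∀ i, 0 < a i) (ha_inj : Function.Injective a)

include hE hm ha_pos ha_inj

theorem integratedSymbol_mul_integratedResolvent :
    integratedSymbol E 𝕜 a * integratedResolvent E 𝕜 a ν = 1 :=
  aeval_prod_mul_sum_weight a _ ha_pos ha_inj hm fun i =>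
    one_sub_mul_waveResolvent hE (ha_pos i).ne'

theorem integratedResolvent_mul_integratedSymbol :
    integratedResolvent E 𝕜 a ν * integratedSymbol E 𝕜 a = 1 :=
  sum_weight_mul_aeval_prod a _ ha_pos ha_inj hm fun i =>
    waveResolvent_mul_one_sub hE (ha_pos i).ne'

/-- Uniqueness for the integrated problem, forward in time. -/
theorem mem_vanishingForward_of_integratedSymbol {F : Evolution E 𝕜}
    (hF : integratedSymbol E 𝕜 a F ∈ vanishingForward E 𝕜) : F ∈ vanishingForward E 𝕜 := by
  have h := LinearMap.congr_fun
    (integratedResolvent_mul_integratedSymbol (𝕜 := 𝕜) hE hm ha_pos ha_inj) F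
  rw [Module.End.mul_apply, Module.End.one_apply] at h
  rw [← h]
  exact integratedResolvent_mem_vanishingForward a ν hF

end IntegratedProblem

/-! ### The explicit formula -/

section Formula

variable {E : Type*} [NormedAddCommGroup E] [InnerProductSpace ℝ E] [FiniteDimensional ℝ E]
  [MeasurableSpace E] [BorelSpace E] {𝕜 : Type*} [RCLike 𝕜] {m : ℕ} {a : Fin m → ℝ} {ν : ℕ}

/-- The solution of the integrated problem, sorted by data: the resolvent absorbs two of the `2m`
time integrals of `F`, since `J² (1 - a_j² J² Δ)⁻¹` is Duhamel's operator. -/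
theorem integratedResolvent_integratedData (hE : Module.finrank ℝ E = 2 * ν + 3) (hm : 1 ≤ m)
    (ha : ∀ i, a i ≠ 0) (F : Evolution E 𝕜) (Φ : ℕ → Evolution E 𝕜) :
    integratedResolvent E 𝕜 a ν (integratedData a F Φ) =
      (timeIntegral E 𝕜 ^ (2 * m - 2)) (∑ j, weight a j • duhamel E 𝕜 ν (a j) F) +
      ∑ k ∈ Finset.range (m + 1), symbolCoeff a (2 * k) • (spaceLaplacian E 𝕜 ^ (m - k))
        (∑ r ∈ Finset.range (2 * k), (timeIntegral E 𝕜 ^ (2 * m - 2 * k + r))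
          (integratedResolvent E 𝕜 a ν (Φ r))) := by
  have hJ := fun q =>
    ((commute_integratedResolvent_timeIntegral (E := E) (𝕜 := 𝕜) a ν).pow_right q).eq
  have hJL := commute_timeIntegral_spaceLaplacian (E := E) (𝕜 := 𝕜)
  rw [integratedData, map_add, map_sum]
  refine congrArg₂ (· + ·) ?_ (Finset.sum_congr rfl fun k hk => ?_)
  · have h2 : 2 * m = 2 * m - 2 + 2 := by omega
    have h3 : timeIntegral E 𝕜 ^ 2 * integratedResolvent E 𝕜 a ν =
        ∑ j, weight a j • duhamel E 𝕜 ν (a j) := by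
      rw [integratedResolvent, Finset.mul_sum]
      refine Finset.sum_congr rfl fun j _ => ?_
      rw [mul_smul_comm, duhamel_eq_mul_waveResolvent hE (ha j)]
    have h4 : integratedResolvent E 𝕜 a ν * timeIntegral E 𝕜 ^ (2 * m) =
        timeIntegral E 𝕜 ^ (2 * m - 2) * ∑ j, weight a j • duhamel E 𝕜 ν (a j) := by
      rw [hJ, ← h3, ← mul_assoc, ← pow_add, ← h2]
    have h5 := LinearMap.congr_fun h4 F
    rw [Module.End.mul_apply, Module.End.mul_apply, LinearMap.sum_apply] at h5
    exact h5
  · have hk' : k ≤ m := Nat.lt_succ_iff.1 (Finset.mem_range.1 hk)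
    rw [map_smul, map_sum, map_sum, map_sum]
    congr 1
    refine Finset.sum_congr rfl fun r _ => ?_
    have h4 : integratedResolvent E 𝕜 a ν * ((timeIntegral E 𝕜 ^ 2 * spaceLaplacian E 𝕜) ^ (m - k) *
        timeIntegral E 𝕜 ^ r) = spaceLaplacian E 𝕜 ^ (m - k) *
          (timeIntegral E 𝕜 ^ (2 * m - 2 * k + r) * integratedResolvent E 𝕜 a ν) := by
      have hR := commute_integratedResolvent_timeIntegral (E := E) (𝕜 := 𝕜) a ν
      rw [((((hR.pow_right 2).mul_right
        (commute_integratedResolvent_spaceLaplacian a ν)).pow_right (m - k)).mul_right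
          (hR.pow_right r)).eq, (hJL.pow_left 2).mul_pow, ← pow_mul,
        ((hJL.pow_left _).pow_right _).eq, pow_add, show 2 * (m - k) = 2 * m - 2 * k by omega]
      simp only [mul_assoc]
    exact LinearMap.congr_fun h4 (Φ r)

end Formula

section SolutionFormula

variable {𝕜 : Type*} [RCLike 𝕜] {m n ν : ℕ} {a : Fin m → ℝ}

/-- The terms of the formula which contain the right-hand side `f`. The Taylor part that the
spherical terms lack is supplied by the second integral. -/
theorem integral_sphericalTerm_add_integral_taylor (ha : ∀ i, a i ≠ 0)
    (F : Evolution (EuclideanSpace ℝ (Fin n)) 𝕜)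
    (hm : 1 ≤ m) (t : ℝ) (x : EuclideanSpace ℝ (Fin n)) :
    (∫ τ in (0 : ℝ)..t, iterIntegral (2 * m - 2)
      (fun τ' => ∑ j, weight a j • sphericalTerm ν (a j) (F τ) x τ') (t - τ))
    + (∫ τ in (0 : ℝ)..t, ∑ j, weight a j • ∑ l ∈ Finset.range ν,
      (a j ^ (2 * l) * (t - τ) ^ (2 * l + 2 * m - 1) / ((2 * l + 2 * m - 1).factorial : ℝ)) •
        (Δ^[l] (F τ)) x) =
    (timeIntegral _ 𝕜 ^ (2 * m - 2)) (∑ j, weight a j • duhamel _ 𝕜 ν (a j) F) t x := by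
  set k : ℝ → ℝ → 𝕜 := fun τ σ => ∑ j, weight a j • wavePropagator ν (a j) (F τ) x σ with hk_def
  have hk : Continuous ↿k := by
    change Continuous fun z : ℝ × ℝ => ∑ j, weight a j • wavePropagator ν (a j) (F z.1) x z.2
    exact continuous_finsetSum _ fun j _ =>
      (F.smoothFamily.continuous_wavePropagator ν (a j) x).const_smul _
  set B : ℝ → 𝕜 := fun τ => ∑ j, weight a j • ∑ l ∈ Finset.range ν,
      (a j ^ (2 * l) * (t - τ) ^ (2 * l + 2 * m - 1) / ((2 * l + 2 * m - 1).factorial : ℝ)) •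
        (Δ^[l] (F τ)) x with hB_def
  have hB : Continuous B := by
    have h := fun l => (F.smoothFamily.laplacian_iterate l).continuous_left x
    refine continuous_finsetSum _ fun j _ => Continuous.const_smul
      (continuous_finsetSum _ fun l _ => Continuous.smul (by fun_prop) (h l)) _
  have hC : Continuous fun τ => primitive^[2 * m - 2] (k τ) (t - τ) :=
    (continuous_primitive_iterate_param hk (2 * m - 2)).comp
      (by fun_prop : Continuous fun τ : ℝ => (τ, t - τ))
  have hA : ∀ τ, iterIntegral (2 * m - 2)
      (fun τ' => ∑ j, weight a j • sphericalTerm ν (a j) (F τ) x τ') (t - τ) =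
      primitive^[2 * m - 2] (k τ) (t - τ) - B τ := fun τ => by
    rw [iterIntegral_sum_sphericalTerm ν ha (F.contDiff τ)]
    simp only [smul_sub, Finset.sum_sub_distrib, map_sub, Evolution.sub_apply]
    congr 1
    · rw [timeIntegral_pow_apply]
      refine congrArg (fun h => primitive^[2 * m - 2] h (t - τ)) (funext fun s => ?_)
      rw [Evolution.sum_apply]
      rfl
    · rw [map_sum, Evolution.sum_apply]
      refine Finset.sum_congr rfl fun j _ => ?_
      rw [map_smul, Evolution.smul_apply, ← Module.End.mul_apply, ← pow_succ,
        timeIntegral_pow_taylor_stationary]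
      refine congrArg (weight a j • ·) (Finset.sum_congr rfl fun l _ => ?_)
      rw [show 2 * l + (2 * m - 2 + 1) = 2 * l + 2 * m - 1 by omega]
  simp only [hA]
  rw [intervalIntegral.integral_sub (hC.intervalIntegrable _ _) (hB.intervalIntegrable _ _),
    sub_add_cancel, ← primitive_iterate_convolution hk, timeIntegral_pow_apply]
  refine congrArg (fun h => primitive^[2 * m - 2] h t) (funext fun s => ?_)
  rw [Evolution.sum_apply]
  simp only [hk_def]
  rw [intervalIntegral.integral_finsetSum]
  · refine Finset.sum_congr rfl fun j _ => ?_
    rw [intervalIntegral.integral_smul]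
    rfl
  · intro j _
    exact (((F.smoothFamily.continuous_wavePropagator ν (a j) x).comp
      (by fun_prop : Continuous fun τ : ℝ => (τ, s - τ))).const_smul _).intervalIntegrable _ _

/-- The formula gives, at nonnegative times, the solution of the integrated problem. -/
theorem solutionFormula_eq (hn : n = 2 * ν + 3) (hm : 1 ≤ m) (ha : ∀ i, a i ≠ 0)
    {f : EuclideanSpace ℝ (Fin n) → ℝ → 𝕜} {φ : ℕ → EuclideanSpace ℝ (Fin n) → 𝕜}
    (F : Evolution (EuclideanSpace ℝ (Fin n)) 𝕜)
    (hF : ∀ t, 0 ≤ t → F t = fun x => f x t) (hφ : ∀ r < 2 * m, ContDiff ℝ ∞ (φ r))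
    (Φ : ℕ → Evolution (EuclideanSpace ℝ (Fin n)) 𝕜)
    (hΦ : ∀ r (hr : r < 2 * m), Φ r = .stationary (φ r) (hφ r hr))
    {t : ℝ} (ht : 0 ≤ t) (x : EuclideanSpace ℝ (Fin n)) :
    solutionFormula ν a f φ x t =
      integratedResolvent _ 𝕜 a ν (integratedData a F Φ) t x := by
  have hE : Module.finrank ℝ (EuclideanSpace ℝ (Fin n)) = 2 * ν + 3 := by simp [hn]
  rw [integratedResolvent_integratedData hE hm ha, Evolution.add_apply,
    ← integral_sphericalTerm_add_integral_taylor ha F hm, solutionFormula, add_assoc]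
  refine congrArg₂ (· + ·) (congrArg₂ (· + ·) ?_ ?_) ?_
  · refine intervalIntegral.integral_congr fun τ hτ => ?_
    rw [uIcc_of_le ht] at hτ
    simp only [hF τ hτ.1]
  · refine intervalIntegral.integral_congr fun τ hτ => ?_
    rw [uIcc_of_le ht] at hτ
    simp only [hF τ hτ.1]
  · rw [← Finset.sum_add_distrib, Evolution.sum_apply]
    refine Finset.sum_congr rfl fun k hk => ?_
    have hk' : k ≤ m := Nat.lt_succ_iff.1 (Finset.mem_range.1 hk)
    -- The two groups of terms containing the initial values, as evolutions: `Z r` belongs to the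
    -- spherical terms, `T r` to the Taylor polynomials.
    set Z : ℕ → Evolution (EuclideanSpace ℝ (Fin n)) 𝕜 := fun r => ∑ j, weight a j •
      (waveResolvent _ 𝕜 ν (a j) (Φ r) - Evolution.taylor ν (a j) (Φ r)) with hZ
    set T : ℕ → Evolution (EuclideanSpace ℝ (Fin n)) 𝕜 := fun r =>
      ∑ j, weight a j • Evolution.taylor ν (a j) (Φ r) with hT
    have hZT : ∀ r, integratedResolvent _ 𝕜 a ν (Φ r) = Z r + T r := fun r => by
      simp only [integratedResolvent, LinearMap.sum_apply, LinearMap.smul_apply, hZ, hT, smul_sub,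
        Finset.sum_sub_distrib, sub_add_cancel]
    have h1 : ∀ y, ∑ r ∈ Finset.range (2 * k), iteratedDerivWithin (2 * k - 1 - r)
        (iterIntegral (2 * m - 2) fun τ => ∑ j, weight a j • sphericalTerm ν (a j) (φ r) y τ)
          (Ici 0) t =
        (∑ r ∈ Finset.range (2 * k), (timeIntegral _ 𝕜 ^ (2 * m - 2 * k + r)) (Z r)) t y :=
      fun y => by
        rw [Evolution.sum_apply]
        refine Finset.sum_congr rfl fun r hr => ?_
        have hr' : r < 2 * k := Finset.mem_range.1 hr
        have hrm : r < 2 * m := by omega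
        -- As `J` applied to the resolvent is a wave, `2m - 2` integrals of the spherical terms are
        -- `2m - 1` integrals of `Z r`, of which the time derivatives remove `2k - 1 - r`.
        have h2 : (iterIntegral (2 * m - 2) fun τ => ∑ j, weight a j •
            sphericalTerm ν (a j) (φ r) y τ) =
            fun s => (timeIntegral _ 𝕜 ^ (2 * m - 1)) (Z r) s y := by
          funext s
          rw [iterIntegral_sum_sphericalTerm ν ha (hφ r hrm),
            show 2 * m - 1 = 2 * m - 2 + 1 by omega, pow_succ, Module.End.mul_apply]
          simp only [hZ, map_sum, map_smul, map_sub, hΦ r hrm,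
            timeIntegral_waveResolvent_stationary hE (ha _)]
        rw [h2, iteratedDerivWithin_timeIntegral_pow _ (by omega) y ht,
          show 2 * m - 1 - (2 * k - 1 - r) = 2 * m - 2 * k + r by omega]
    have h3 : ∀ y, ∑ r ∈ Finset.range (2 * k), ∑ j, weight a j • ∑ l ∈ Finset.range ν,
          (a j ^ (2 * l) * t ^ (2 * l + 2 * m + r - 2 * k) /
              ((2 * l + 2 * m + r - 2 * k).factorial : ℝ)) • (Δ^[l] (φ r)) y =
        (∑ r ∈ Finset.range (2 * k), (timeIntegral _ 𝕜 ^ (2 * m - 2 * k + r)) (T r)) t y :=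
      fun y => by
        rw [Evolution.sum_apply]
        refine Finset.sum_congr rfl fun r hr => ?_
        have hr' : r < 2 * k := Finset.mem_range.1 hr
        have hrm : r < 2 * m := by omega
        simp only [hT, map_sum, map_smul, Evolution.sum_apply, Evolution.smul_apply, hΦ r hrm,
          timeIntegral_pow_taylor_stationary]
        refine Finset.sum_congr rfl fun j _ => congrArg (weight a j • ·)
          (Finset.sum_congr rfl fun l _ => ?_)
        rw [show 2 * l + 2 * m + r - 2 * k = 2 * l + (2 * m - 2 * k + r) by omega]
    simp only [h1, h3, hZT, map_add, Finset.sum_add_distrib, Evolution.smul_apply,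
      Evolution.add_apply, spaceLaplacian_pow_apply, smul_add]

end SolutionFormula

/-! ### Time derivatives of the solution of the integrated problem -/

section TimeDerivatives

variable {E : Type*} [NormedAddCommGroup E] [InnerProductSpace ℝ E] [FiniteDimensional ℝ E]
  [MeasurableSpace E] [BorelSpace E] {𝕜 : Type*} [RCLike 𝕜]

theorem timeIntegral_injective : Function.Injective (timeIntegral E 𝕜) := fun F G h =>
  Evolution.ext fun t x => (hasDerivAt_timeIntegral F t x).unique
    (by rw [h]; exact hasDerivAt_timeIntegral G t x)

theorem timeIntegral_pow_injective (q : ℕ) : Function.Injective (timeIntegral E 𝕜 ^ q) := by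
  induction q with
  | zero => exact Function.injective_id
  | succ q ih =>
    rw [pow_succ]
    exact ih.comp timeIntegral_injective

theorem timeIntegral_pow_mem_range {F : Evolution E 𝕜} {q : ℕ}
    (hF : F ∈ LinearMap.range (timeIntegral E 𝕜 ^ q)) (p : ℕ) :
    (timeIntegral E 𝕜 ^ p) F ∈ LinearMap.range (timeIntegral E 𝕜 ^ (p + q)) := by
  obtain ⟨G, rfl⟩ := hF
  exact ⟨G, by rw [pow_add, Module.End.mul_apply]⟩

theorem spaceLaplacian_pow_mem_range {F : Evolution E 𝕜} {q : ℕ}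
    (hF : F ∈ LinearMap.range (timeIntegral E 𝕜 ^ q)) (p : ℕ) :
    (spaceLaplacian E 𝕜 ^ p) F ∈ LinearMap.range (timeIntegral E 𝕜 ^ q) := by
  obtain ⟨G, rfl⟩ := hF
  exact ⟨(spaceLaplacian E 𝕜 ^ p) G, LinearMap.congr_fun
    ((commute_timeIntegral_spaceLaplacian (E := E) (𝕜 := 𝕜)).pow_pow q p).eq G⟩

theorem range_timeIntegral_pow_anti {p q : ℕ} (h : p ≤ q) :
    LinearMap.range (timeIntegral E 𝕜 ^ q) ≤ LinearMap.range (timeIntegral E 𝕜 ^ p) := by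
  rintro _ ⟨G, rfl⟩
  exact ⟨(timeIntegral E 𝕜 ^ (q - p)) G, by
    rw [← Module.End.mul_apply, ← pow_add, Nat.add_sub_cancel' h]⟩

variable {m : ℕ} {a : Fin m → ℝ}

theorem symbolCoeff_top : symbolCoeff a (2 * m) = 1 := by
  rw [symbolCoeff_two_mul]
  have hmonic := Polynomial.monic_prod_of_monic Finset.univ
    (fun i => (Polynomial.X - Polynomial.C (a i ^ 2) : Polynomial ℝ))
    fun i _ => Polynomial.monic_X_sub_C _
  have hdeg : (∏ i, (Polynomial.X - Polynomial.C (a i ^ 2)) : Polynomial ℝ).natDegree = m := by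
    rw [Polynomial.natDegree_prod_of_monic _ _ fun i _ => Polynomial.monic_X_sub_C _]
    simp only [Polynomial.natDegree_X_sub_C, Finset.sum_const, Finset.card_univ, Fintype.card_fin,
      smul_eq_mul, mul_one]
  have := hmonic.coeff_natDegree
  rwa [hdeg] at this

theorem symbol_pow_eq (k : ℕ) :
    (timeIntegral E 𝕜 ^ 2 * spaceLaplacian E 𝕜) ^ k =
      timeIntegral E 𝕜 ^ (2 * k) * spaceLaplacian E 𝕜 ^ k := by
  rw [((commute_timeIntegral_spaceLaplacian (E := E) (𝕜 := 𝕜)).pow_left 2).mul_pow, ← pow_mul]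

/-- The integrated equation, solved for its leading term. -/
theorem sum_symbol_sub_eq {S F : Evolution E 𝕜} {Φ : ℕ → Evolution E 𝕜}
    (hS : integratedSymbol E 𝕜 a S = integratedData a F Φ) :
    ∑ k ∈ Finset.range (m + 1), symbolCoeff a (2 * k) •
      (timeIntegral E 𝕜 ^ (2 * (m - k))) ((spaceLaplacian E 𝕜 ^ (m - k))
        (S - ∑ r ∈ Finset.range (2 * k), (timeIntegral E 𝕜 ^ r) (Φ r))) =
      (timeIntegral E 𝕜 ^ (2 * m)) F := by
  rw [integratedSymbol, integratedData, LinearMap.sum_apply, ← sub_eq_iff_eq_add,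
    ← Finset.sum_sub_distrib] at hS
  rw [← hS]
  refine Finset.sum_congr rfl fun k _ => ?_
  rw [LinearMap.smul_apply, ← smul_sub, ← map_sub, symbol_pow_eq, Module.End.mul_apply]

/-- The solution minus its Taylor part is a `2i`-fold time integral, by induction on `i`: in the
equation solved for its leading term, the term of index `k < m` carries at least two further time
integrals. -/
theorem sub_sum_mem_range {S F : Evolution E 𝕜} {Φ : ℕ → Evolution E 𝕜}
    (hS : integratedSymbol E 𝕜 a S = integratedData a F Φ) {i : ℕ} (hi : i ≤ m) :
    S - ∑ r ∈ Finset.range (2 * m), (timeIntegral E 𝕜 ^ r) (Φ r) ∈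
      LinearMap.range (timeIntegral E 𝕜 ^ (2 * i)) := by
  induction i with
  | zero => exact ⟨_, rfl⟩
  | succ i ih =>
    have hd := ih (Nat.le_of_succ_le hi)
    have hA : ∀ k < m, S - ∑ r ∈ Finset.range (2 * k), (timeIntegral E 𝕜 ^ r) (Φ r) ∈
        LinearMap.range (timeIntegral E 𝕜 ^ (min (2 * i) (2 * k))) := fun k hk => by
      have h := Finset.sum_range_add_sum_Ico (fun r => (timeIntegral E 𝕜 ^ r) (Φ r))
        (show 2 * k ≤ 2 * m by omega)
      have h' : S - ∑ r ∈ Finset.range (2 * k), (timeIntegral E 𝕜 ^ r) (Φ r) =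
          (S - ∑ r ∈ Finset.range (2 * m), (timeIntegral E 𝕜 ^ r) (Φ r)) +
            ∑ r ∈ Finset.Ico (2 * k) (2 * m), (timeIntegral E 𝕜 ^ r) (Φ r) := by
        rw [← h]
        abel
      rw [h']
      refine add_mem (range_timeIntegral_pow_anti (min_le_left _ _) hd) (sum_mem fun r hr => ?_)
      exact range_timeIntegral_pow_anti ((min_le_right _ _).trans (Finset.mem_Ico.1 hr).1)
        ⟨_, rfl⟩
    have h := sum_symbol_sub_eq hS
    rw [Finset.sum_range_succ, symbolCoeff_top, Nat.sub_self, mul_zero, pow_zero, pow_zero,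
      one_smul, Module.End.one_apply, Module.End.one_apply, ← eq_sub_iff_add_eq'] at h
    rw [h]
    refine sub_mem (range_timeIntegral_pow_anti (by omega) ⟨_, rfl⟩) (sum_mem fun k hk => ?_)
    have hk' := Finset.mem_range.1 hk
    refine Submodule.smul_mem _ _ (range_timeIntegral_pow_anti ?_
      (timeIntegral_pow_mem_range (spaceLaplacian_pow_mem_range (hA k hk') (m - k)) _))
    rcases min_choice (2 * i) (2 * k) with h | h <;> rw [h] <;> omega

/-- A solution of the integrated problem is `2m` times differentiable in time; the derivatives
`v k` are evolutions, they have the prescribed initial values, and they satisfy the equation. -/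
theorem exists_timeDerivatives {S F : Evolution E 𝕜} {Φ : ℕ → Evolution E 𝕜}
    (hS : integratedSymbol E 𝕜 a S = integratedData a F Φ) :
    ∃ v : ℕ → Evolution E 𝕜, v 0 = S ∧ (∀ k < 2 * m, v k = Φ k + timeIntegral E 𝕜 (v (k + 1))) ∧
      ∑ k ∈ Finset.range (m + 1), symbolCoeff a (2 * k) •
        (spaceLaplacian E 𝕜 ^ (m - k)) (v (2 * k)) = F := by
  obtain ⟨y, hy⟩ := sub_sum_mem_range hS le_rfl
  -- Differentiating `S = ∑ r < 2m, J ^ r Φ_r + J ^ (2m) y` formally `k` times gives `v k`.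
  refine ⟨fun k => ∑ r ∈ Finset.Ico k (2 * m), (timeIntegral E 𝕜 ^ (r - k)) (Φ r) +
    (timeIntegral E 𝕜 ^ (2 * m - k)) y, ?_, fun k hk => ?_, ?_⟩
  · simp only [Nat.sub_zero, hy, ← Finset.range_eq_Ico, add_sub_cancel]
  · simp only
    rw [Finset.sum_eq_sum_Ico_succ_bot hk, Nat.sub_self, pow_zero, Module.End.one_apply, map_add,
      map_sum, add_assoc]
    congr 2
    · refine Finset.sum_congr rfl fun r hr => ?_
      rw [← Module.End.mul_apply, ← pow_succ']
      congr 2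
      have := (Finset.mem_Ico.1 hr).1
      omega
    · rw [← Module.End.mul_apply, ← pow_succ']
      congr 2
      omega
  · refine timeIntegral_pow_injective (2 * m) ?_
    rw [← sum_symbol_sub_eq hS, map_sum]
    refine Finset.sum_congr rfl fun k hk => ?_
    have hk' : k ≤ m := Nat.lt_succ_iff.1 (Finset.mem_range.1 hk)
    have h1 : S - ∑ r ∈ Finset.range (2 * k), (timeIntegral E 𝕜 ^ r) (Φ r) =
        (timeIntegral E 𝕜 ^ (2 * k)) (∑ r ∈ Finset.Ico (2 * k) (2 * m),
          (timeIntegral E 𝕜 ^ (r - 2 * k)) (Φ r) + (timeIntegral E 𝕜 ^ (2 * m - 2 * k)) y) := by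
      rw [map_add, map_sum, ← Module.End.mul_apply, ← pow_add, Nat.add_sub_cancel' (by omega), hy,
        ← Finset.sum_range_add_sum_Ico (fun r => (timeIntegral E 𝕜 ^ r) (Φ r))
          (show 2 * k ≤ 2 * m by omega)]
      have h2 : ∑ r ∈ Finset.Ico (2 * k) (2 * m),
          (timeIntegral E 𝕜 ^ (2 * k)) ((timeIntegral E 𝕜 ^ (r - 2 * k)) (Φ r)) =
          ∑ r ∈ Finset.Ico (2 * k) (2 * m), (timeIntegral E 𝕜 ^ r) (Φ r) :=
        Finset.sum_congr rfl fun r hr => by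
          rw [← Module.End.mul_apply, ← pow_add, Nat.add_sub_cancel' (Finset.mem_Ico.1 hr).1]
      rw [h2]
      abel
    rw [h1, map_smul]
    congr 1
    have hc := ((commute_timeIntegral_spaceLaplacian (E := E) (𝕜 := 𝕜)).pow_pow (2 * k) (m - k)).eq
    rw [← Module.End.mul_apply (spaceLaplacian E 𝕜 ^ (m - k)) (timeIntegral E 𝕜 ^ (2 * k)), ← hc,
      Module.End.mul_apply, ← Module.End.mul_apply (timeIntegral E 𝕜 ^ (2 * (m - k))), ← pow_add,
      show 2 * (m - k) + 2 * k = 2 * m by omega]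

end TimeDerivatives

/-! ### Joint smoothness in position and time -/

section JointSmoothness

-- `E` lives in `Type`, so that replacing `W` by `E →L[ℝ] W` in an induction does not change the
-- universe.
variable {E : Type} [NormedAddCommGroup E] [InnerProductSpace ℝ E] [FiniteDimensional ℝ E]

/-- The derivatives in time and in the position commute. -/
theorem SmoothFamily.hasDerivAt_fderiv {W : Type*} [NormedAddCommGroup W] [NormedSpace ℝ W]
    [CompleteSpace W] {F G : ℝ → E → W} (hF : SmoothFamily F) (hG : SmoothFamily G)
    (h : ∀ t x, HasDerivAt (fun s => F s x) (G t x) t) (t : ℝ) (x : E) :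
    HasDerivAt (fun s => _root_.fderiv ℝ (F s) x) (_root_.fderiv ℝ (G t) x) t := by
  have h1 : ∀ s, F s = fun y => F 0 y + ∫ r in (0 : ℝ)..s, G r y := fun s => by
    funext y
    rw [intervalIntegral.integral_eq_sub_of_hasDerivAt (fun r _ => h r y)
      ((hG.continuous_left y).intervalIntegrable _ _)]
    abel
  have h2 : ∀ s, _root_.fderiv ℝ (F s) x =
      _root_.fderiv ℝ (F 0) x + ∫ r in (0 : ℝ)..s, _root_.fderiv ℝ (G r) x := fun s => by
    have hI : SmoothFamily fun s x => ∫ r in (0 : ℝ)..s, G r x :=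
      SmoothFamily.intervalIntegral (F := fun z : ℝ × ℝ => G z.2) (hG.comp continuous_snd)
        continuous_id
    rw [h1 s, _root_.fderiv_fun_add (hF.differentiable 0 x) (hI.differentiable s x),
      hG.fderiv_intervalIntegral s x]
  rw [show (fun s => _root_.fderiv ℝ (F s) x) = _ from funext h2]
  exact (hasDerivAt_primitive (hG.fderiv.continuous_left x) t).const_add _

/-- A smooth family whose first `N` time derivatives are smooth families is jointly of class
`C^N`. -/
theorem contDiff_uncurry_of_timeDerivatives (N : ℕ) {W : Type*} [NormedAddCommGroup W]
    [NormedSpace ℝ W] [CompleteSpace W] {v : ℕ → ℝ → E → W} (hv : ∀ k ≤ N, SmoothFamily (v k))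
    (h : ∀ k < N, ∀ t x, HasDerivAt (fun s => v k s x) (v (k + 1) t x) t) :
    ContDiff ℝ N fun p : E × ℝ => v 0 p.2 p.1 := by
  induction N generalizing W with
  | zero =>
    exact contDiff_zero.2 ((hv 0 le_rfl).continuous.comp
      (by fun_prop : Continuous fun p : E × ℝ => (p.2, p.1)))
  | succ N ih =>
    have hA := ih (v := fun k t => _root_.fderiv ℝ (v k t)) (fun k hk => (hv k (by omega)).fderiv)
      fun k hk => (hv k (by omega)).hasDerivAt_fderiv (hv (k + 1) (by omega)) (h k (by omega))
    have hB := ih (v := fun k => v (k + 1)) (fun k hk => hv (k + 1) (by omega))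
      fun k hk => h (k + 1) (by omega)
    have hswap : Continuous fun p : E × ℝ => (p.2, p.1) := by fun_prop
    refine contDiff_succ_iff_hasFDerivAt.2 ⟨fun p => (_root_.fderiv ℝ (v 0 p.2) p.1).comp
      (ContinuousLinearMap.fst ℝ E ℝ) +
      ((1 : ℝ →L[ℝ] ℝ).smulRight (v 1 p.2 p.1)).comp (ContinuousLinearMap.snd ℝ E ℝ), ?_, ?_⟩
    · exact (hA.clm_comp contDiff_const).add
        ((contDiff_const.smulRight hB).clm_comp contDiff_const)
    · rintro ⟨x, t⟩
      have h1 := hasStrictFDerivAt_uncurry_coprod (𝕜 := ℝ) (f := fun (x : E) (t : ℝ) => v 0 t x)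
        (u := (x, t)) (f₁ := fun x t => _root_.fderiv ℝ (v 0 t) x)
        (f₂ := fun x t => (1 : ℝ →L[ℝ] ℝ).smulRight (v 1 t x))
        (Eventually.of_forall fun z => ((hv 0 (by omega)).differentiable z.2 z.1).hasFDerivAt)
        (Eventually.of_forall fun z => (h 0 (by omega) z.2 z.1).hasFDerivAt)
        (((hv 0 (by omega)).fderiv.continuous.comp hswap).continuousAt)
        ((ContinuousLinearMap.smulRightL ℝ ℝ W 1).continuous.comp
          ((hv 1 (by omega)).continuous.comp hswap)).continuousAt
      refine h1.hasFDerivAt.congr_fderiv ?_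
      ext <;> simp [Function.HasUncurry.uncurry]

end JointSmoothness

/-! ### The formula solves the Cauchy problem -/

section Existence

variable {𝕜 : Type*} [RCLike 𝕜] {m n : ℕ} {a : Fin m → ℝ}

theorem iteratedDeriv_eq_of_hasDerivAt {W : Type*} [NormedAddCommGroup W] [NormedSpace ℝ W]
    {w : ℕ → ℝ → W} {N : ℕ} (h : ∀ k < N, ∀ t, HasDerivAt (w k) (w (k + 1) t) t) {k : ℕ}
    (hk : k ≤ N) : iteratedDeriv k (w 0) = w k := by
  induction k with
  | zero => rw [iteratedDeriv_zero]
  | succ k ih =>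
    rw [iteratedDeriv_succ, ih (by omega)]
    exact funext fun t => (h k (by omega) t).deriv

/-- A solution of the integrated problem is a classical solution of the Cauchy problem. -/
theorem isCauchySolution_of_integratedSymbol {f : EuclideanSpace ℝ (Fin n) → ℝ → 𝕜}
    {φ : ℕ → EuclideanSpace ℝ (Fin n) → 𝕜} {u : EuclideanSpace ℝ (Fin n) → ℝ → 𝕜}
    {S F : Evolution (EuclideanSpace ℝ (Fin n)) 𝕜} {Φ : ℕ → Evolution (EuclideanSpace ℝ (Fin n)) 𝕜}
    (hS : integratedSymbol _ 𝕜 a S = integratedData a F Φ)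
    (hF : ∀ t, 0 ≤ t → F t = fun x => f x t) (hΦ : ∀ r < 2 * m, ∀ t, Φ r t = φ r)
    (hu : ∀ x t, 0 ≤ t → u x t = S t x) : IsCauchySolution a f φ u := by
  obtain ⟨v, hv0, hvs, hveq⟩ := exists_timeDerivatives hS
  have hder : ∀ k < 2 * m, ∀ t x, HasDerivAt (fun s => v k s x) (v (k + 1) t x) t :=
    fun k hk t x => by
      have h1 : (fun s => v k s x) = fun s => φ k x + timeIntegral _ 𝕜 (v (k + 1)) s x := by
        funext s
        rw [hvs k hk, Evolution.add_apply, hΦ k hk]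
      rw [h1]
      exact (hasDerivAt_timeIntegral _ t x).const_add _
  have hjoint : ContDiff ℝ (2 * m : ℕ) fun p : EuclideanSpace ℝ (Fin n) × ℝ => v 0 p.2 p.1 :=
    contDiff_uncurry_of_timeDerivatives (2 * m) (v := fun k => v k)
      (fun k _ => (v k).smoothFamily) hder
  have hiter : ∀ k ≤ 2 * m, ∀ x, iteratedDeriv k (fun s => v 0 s x) = fun s => v k s x :=
    fun k hk x => iteratedDeriv_eq_of_hasDerivAt (w := fun k s => v k s x)
      (fun k hk t => hder k hk t x) hk
  refine ⟨?_, fun x t ht => ?_, fun r hr x => ?_⟩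
  · refine hjoint.contDiffOn.congr fun p hp => ?_
    rw [hv0]
    exact hu p.1 p.2 hp.2
  · have h1 : ∀ k ∈ Finset.range (m + 1),
        (fun y => iteratedDeriv (2 * k) (u y) t) = v (2 * k) t := fun k hk => by
      have hk' : k ≤ m := Nat.lt_succ_iff.1 (Finset.mem_range.1 hk)
      funext y
      have h2 : u y =ᶠ[𝓝 t] fun s => v 0 s y := by
        filter_upwards [lt_mem_nhds ht] with s hs
        rw [hv0]
        exact hu y s (le_of_lt hs)
      rw [h2.iteratedDeriv_eq, hiter _ (by omega)]
    have h3 : f x t = F t x := by rw [hF t ht.le]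
    rw [waveOp, h3, ← hveq, Evolution.sum_apply]
    refine Finset.sum_congr rfl fun k hk => ?_
    rw [h1 k hk, Evolution.smul_apply, spaceLaplacian_pow_apply]
  · have h1 : Set.EqOn (u x) (fun s => v 0 s x) (Ici 0) := fun s hs => by
      simp only [hv0]
      exact hu x s hs
    have h2 : ContDiff ℝ (2 * m : ℕ) fun s => v 0 s x :=
      hjoint.comp (contDiff_const.prodMk contDiff_id)
    have h3 : iteratedDerivWithin r (fun s => v 0 s x) (Ici 0) 0 =
        iteratedDeriv r (fun s => v 0 s x) 0 :=
      iteratedDerivWithin_eq_iteratedDeriv (uniqueDiffOn_Ici 0)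
        (h2.contDiffAt.of_le (by exact_mod_cast hr.le)) (mem_Ici.2 le_rfl)
    rw [iteratedDerivWithin_congr h1 (mem_Ici.2 le_rfl), h3, hiter r hr.le]
    simp only
    rw [hvs r hr, Evolution.add_apply, hΦ r hr, timeIntegral_apply,
      intervalIntegral.integral_same, add_zero]

end Existence

/-! ### Mollification in the position -/

section Mollify

variable {E : Type*} [NormedAddCommGroup E] [InnerProductSpace ℝ E] [FiniteDimensional ℝ E]
  [MeasurableSpace E] [BorelSpace E] {𝕜 : Type*} [RCLike 𝕜] {η : E → ℝ}

/-- The convolution of `w` with `η`. -/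
noncomputable def mollify (η : E → ℝ) (w : E → 𝕜) (x : E) : 𝕜 := ∫ y, η y • w (x - y)

theorem mollify_eq_integral_sub (η : E → ℝ) (w : E → 𝕜) (x : E) :
    mollify η w x = ∫ y, η (x - y) • w y := by
  rw [mollify, ← integral_sub_left_eq_self (fun y => η y • w (x - y)) volume x]
  simp only [sub_sub_cancel]

theorem mollify_eq_setIntegral (η : E → ℝ) (w : E → 𝕜) (x : E) :
    mollify η w x = ∫ y in tsupport η, η y • w (x - y) :=
  (setIntegral_eq_integral_of_forall_compl_eq_zero fun y hy => by
    rw [image_eq_zero_of_notMem_tsupport hy, zero_smul]).symm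

theorem integrable_mollify (hη : Continuous η) (hc : HasCompactSupport η) {w : E → 𝕜}
    (hw : Continuous w) (x : E) : Integrable fun y => η y • w (x - y) :=
  (hη.smul (hw.comp (by fun_prop))).integrable_of_hasCompactSupport hc.smul_right

theorem mollify_add (hη : Continuous η) (hc : HasCompactSupport η) {v w : E → 𝕜}
    (hv : Continuous v) (hw : Continuous w) (x : E) :
    mollify η (fun y => v y + w y) x = mollify η v x + mollify η w x := by
  simp only [mollify, smul_add]
  exact integral_add (integrable_mollify hη hc hv x) (integrable_mollify hη hc hw x)

theorem mollify_sum_smul {ι : Type*} (hη : Continuous η) (hc : HasCompactSupport η) (s : Finset ι)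
    (c : ι → ℝ) {w : ι → E → 𝕜} (hw : ∀ i ∈ s, Continuous (w i)) (x : E) :
    mollify η (fun y => ∑ i ∈ s, c i • w i y) x = ∑ i ∈ s, c i • mollify η (w i) x := by
  simp only [mollify, Finset.smul_sum, ← integral_smul]
  rw [integral_finsetSum]
  · simp only [smul_comm (c _)]
  · intro i hi
    simp only [smul_comm _ (c i)]
    exact (integrable_mollify hη hc (hw i hi) x).smul (c i)

theorem mollify_intervalIntegral (hη : Continuous η) (hc : HasCompactSupport η) {w : ℝ → E → 𝕜}
    (hw : Continuous fun z : ℝ × E => w z.1 z.2) (t : ℝ) (x : E) :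
    mollify η (fun y => ∫ s in (0 : ℝ)..t, w s y) x = ∫ s in (0 : ℝ)..t, mollify η (w s) x := by
  simp only [mollify_eq_setIntegral, ← intervalIntegral.integral_smul]
  symm
  refine intervalIntegral_integral_swap ?_
  have hcont : Continuous (uncurry fun (s : ℝ) (y : E) => η y • w s (x - y)) :=
    (hη.comp continuous_snd).smul (hw.comp (by fun_prop : Continuous fun z : ℝ × E =>
      (z.1, x - z.2)))
  rw [Measure.prod_restrict]
  exact (hcont.continuousOn.integrableOn_compact (isCompact_uIcc.prod hc)).mono_set
    (prod_mono uIoc_subset_uIcc subset_rfl)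

/-- Mollification in the position turns continuous functions of time and position into smooth
families: near a given point, the integral may be taken over a fixed ball, and the position enters
through `η`. -/
theorem smoothFamily_mollify (hη : ContDiff ℝ ∞ η) (hc : HasCompactSupport η) {w : ℝ → E → 𝕜}
    (hw : Continuous fun z : ℝ × E => w z.1 z.2) : SmoothFamily fun t => mollify η (w t) := by
  refine SmoothFamily.of_locally fun x₀ => ?_
  obtain ⟨R, hR⟩ := hc.isCompact.isBounded.subset_closedBall (0 : E)
  refine ⟨fun t x => ∫ y in Metric.closedBall x₀ (1 + R), η (x + -y) • w t y,
    SmoothFamily.setIntegral (X := ℝ) (Q := E) (F := fun z x => η (x + -z.2) • w z.1 z.2)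
      (isCompact_closedBall _ _) (SmoothFamily.smul_right (f := fun z x => η (x + -z.2))
        ((SmoothFamily.const (X := ℝ × E) hη).translate continuous_id
          (A := fun z : ℝ × E => -z.2) (by fun_prop)) hw), ?_⟩
  filter_upwards [Metric.ball_mem_nhds x₀ one_pos] with x hx t
  rw [mollify_eq_integral_sub]
  simp only [← sub_eq_add_neg]
  refine (setIntegral_eq_integral_of_forall_compl_eq_zero fun y hy => ?_).symm
  have h0 : x - y ∉ tsupport η := fun h => hy ?_
  · rw [image_eq_zero_of_notMem_tsupport h0, zero_smul]
  have h1 := mem_closedBall_zero_iff.1 (hR h)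
  have h2 : dist x x₀ < 1 := hx
  rw [Metric.mem_closedBall]
  calc dist y x₀ ≤ dist y x + dist x x₀ := dist_triangle _ _ _
    _ ≤ R + 1 := add_le_add (by rwa [dist_comm, dist_eq_norm]) h2.le
    _ = 1 + R := add_comm _ _

theorem laplacian_mollify (hη : Continuous η) (hc : HasCompactSupport η) {w : E → 𝕜}
    (hw : ContDiff ℝ 2 w) : Δ (mollify η w) = mollify η (Δ w) := by
  funext x
  have hw' : ContDiff ℝ 1 (fderiv ℝ w) := hw.fderiv_right (by norm_num)
  have hd : ∀ q, fderiv ℝ (fun x => η q • w (x + -q)) = fun x => η q • fderiv ℝ w (x + -q) :=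
    fun q => funext fun x => by
      have h : Differentiable ℝ fun x => w (x + -q) :=
        (hw.differentiable (by simp)).comp (by fun_prop : Differentiable ℝ fun x => x + -q)
      rw [fderiv_fun_const_smul (h x), fderiv_comp_add_right]
  have hdd : ∀ q, fderiv ℝ (fderiv ℝ fun x => η q • w (x + -q)) =
      fun x => η q • fderiv ℝ (fderiv ℝ w) (x + -q) :=
    fun q => funext fun x => by
      have h : Differentiable ℝ fun x => fderiv ℝ w (x + -q) :=
        (hw'.differentiable (by simp)).comp (by fun_prop : Differentiable ℝ fun x => x + -q)
      rw [hd, fderiv_fun_const_smul (h x), fderiv_comp_add_right]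
  have hshift : Continuous fun z : E × E => z.2 + -z.1 := by fun_prop
  have h := laplacian_setIntegral (μ := volume) hc.isCompact (F := fun q x => η q • w (x + -q))
    (fun q => (hw.comp (by fun_prop : ContDiff ℝ 2 fun x => x + -q)).const_smul (η q))
    ((hη.comp continuous_fst).smul (hw.continuous.comp hshift))
    (by simp only [hd]; exact (hη.comp continuous_fst).smul (hw'.continuous.comp hshift))
    (by simp only [hdd]
        exact (hη.comp continuous_fst).smul ((hw'.continuous_fderiv (by simp)).comp hshift)) x
  have h1 : mollify η w = fun x => ∫ q in tsupport η, η q • w (x + -q) := by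
    funext x
    simp only [mollify_eq_setIntegral, sub_eq_add_neg]
  rw [h1, h, mollify_eq_setIntegral]
  refine integral_congr_ae (Eventually.of_forall fun q => ?_)
  have h2 : ContDiff ℝ 2 fun x => w (x + -q) :=
    hw.comp (by fun_prop : ContDiff ℝ 2 fun x => x + -q)
  simp only
  rw [laplacian_const_smul (η q) h2,
    laplacian_comp_add_right, sub_eq_add_neg]

theorem contDiff_laplacian {w : E → 𝕜} {k : ℕ} (hw : ContDiff ℝ (k + 2 : ℕ) w) :
    ContDiff ℝ k (Δ w) := by
  have h1 : ContDiff ℝ (k + 1 : ℕ) (fderiv ℝ w) := hw.fderiv_right (by norm_cast)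
  have h2 : ContDiff ℝ k (fderiv ℝ (fderiv ℝ w)) := h1.fderiv_right (by norm_cast)
  rw [show Δ w = fun x => bilinTrace E 𝕜 (fderiv ℝ (fderiv ℝ w) x) from
    funext (laplacian_eq_bilinTrace w)]
  exact (bilinTrace E 𝕜).contDiff.comp h2

theorem contDiff_laplacian_iterate_of_le {w : E → 𝕜} {N : ℕ} (hw : ContDiff ℝ N w) {p k : ℕ}
    (h : 2 * p + k ≤ N) : ContDiff ℝ k (Δ^[p] w) := by
  induction p generalizing k with
  | zero => exact hw.of_le (by exact_mod_cast (by omega : k ≤ N))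
  | succ p ih =>
    rw [Function.iterate_succ_apply']
    exact contDiff_laplacian (ih (by omega))

theorem laplacian_iterate_mollify (hη : Continuous η) (hc : HasCompactSupport η) {w : E → 𝕜} {p : ℕ}
    (hw : ContDiff ℝ (2 * p : ℕ) w) : Δ^[p] (mollify η w) = mollify η (Δ^[p] w) := by
  have h : ∀ q ≤ p, Δ^[q] (mollify η w) = mollify η (Δ^[q] w) := by
    intro q hq
    induction q with
    | zero => rfl
    | succ q ih =>
      rw [Function.iterate_succ_apply', ih (by omega), laplacian_mollify hη hc
        (contDiff_laplacian_iterate_of_le (k := 2) hw (by omega)), Function.iterate_succ_apply']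
  exact h p le_rfl

/-- Continuous functions are determined by their mollifications. -/
theorem eq_of_mollify_eq {v w : E → 𝕜} (hv : Continuous v) (hw : Continuous w)
    (h : ∀ η : E → ℝ, ContDiff ℝ ∞ η → HasCompactSupport η → mollify η v 0 = mollify η w 0) :
    v = w := by
  have hv' : Continuous fun y => v (0 - y) := hv.comp (by fun_prop)
  have hw' : Continuous fun y => w (0 - y) := hw.comp (by fun_prop)
  have h1 := (hv'.ae_eq_iff_eq volume hw').1 (ae_eq_of_integral_contDiff_smul_eq
    hv'.locallyIntegrable hw'.locallyIntegrable h)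
  funext y
  simpa using congrFun h1 (-y)

end Mollify

/-! ### Time derivatives of classical solutions -/

section HalfSpace

variable {E : Type*} [NormedAddCommGroup E] [NormedSpace ℝ E] {W : Type*} [NormedAddCommGroup W]
  [NormedSpace ℝ W] {u : E → ℝ → W}

theorem hasDerivWithinAt_of_contDiffOn_halfSpace {j : ℕ}
    (hu : ContDiffOn ℝ (j + 1 : ℕ) (fun p : E × ℝ => u p.1 p.2) (univ ×ˢ Ici 0)) (x : E) {t : ℝ}
    (ht : 0 ≤ t) : HasDerivWithinAt (u x)
      (fderivWithin ℝ (fun p : E × ℝ => u p.1 p.2) (univ ×ˢ Ici 0) (x, t) (0, 1)) (Ici 0) t := by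
  have h1 := ((hu.differentiableOn (by simp)) (x, t) ⟨mem_univ _, ht⟩).hasFDerivWithinAt
  have h2 : HasDerivWithinAt (fun s : ℝ => (x, s)) (0, 1) (Ici 0) t :=
    ((hasDerivAt_const t x).prodMk (hasDerivAt_id t)).hasDerivWithinAt
  exact h1.comp_hasDerivWithinAt t h2 fun s hs => ⟨mem_univ _, hs⟩

theorem contDiffOn_iteratedDerivWithin {k j : ℕ}
    (hu : ContDiffOn ℝ (j + k : ℕ) (fun p : E × ℝ => u p.1 p.2) (univ ×ˢ Ici 0)) :
    ContDiffOn ℝ j (fun p : E × ℝ => iteratedDerivWithin k (u p.1) (Ici 0) p.2)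
      (univ ×ˢ Ici 0) := by
  induction k generalizing j with
  | zero => simpa only [iteratedDerivWithin_zero, Nat.add_zero] using hu
  | succ k ih =>
    have h := ih (j := j + 1) (by rwa [show j + 1 + k = j + (k + 1) by omega])
    have hs : UniqueDiffOn ℝ ((univ : Set E) ×ˢ Ici (0 : ℝ)) :=
      uniqueDiffOn_univ.prod (uniqueDiffOn_Ici 0)
    refine ((h.fderivWithin hs (m := j) (by norm_cast)).clm_apply
      (contDiffOn_const (c := ((0 : E), (1 : ℝ))))).congr fun p hp => ?_
    rw [iteratedDerivWithin_succ]
    exact (hasDerivWithinAt_of_contDiffOn_halfSpace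
        (u := fun x => iteratedDerivWithin k (u x) (Ici 0))
      h p.1 hp.2).derivWithin (uniqueDiffOn_Ici 0 p.2 hp.2)

theorem hasDerivWithinAt_iteratedDerivWithin {k N : ℕ} (hk : k < N)
    (hu : ContDiffOn ℝ N (fun p : E × ℝ => u p.1 p.2) (univ ×ˢ Ici 0)) (x : E) {t : ℝ}
    (ht : 0 ≤ t) : HasDerivWithinAt (iteratedDerivWithin k (u x) (Ici 0))
      (iteratedDerivWithin (k + 1) (u x) (Ici 0) t) (Ici 0) t := by
  obtain ⟨j, rfl⟩ : ∃ j, N = j + 1 + k := ⟨N - k - 1, by omega⟩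
  rw [iteratedDerivWithin_succ]
  exact (hasDerivWithinAt_of_contDiffOn_halfSpace
    (u := fun x => iteratedDerivWithin k (u x) (Ici 0))
    (contDiffOn_iteratedDerivWithin hu) x ht).differentiableWithinAt.hasDerivWithinAt

theorem contDiff_iteratedDerivWithin_left {k j : ℕ}
    (hu : ContDiffOn ℝ (j + k : ℕ) (fun p : E × ℝ => u p.1 p.2) (univ ×ˢ Ici 0)) {t : ℝ}
    (ht : 0 ≤ t) : ContDiff ℝ j fun x => iteratedDerivWithin k (u x) (Ici 0) t :=
  contDiffOn_univ.1 ((contDiffOn_iteratedDerivWithin hu).comp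
    (f := fun x => (x, t)) (contDiff_id.prodMk contDiff_const).contDiffOn
      fun _ _ => ⟨mem_univ _, ht⟩)

/-- One-sided time derivatives, extended to negative times by their values at time `0`. -/
theorem continuous_iteratedDerivWithin_max {k N : ℕ} (hk : k ≤ N)
    (hu : ContDiffOn ℝ N (fun p : E × ℝ => u p.1 p.2) (univ ×ˢ Ici 0)) :
    Continuous fun z : ℝ × E => iteratedDerivWithin k (u z.2) (Ici 0) (max z.1 0) := by
  obtain ⟨j, rfl⟩ : ∃ j, N = j + k := ⟨N - k, by omega⟩
  exact (contDiffOn_iteratedDerivWithin hu).continuousOn.comp_continuous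
    (by fun_prop : Continuous fun z : ℝ × E => (z.2, max z.1 0))
    fun z => ⟨mem_univ _, le_max_right z.1 0⟩

theorem iteratedDerivWithin_Ici_eq_iteratedDeriv {k N : ℕ} (hk : k ≤ N)
    (hu : ContDiffOn ℝ N (fun p : E × ℝ => u p.1 p.2) (univ ×ˢ Ici 0)) (x : E) {t : ℝ}
    (ht : 0 < t) : iteratedDerivWithin k (u x) (Ici 0) t = iteratedDeriv k (u x) t := by
  refine iteratedDerivWithin_eq_iteratedDeriv (uniqueDiffOn_Ici 0) ?_ ht.le
  have h : ContDiffOn ℝ N (u x) (Ici 0) := hu.comp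
    (f := fun s : ℝ => (x, s)) (contDiff_const.prodMk contDiff_id).contDiffOn
      fun _ hs => ⟨mem_univ _, hs⟩
  exact (h.contDiffAt (Ici_mem_nhds ht)).of_le (by exact_mod_cast hk)

theorem iteratedDerivWithin_eq_add_integral [CompleteSpace W] {k N : ℕ} (hk : k < N)
    (hu : ContDiffOn ℝ N (fun p : E × ℝ => u p.1 p.2) (univ ×ˢ Ici 0)) (x : E) {t : ℝ}
    (ht : 0 ≤ t) : iteratedDerivWithin k (u x) (Ici 0) t =
      iteratedDerivWithin k (u x) (Ici 0) 0 +
        ∫ s in (0 : ℝ)..t, iteratedDerivWithin (k + 1) (u x) (Ici 0) (max s 0) := by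
  have hd := fun s (hs : 0 ≤ s) => hasDerivWithinAt_iteratedDerivWithin hk hu x hs
  rw [intervalIntegral.integral_eq_sub_of_hasDeriv_right
    (f := iteratedDerivWithin k (u x) (Ici 0)), add_sub_cancel]
  · rw [uIcc_of_le ht]
    exact fun s hs => ((hd s hs.1).continuousWithinAt).mono Icc_subset_Ici_self
  · intro s hs
    rw [min_eq_left ht] at hs
    have h := (hd s hs.1.le).mono (Ioi_subset_Ici hs.1.le)
    rw [max_eq_left hs.1.le]
    exact ((hd s hs.1.le).hasDerivAt (Ici_mem_nhds hs.1)).hasDerivWithinAt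
  · exact ((continuous_iteratedDerivWithin_max hk hu).comp
      (by fun_prop : Continuous fun s : ℝ => (s, x))).intervalIntegrable _ _

end HalfSpace

/-! ### Uniqueness of classical solutions -/

section VanishingForward

variable {E : Type*} [NormedAddCommGroup E] [InnerProductSpace ℝ E] [FiniteDimensional ℝ E]
  [MeasurableSpace E] [BorelSpace E] {𝕜 : Type*} [RCLike 𝕜]

theorem timeIntegral_mem_vanishingForward {F : Evolution E 𝕜} (hF : F ∈ vanishingForward E 𝕜) :
    timeIntegral E 𝕜 F ∈ vanishingForward E 𝕜 := fun t ht => by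
  funext x
  rw [timeIntegral_apply, intervalIntegral.integral_congr (g := fun _ => 0)]
  · simp
  · intro s hs
    rw [uIcc_of_le ht] at hs
    simp only [hF s hs.1]
    rfl

theorem timeIntegral_pow_mem_vanishingForward {F : Evolution E 𝕜}
    (hF : F ∈ vanishingForward E 𝕜) (q : ℕ) :
    (timeIntegral E 𝕜 ^ q) F ∈ vanishingForward E 𝕜 := by
  induction q with
  | zero => exact hF
  | succ q ih =>
    rw [pow_succ', Module.End.mul_apply]
    exact timeIntegral_mem_vanishingForward ih

theorem spaceLaplacian_pow_mem_vanishingForward {F : Evolution E 𝕜}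
    (hF : F ∈ vanishingForward E 𝕜) (q : ℕ) :
    (spaceLaplacian E 𝕜 ^ q) F ∈ vanishingForward E 𝕜 := by
  induction q with
  | zero => exact hF
  | succ q ih =>
    rw [pow_succ', Module.End.mul_apply]
    intro t ht
    rw [spaceLaplacian_apply, ih t ht]
    exact InnerProductSpace.laplacian_const

theorem mem_vanishingForward_of_pos {F : Evolution E 𝕜} (hF : ∀ t x, 0 < t → F t x = 0) :
    F ∈ vanishingForward E 𝕜 := fun t ht => by
  funext x
  have h1 : closure (Ioi (0 : ℝ)) ⊆ {t | F t x = 0} :=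
    closure_minimal (fun t ht => hF t x ht) (isClosed_eq (F.continuous x) continuous_const)
  rw [closure_Ioi] at h1
  exact h1 ht

variable {m : ℕ} {a : Fin m → ℝ} {ν : ℕ}

/-- Evolutions `e k` which are successive derivatives in time, have vanishing initial values, and
satisfy the homogeneous equation, vanish forward in time. -/
theorem mem_vanishingForward_of_timeDerivatives (hE : Module.finrank ℝ E = 2 * ν + 3) (hm : 1 ≤ m)
    (ha_pos : ∀ i, 0 < a i) (ha_inj : Function.Injective a) {e : ℕ → Evolution E 𝕜}
    (hstep : ∀ k < 2 * m, e k - timeIntegral E 𝕜 (e (k + 1)) ∈ vanishingForward E 𝕜)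
    (heq : ∑ k ∈ Finset.range (m + 1), symbolCoeff a (2 * k) •
      (spaceLaplacian E 𝕜 ^ (m - k)) (e (2 * k)) ∈ vanishingForward E 𝕜) :
    e 0 ∈ vanishingForward E 𝕜 := by
  have hpow : ∀ k ≤ 2 * m, e 0 - (timeIntegral E 𝕜 ^ k) (e k) ∈ vanishingForward E 𝕜 := by
    intro k hk
    induction k with
    | zero =>
      rw [pow_zero, Module.End.one_apply, sub_self]
      exact zero_mem _
    | succ k ih =>
      have h := add_mem (ih (by omega))
        (timeIntegral_pow_mem_vanishingForward (hstep k (by omega)) k)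
      rwa [map_sub, sub_add_sub_cancel, ← Module.End.mul_apply, ← pow_succ] at h
  refine mem_vanishingForward_of_integratedSymbol hE hm ha_pos ha_inj ?_
  have h1 : integratedSymbol E 𝕜 a (e 0) =
      ∑ k ∈ Finset.range (m + 1), symbolCoeff a (2 * k) • (timeIntegral E 𝕜 ^ (2 * (m - k)))
        ((spaceLaplacian E 𝕜 ^ (m - k)) (e 0 - (timeIntegral E 𝕜 ^ (2 * k)) (e (2 * k)))) +
      (timeIntegral E 𝕜 ^ (2 * m)) (∑ k ∈ Finset.range (m + 1), symbolCoeff a (2 * k) •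
        (spaceLaplacian E 𝕜 ^ (m - k)) (e (2 * k))) := by
    rw [integratedSymbol, LinearMap.sum_apply, map_sum, ← Finset.sum_add_distrib]
    refine Finset.sum_congr rfl fun k hk => ?_
    have hk' : k ≤ m := Nat.lt_succ_iff.1 (Finset.mem_range.1 hk)
    have hc := LinearMap.congr_fun ((commute_timeIntegral_spaceLaplacian (E := E) (𝕜 := 𝕜)).pow_pow
      (2 * k) (m - k)).eq (e (2 * k))
    rw [Module.End.mul_apply, Module.End.mul_apply] at hc
    rw [LinearMap.smul_apply, symbol_pow_eq, Module.End.mul_apply, map_smul, ← smul_add, map_sub,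
      map_sub, ← hc, ← Module.End.mul_apply (timeIntegral E 𝕜 ^ (2 * (m - k)))
        (timeIntegral E 𝕜 ^ (2 * k)), ← pow_add,
      show 2 * (m - k) + 2 * k = 2 * m by omega, sub_add_cancel]
  rw [h1]
  refine add_mem (sum_mem fun k hk => Submodule.smul_mem _ _
    (timeIntegral_pow_mem_vanishingForward (spaceLaplacian_pow_mem_vanishingForward
      (hpow _ ?_) _) _)) (timeIntegral_pow_mem_vanishingForward heq _)
  have hk' : k < m + 1 := Finset.mem_range.1 hk
  omega

end VanishingForward

section Uniqueness

variable {𝕜 : Type*} [RCLike 𝕜] {m n ν : ℕ} {a : Fin m → ℝ}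

variable {f : EuclideanSpace ℝ (Fin n) → ℝ → 𝕜} {φ : ℕ → EuclideanSpace ℝ (Fin n) → 𝕜}
  {u : EuclideanSpace ℝ (Fin n) → ℝ → 𝕜}

/-- The mollified time derivatives of a classical solution; for negative times, the value at time
`0` is used. Derivatives of order greater than `2 m` do not occur and are replaced by `0`. -/
noncomputable def mollifiedDeriv (hu : IsCauchySolution a f φ u) {η : EuclideanSpace ℝ (Fin n) → ℝ}
    (hη : ContDiff ℝ ∞ η) (hc : HasCompactSupport η) (k : ℕ) :
    Evolution (EuclideanSpace ℝ (Fin n)) 𝕜 :=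
  if hk : k ≤ 2 * m then
    .mk (fun t => mollify η fun y => iteratedDerivWithin k (u y) (Ici 0) (max t 0))
      (smoothFamily_mollify hη hc (continuous_iteratedDerivWithin_max hk hu.contDiffOn))
  else 0

variable (hu : IsCauchySolution a f φ u) {η : EuclideanSpace ℝ (Fin n) → ℝ} (hη : ContDiff ℝ ∞ η)
  (hc : HasCompactSupport η)

theorem mollifiedDeriv_apply {k : ℕ} (hk : k ≤ 2 * m) (t : ℝ) :
    mollifiedDeriv hu hη hc k t =
      mollify η fun y => iteratedDerivWithin k (u y) (Ici 0) (max t 0) := by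
  rw [mollifiedDeriv, dif_pos hk]
  rfl

/-- The fundamental theorem of calculus for the time derivatives, mollified. -/
theorem mollifiedDeriv_eq_add {k : ℕ} (hk : k < 2 * m) {t : ℝ} (ht : 0 ≤ t)
    (x : EuclideanSpace ℝ (Fin n)) :
    mollifiedDeriv hu hη hc k t x =
      mollify η (φ k) x + timeIntegral _ 𝕜 (mollifiedDeriv hu hη hc (k + 1)) t x := by
  have hcont := continuous_iteratedDerivWithin_max (k := k + 1) (N := 2 * m) (by omega)
    hu.contDiffOn
  have h1 : (fun y => iteratedDerivWithin k (u y) (Ici 0) (max t 0)) = fun y => φ k y +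
      ∫ s in (0 : ℝ)..t, iteratedDerivWithin (k + 1) (u y) (Ici 0) (max s 0) := by
    funext y
    rw [max_eq_left ht, iteratedDerivWithin_eq_add_integral hk hu.contDiffOn y ht,
      hu.initial k hk]
  have h2 : Continuous (φ k) := by
    have h := (continuous_iteratedDerivWithin_max hk.le hu.contDiffOn).comp
      (by fun_prop : Continuous fun y : EuclideanSpace ℝ (Fin n) => ((0 : ℝ), y))
    refine h.congr fun y => ?_
    simp only [Function.comp_apply, max_self]
    exact hu.initial k hk y
  have h3 : Continuous fun y : EuclideanSpace ℝ (Fin n) =>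
      ∫ s in (0 : ℝ)..t, iteratedDerivWithin (k + 1) (u y) (Ici 0) (max s 0) := by
    have h := intervalIntegral.continuous_parametric_primitive_of_continuous (μ := volume)
      (a₀ := 0) (f := fun (y : EuclideanSpace ℝ (Fin n)) s =>
        iteratedDerivWithin (k + 1) (u y) (Ici 0) (max s 0))
      (hcont.comp (by fun_prop : Continuous fun z : EuclideanSpace ℝ (Fin n) × ℝ => (z.2, z.1)))
    exact h.comp (by fun_prop : Continuous fun y : EuclideanSpace ℝ (Fin n) => (y, t))
  rw [mollifiedDeriv_apply hu hη hc hk.le, h1, mollify_add hη.continuous hc h2 h3,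
    mollify_intervalIntegral hη.continuous hc hcont, timeIntegral_apply]
  simp only [mollifiedDeriv_apply hu hη hc (show k + 1 ≤ 2 * m from hk)]

/-- The equation, mollified; the derivatives in the position of a classical solution that occur in
it are continuous, so that they commute with the mollification. -/
theorem sum_laplacian_mollifiedDeriv {t : ℝ} (ht : 0 < t) (x : EuclideanSpace ℝ (Fin n)) :
    (∑ k ∈ Finset.range (m + 1), symbolCoeff a (2 * k) •
      (spaceLaplacian _ 𝕜 ^ (m - k)) (mollifiedDeriv hu hη hc (2 * k))) t x =
      mollify η (fun y => f y t) x := by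
  have hsmooth : ∀ k ≤ m, ContDiff ℝ (2 * (m - k) : ℕ)
      fun y => iteratedDerivWithin (2 * k) (u y) (Ici 0) t := fun k hk =>
    contDiff_iteratedDerivWithin_left
      (by rw [show 2 * (m - k) + 2 * k = 2 * m by omega]; exact hu.contDiffOn) ht.le
  have h1 : (fun y => f y t) = fun y => ∑ k ∈ Finset.range (m + 1), symbolCoeff a (2 * k) •
      (Δ^[m - k] fun y => iteratedDerivWithin (2 * k) (u y) (Ici 0) t) y := by
    funext y
    rw [← hu.equation y t ht, waveOp]
    refine Finset.sum_congr rfl fun k hk => ?_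
    have hk' : k ≤ m := Nat.lt_succ_iff.1 (Finset.mem_range.1 hk)
    simp only [iteratedDerivWithin_Ici_eq_iteratedDeriv (show 2 * k ≤ 2 * m by omega)
      hu.contDiffOn _ ht]
  rw [h1, mollify_sum_smul hη.continuous hc, Evolution.sum_apply]
  · refine Finset.sum_congr rfl fun k hk => ?_
    have hk' : k ≤ m := Nat.lt_succ_iff.1 (Finset.mem_range.1 hk)
    rw [Evolution.smul_apply, spaceLaplacian_pow_apply,
      mollifiedDeriv_apply hu hη hc (show 2 * k ≤ 2 * m by omega), max_eq_left ht.le,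
      laplacian_iterate_mollify hη.continuous hc (hsmooth k hk')]
  · intro k hk
    have hk' : k ≤ m := Nat.lt_succ_iff.1 (Finset.mem_range.1 hk)
    exact (contDiff_laplacian_iterate_of_le (k := 0) (hsmooth k hk') (by omega)).continuous

/-- Classical solutions of the Cauchy problem are unique at nonnegative times. -/
theorem IsCauchySolution.eq_of_nonneg (hn : n = 2 * ν + 3) (hm : 1 ≤ m) (ha_pos : ∀ i, 0 < a i)
    (ha_inj : Function.Injective a) {u₁ u₂ : EuclideanSpace ℝ (Fin n) → ℝ → 𝕜}
    (h₁ : IsCauchySolution a f φ u₁) (h₂ : IsCauchySolution a f φ u₂)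
    (x : EuclideanSpace ℝ (Fin n)) {t : ℝ} (ht : 0 ≤ t) : u₁ x t = u₂ x t := by
  have hE : Module.finrank ℝ (EuclideanSpace ℝ (Fin n)) = 2 * ν + 3 := by simp [hn]
  have hcont : ∀ {u : EuclideanSpace ℝ (Fin n) → ℝ → 𝕜}, IsCauchySolution a f φ u →
      Continuous fun y => u y t :=
    fun hu => hu.contDiffOn.continuousOn.comp_continuous
      (by fun_prop : Continuous fun y : EuclideanSpace ℝ (Fin n) => (y, t)) fun _ =>
        ⟨mem_univ _, ht⟩
  refine congrFun (eq_of_mollify_eq (hcont h₁) (hcont h₂) fun η hη hc => ?_) x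
  have hmem := mem_vanishingForward_of_timeDerivatives hE hm ha_pos ha_inj
    (e := fun k => mollifiedDeriv h₁ hη hc k - mollifiedDeriv h₂ hη hc k) (fun k hk t ht => by
      funext x
      rw [map_sub, Evolution.sub_apply, Evolution.sub_apply, Evolution.sub_apply,
        mollifiedDeriv_eq_add h₁ hη hc hk ht, mollifiedDeriv_eq_add h₂ hη hc hk ht,
        add_sub_add_left_eq_sub, sub_self]
      rfl) (mem_vanishingForward_of_pos fun t x ht => by
      simp only [map_sub, smul_sub, Finset.sum_sub_distrib]
      rw [Evolution.sub_apply, sum_laplacian_mollifiedDeriv h₁ hη hc ht,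
        sum_laplacian_mollifiedDeriv h₂ hη hc ht, sub_self])
  have h := congrFun (hmem t ht) 0
  simp only [Evolution.sub_apply, mollifiedDeriv_apply _ hη hc (Nat.zero_le _),
    iteratedDerivWithin_zero, max_eq_left ht] at h
  exact sub_eq_zero.1 h

end Uniqueness

/-! ### The Cauchy problem -/

section Main

variable {𝕜 : Type*} [RCLike 𝕜] {n : ℕ}

/-- A right-hand side given at nonnegative times, extended by its value at time `0`. -/
theorem smoothFamily_max {f : EuclideanSpace ℝ (Fin n) → ℝ → 𝕜}
    (hf_smooth : ∀ t, 0 ≤ t → ContDiff ℝ ∞ (fun y => f y t))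
    (hf_cont : ∀ k : ℕ, ContinuousOn
      (fun p : EuclideanSpace ℝ (Fin n) × ℝ => iteratedFDeriv ℝ k (fun y => f y p.2) p.1)
        (univ ×ˢ Ici 0)) :
    SmoothFamily fun t y => f y (max t 0) where
  contDiff t := hf_smooth _ (le_max_right _ _)
  continuous_iteratedFDeriv k := (hf_cont k).comp_continuous
    (by fun_prop : Continuous fun z : ℝ × EuclideanSpace ℝ (Fin n) => (z.2, max z.1 0))
    fun z => ⟨mem_univ _, le_max_right z.1 0⟩

end Main

end MultipleWave

theorem theorem3p6 {𝕜 : Type*} [RCLike 𝕜] (ν n m : ℕ) (hn : n = 2 * ν + 3) (hm : 1 ≤ m)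
    (a : Fin m → ℝ) (ha_pos : ∀ i, 0 < a i) (ha_inj : Function.Injective a)
    (f : EuclideanSpace ℝ (Fin n) → ℝ → 𝕜)
    (hf_smooth : ∀ t, 0 ≤ t → ContDiff ℝ ∞ (fun y => f y t))
    (hf_cont : ∀ k : ℕ, ContinuousOn
      (fun p : EuclideanSpace ℝ (Fin n) × ℝ => iteratedFDeriv ℝ k (fun y => f y p.2) p.1)
      (univ ×ˢ Ici 0))
    (φ : ℕ → EuclideanSpace ℝ (Fin n) → 𝕜)
    (hφ : ∀ r < 2 * m, ContDiff ℝ ∞ (φ r))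
    (u : EuclideanSpace ℝ (Fin n) → ℝ → 𝕜) :
    MultipleWave.IsCauchySolution a f φ u ↔
      ∀ x t, 0 ≤ t → u x t = MultipleWave.solutionFormula ν a f φ x t := by
  -- The right-hand side is only given at nonnegative times, while evolutions run through all times.
  let F : MultipleWave.Evolution (EuclideanSpace ℝ (Fin n)) 𝕜 :=
    .mk _ (MultipleWave.smoothFamily_max hf_smooth hf_cont)
  -- For `r ≥ 2m` the function `φ r` need not be smooth; it does not occur in the problem.
  let Φ : ℕ → MultipleWave.Evolution (EuclideanSpace ℝ (Fin n)) 𝕜 := fun r =>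
    if hr : r < 2 * m then .stationary (φ r) (hφ r hr) else 0
  have hF : ∀ t, 0 ≤ t → F t = fun x => f x t := fun t ht => by
    funext x
    change f x (max t 0) = f x t
    rw [max_eq_left ht]
  have hΦ : ∀ r (hr : r < 2 * m), Φ r = .stationary (φ r) (hφ r hr) := fun r hr => dif_pos hr
  have hE : Module.finrank ℝ (EuclideanSpace ℝ (Fin n)) = 2 * ν + 3 := by simp [hn]
  have hformula : ∀ x t, 0 ≤ t → MultipleWave.solutionFormula ν a f φ x t =
      MultipleWave.integratedResolvent _ 𝕜 a ν (MultipleWave.integratedData a F Φ) t x :=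
    fun x t ht => MultipleWave.solutionFormula_eq hn hm (fun i => (ha_pos i).ne') F hF hφ Φ hΦ ht x
  have hS : MultipleWave.integratedSymbol _ 𝕜 a
      (MultipleWave.integratedResolvent _ 𝕜 a ν (MultipleWave.integratedData a F Φ)) =
        MultipleWave.integratedData a F Φ :=
    LinearMap.congr_fun
      (MultipleWave.integratedSymbol_mul_integratedResolvent hE hm ha_pos ha_inj) _
  have hsol : ∀ u : EuclideanSpace ℝ (Fin n) → ℝ → 𝕜,
      (∀ x t, 0 ≤ t → u x t = MultipleWave.solutionFormula ν a f φ x t) →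
        MultipleWave.IsCauchySolution a f φ u := fun u hu =>
    MultipleWave.isCauchySolution_of_integratedSymbol hS hF
      (fun r hr t => by rw [hΦ r hr]; rfl) fun x t ht => (hu x t ht).trans (hformula x t ht)
  exact ⟨fun hu x t ht => hu.eq_of_nonneg hn hm ha_pos ha_inj
    (hsol (MultipleWave.solutionFormula ν a f φ) fun _ _ _ => rfl) x ht, hsol u⟩
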